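/- For real numbers $X,Y>0$ let $E_0(X;Y)$ denote the number of integers $n$ with $X/2<n\le X$ and $8\nmid n$ for which there are no positive integers $x_1,x_2,x_3,x_4$ with $n=x_1^2+x_2^2+x_3^2+x_4^2$ and $\max\{x_3,x_4\}\le Y$. Let $0<\delta<\tfrac1{11}$. Then there are positive real numbers $C$ and $X_0$, depending at most on $\delta$, such that for all real numbers $X\ge X_0$ and all real numbers $Y$ with $$(\log X)^{1/2}(\log\log X)^{3/2}\le Y\le(\log X)^{1/2+\delta}$$ one has $$E_0(X;Y)\le C\,X\,Y^{-2}(\log X)(\log\log X)^3 .$$ -/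

import Mathlib

/-- `n = x₁² + x₂² + x₃² + x₄²` with positive integers `x₁, x₂, x₃, x₄` such that
`max {x₃, x₄} ≤ Y`. -/
def IsMicroRep (n : ℕ) (Y : ℝ) (x₁ x₂ x₃ x₄ : ℕ) : Prop :=
  0 < x₁ ∧ 0 < x₂ ∧ 0 < x₃ ∧ 0 < x₄ ∧
    n = x₁ ^ 2 + x₂ ^ 2 + x₃ ^ 2 + x₄ ^ 2 ∧ ((max x₃ x₄ : ℕ) : ℝ) ≤ Y

/-- The integers `n` with `X / 2 < n ≤ X` and `8 ∤ n` that have no representation as a sum of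
four positive squares, the last two of them with roots at most `Y`. -/
def exceptionalSet (X Y : ℝ) : Set ℕ :=
  {n : ℕ | X / 2 < (n : ℝ) ∧ (n : ℝ) ≤ X ∧ ¬ 8 ∣ n ∧
    ¬ ∃ x₁ x₂ x₃ x₄ : ℕ, IsMicroRep n Y x₁ x₂ x₃ x₄}

/-- The exceptional set is finite, so that its `ncard` is its number of elements. -/
theorem exceptionalSet_finite (X Y : ℝ) : (exceptionalSet X Y).Finite :=
  (Set.finite_Iic ⌊X⌋₊).subset fun _ hn => Nat.le_floor hn.2.1

/-- The counting function `E₀(X; Y)`. -/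
noncomputable def E₀ (X Y : ℝ) : ℕ := (exceptionalSet X Y).ncard

/-! Circle method with Gaussian weights. Put η = 1/X, M = ⌊Y⌋, let θ(α) be the sum of
exp(-πηx²)e(αx²) over all integers x, and f(α) the same sum over 1 ≤ x ≤ M. The n-th Fourier
coefficient of θ²f² counts, with weight exp(-πηn), the representations of n by two integer squares
and two squares of positive integers up to M.

The square θ² is compared with a model (`modelSum`): a combination of kernels with poles near the
fractions u/q, q ≤ Q, whose Fourier coefficients are the truncated singular series for two squares.
If n is not represented, the n-th coefficient of (θ² - model)f² is exactly minus that of model·f².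
Summing over the two small squares turns the latter into about M² times the truncated singular
series for four squares, which is at least 1/8 when 8 ∤ n (`le_truncSingularSeries`,
`le_norm_sum_modelCoeff`). Bessel's inequality then bounds the number of such n, times M⁴, by a
constant times the integral of |θ² - model|²|f|⁴.

For the integral, Poisson summation at a/q gives |θ(a/q + β)|⁴ ≪ q⁻²(η² + β²)⁻¹, and by Dirichlet's
theorem every α has such an approximation with q ≤ √X. Near fractions with q ≤ Q the model cancels
the main term of θ². The fractions with q > Q remain; summing |f|⁴ over the translates by a/q
detects the congruence a² + b² ≡ c² + d² mod q, so the integral is governed by X times the sum of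
`quadCount M q / q` over Q < q ≤ √X. Equalities a² + b² = c² + d² contribute M²(log M)² log X.
Proper congruences force q ≤ 2M², so they cost no log X: they give M⁴(log M)²/Q + M³ log M
(`sum_quadCount_div_le`).

Altogether E₀ ≪ X M⁻² (log M)² (log X + M²/Q + M). With Q about M^(1/3) and M ≤ (log X)^(3/5), the
last bracket is ≪ log X, and log M ≤ log log X. -/

section

/-! ### The additive character and the size of quadratic Gauss sums -/

open Finset

/-- The additive character `t ↦ exp (2πit)` of the real line. -/
noncomputable def circExp (t : ℝ) : ℂ := Complex.exp (2 * Real.pi * t * Complex.I)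

theorem circExp_add (s t : ℝ) : circExp (s + t) = circExp s * circExp t := by
  rw [circExp, circExp, circExp, ← Complex.exp_add]
  push_cast
  ring_nf

theorem circExp_zero : circExp 0 = 1 := by simp [circExp]

theorem circExp_int (n : ℤ) : circExp n = 1 := by
  rw [circExp, Complex.exp_eq_one_iff]
  exact ⟨n, by push_cast; ring⟩

theorem circExp_add_int (t : ℝ) (n : ℤ) : circExp (t + n) = circExp t := by
  rw [circExp_add, circExp_int, mul_one]

theorem norm_circExp (t : ℝ) : ‖circExp t‖ = 1 := by
  have : circExp t = Complex.exp ((2 * Real.pi * t : ℝ) * Complex.I) := by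
    rw [circExp]; push_cast; ring_nf
  rw [this, Complex.norm_exp_ofReal_mul_I]

theorem conj_circExp (t : ℝ) : (starRingEnd ℂ) (circExp t) = circExp (-t) := by
  rw [circExp, circExp, ← Complex.exp_conj]
  simp [map_ofNat]

theorem continuous_circExp : Continuous circExp := by
  unfold circExp
  fun_prop

theorem circExp_nat_mul (k : ℕ) (t : ℝ) : circExp (k * t) = circExp t ^ k := by
  rw [circExp, circExp, ← Complex.exp_nat_mul]
  push_cast
  ring_nf

theorem circExp_div_eq_stdAddChar (q : ℕ) [NeZero q] (j : ℤ) :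
    circExp ((j : ℝ) / q) = ZMod.stdAddChar (j : ZMod q) := by
  rw [ZMod.stdAddChar_coe, circExp]
  push_cast
  ring_nf

theorem circExp_half_odd {j : ℤ} (hj : Odd j) : circExp ((j : ℝ) / 2) = -1 := by
  obtain ⟨k, rfl⟩ := hj
  have : (((2 * k + 1 : ℤ) : ℝ) / 2) = 1 / 2 + (k : ℤ) := by push_cast; ring
  rw [this, circExp_add_int, circExp]
  have : (2 * Real.pi * ((1 / 2 : ℝ) : ℂ) * Complex.I) = Real.pi * Complex.I := by
    push_cast; ring
  rw [this, Complex.exp_pi_mul_I]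

theorem sum_range_eq_sum_zmod (q : ℕ) [NeZero q] (f : ZMod q → ℂ) :
    ∑ x ∈ range q, f (x : ZMod q) = ∑ x : ZMod q, f x := by
  refine sum_bij (fun x _ => (x : ZMod q)) (fun _ _ => mem_univ _) ?_ ?_ (fun _ _ => rfl)
  · intro x hx y hy h
    have := congrArg ZMod.val h
    rwa [ZMod.val_natCast_of_lt (mem_range.1 hx), ZMod.val_natCast_of_lt (mem_range.1 hy)] at this
  · intro x _
    exact ⟨x.val, mem_range.2 (ZMod.val_lt x), by simp⟩

/-- The quadratic Gauss sum with a linear term. -/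
noncomputable def quadGauss (q : ℕ) (a k : ℤ) : ℂ :=
  ∑ x ∈ range q, circExp (((a * x ^ 2 + k * x : ℤ) : ℝ) / q)

theorem quadGauss_eq_zmod (q : ℕ) [NeZero q] (a k : ℤ) :
    quadGauss q a k = ∑ x : ZMod q, ZMod.stdAddChar ((a : ZMod q) * x ^ 2 + (k : ZMod q) * x) := by
  rw [← sum_range_eq_sum_zmod q, quadGauss]
  refine sum_congr rfl fun x _ => ?_
  rw [circExp_div_eq_stdAddChar]
  push_cast
  rfl

theorem conj_stdAddChar (q : ℕ) [NeZero q] (x : ZMod q) :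
    (starRingEnd ℂ) (ZMod.stdAddChar x) = ZMod.stdAddChar (-x) := by
  obtain ⟨j, rfl⟩ := ZMod.intCast_surjective x
  rw [← circExp_div_eq_stdAddChar, conj_circExp, ← Int.cast_neg, ← circExp_div_eq_stdAddChar]
  push_cast
  ring_nf

/-- Weyl differencing: with x = y + h the phase is linear in y, so the sum over y is q or 0 by
orthogonality. -/
theorem quadGauss_mul_conj (q : ℕ) [NeZero q] (a k : ℤ) :
    quadGauss q a k * (starRingEnd ℂ) (quadGauss q a k) =
      ∑ h : ZMod q, ZMod.stdAddChar ((a : ZMod q) * h ^ 2 + (k : ZMod q) * h) *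
        (if 2 * (a : ZMod q) * h = 0 then (q : ℂ) else 0) := by
  have key : ∀ h : ZMod q, ∑ y : ZMod q, ZMod.stdAddChar (y * (2 * (a : ZMod q) * h)) =
      if 2 * (a : ZMod q) * h = 0 then (q : ℂ) else 0 := by
    intro h
    rw [AddChar.sum_mulShift _ (ZMod.isPrimitive_stdAddChar q)]
    simp [ZMod.card]
  rw [quadGauss_eq_zmod, map_sum, sum_mul_sum, sum_comm]
  calc _ = ∑ y : ZMod q, ∑ h : ZMod q, ZMod.stdAddChar ((a : ZMod q) * h ^ 2 + (k : ZMod q) * h) *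
        ZMod.stdAddChar (y * (2 * (a : ZMod q) * h)) := by
        refine sum_congr rfl fun y _ => ?_
        rw [← Equiv.sum_comp (Equiv.addRight y)]
        refine sum_congr rfl fun h _ => ?_
        rw [conj_stdAddChar, ← AddChar.map_add_eq_mul, ← AddChar.map_add_eq_mul]
        congr 1
        simp only [Equiv.coe_addRight]
        ring
    _ = _ := by
        rw [sum_comm]
        refine sum_congr rfl fun h _ => ?_
        rw [← mul_sum, key]

theorem isUnit_intCast_zmod {q : ℕ} {a : ℤ} (h : IsCoprime a q) : IsUnit (a : ZMod q) := by
  obtain ⟨s, t, hst⟩ := h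
  have : ((s * a + t * q : ℤ) : ZMod q) = 1 := by rw [hst]; simp
  push_cast at this
  rw [ZMod.natCast_self, mul_zero, add_zero] at this
  exact IsUnit.of_mul_eq_one _ (by rw [mul_comm]; exact this)

theorem card_two_torsion_zmod_le (q : ℕ) [NeZero q] :
    #{h : ZMod q | 2 * h = 0} ≤ 2 := by
  have : ({h : ZMod q | 2 * h = 0} : Finset (ZMod q)) ⊆ {0, ((q / 2 : ℕ) : ZMod q)} := by
    intro h hh
    simp only [mem_filter, mem_univ, true_and] at hh
    have h1 : ((2 * h.val : ℕ) : ZMod q) = 0 := by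
      push_cast; rw [ZMod.natCast_zmod_val]; exact hh
    rw [ZMod.natCast_eq_zero_iff] at h1
    have h2 := ZMod.val_lt h
    obtain ⟨c, hc⟩ := h1
    have : c < 2 := by
      by_contra hcon
      have : q * 2 ≤ q * c := Nat.mul_le_mul_left q (by omega)
      omega
    simp only [mem_insert, mem_singleton]
    interval_cases c
    · left
      have : h.val = 0 := by omega
      exact (ZMod.val_eq_zero h).1 this
    · right
      have : q / 2 = h.val := by omega
      rw [this, ZMod.natCast_zmod_val]
  exact (card_le_card this).trans card_le_two

/-- At most two residues h satisfy 2h = 0, and each contributes modulus q. The uniformity in k is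
what controls all dual terms of Poisson summation at once. -/
theorem norm_quadGauss_sq_le {q : ℕ} (hq : 0 < q) {a : ℤ} (ha : IsCoprime a q) (k : ℤ) :
    ‖quadGauss q a k‖ ^ 2 ≤ 2 * q := by
  have : NeZero q := ⟨hq.ne'⟩
  have hu := isUnit_intCast_zmod ha
  have h1 : ‖quadGauss q a k * (starRingEnd ℂ) (quadGauss q a k)‖ = ‖quadGauss q a k‖ ^ 2 := by
    rw [norm_mul, RCLike.norm_conj, sq]
  rw [← h1, quadGauss_mul_conj]
  have h2 : ∀ h : ZMod q, 2 * (a : ZMod q) * h = 0 ↔ 2 * h = 0 := by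
    intro h
    rw [mul_comm 2, mul_assoc]
    exact ⟨fun H => (hu.mul_right_eq_zero).1 H, fun H => by rw [H, mul_zero]⟩
  calc _ ≤ ∑ h : ZMod q, ‖ZMod.stdAddChar ((a : ZMod q) * h ^ 2 + (k : ZMod q) * h) *
        (if 2 * (a : ZMod q) * h = 0 then (q : ℂ) else 0)‖ := norm_sum_le _ _
    _ = ∑ h : ZMod q, if 2 * h = 0 then (q : ℝ) else 0 := by
        refine sum_congr rfl fun h _ => ?_
        rw [norm_mul, AddChar.norm_apply, one_mul]
        simp only [h2]
        split_ifs <;> simp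
    _ = (#{h : ZMod q | 2 * h = 0} : ℝ) * q := by
        rw [← sum_filter, sum_const, nsmul_eq_mul]
    _ ≤ 2 * q := by
        gcongr
        exact_mod_cast card_two_torsion_zmod_le q

theorem quadGauss_mul_conj_of_odd {q : ℕ} (hq : Odd q) {a : ℤ} (ha : IsCoprime a q) (k : ℤ) :
    quadGauss q a k * (starRingEnd ℂ) (quadGauss q a k) = q := by
  have : NeZero q := ⟨by rintro rfl; simp at hq⟩
  have hu := isUnit_intCast_zmod ha
  have hu2 : IsUnit (2 : ZMod q) := by
    have := (ZMod.isUnit_iff_coprime 2 q).2 (Nat.coprime_two_left.2 hq)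
    exact_mod_cast this
  rw [quadGauss_mul_conj, sum_eq_single 0]
  · simp
  · intro h _ hh
    rw [if_neg, mul_zero]
    intro H
    exact hh (((hu2.mul hu).mul_right_eq_zero).1 H)
  · simp

/-- Minus one is a sum of two squares modulo every odd number. -/
theorem exists_sq_add_sq_eq_neg_one {q : ℕ} (hq : Odd q) :
    ∃ u v : ZMod q, u ^ 2 + v ^ 2 = -1 := by
  have hq0 : 0 < q := hq.pos
  have : NeZero (4 * q) := ⟨by omega⟩
  have hcop : Nat.Coprime 4 q := by
    rw [show 4 = 2 ^ 2 by norm_num]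
    exact (Nat.coprime_two_left.2 hq).pow_left 2
  -- By Dirichlet's theorem there is a prime p with p ≡ 1 mod 4 and p ≡ -1 mod q; writing p as a sum
  -- of two squares and reducing mod q gives u and v.
  obtain ⟨r, hr4, hrq⟩ := Nat.chineseRemainder hcop 1 (q - 1)
  have hu : IsUnit (r : ZMod (4 * q)) := by
    rw [ZMod.isUnit_iff_coprime]
    refine Nat.Coprime.mul_right ?_ ?_
    · rw [Nat.coprime_iff_gcd_eq_one, hr4.gcd_eq, Nat.gcd_one_left]
    · have h := hrq.gcd_eq
      rw [Nat.coprime_iff_gcd_eq_one, h]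
      rw [← Nat.coprime_iff_gcd_eq_one]
      have h3 : Nat.Coprime (q - 1) (1 + (q - 1)) := by simp
      rwa [Nat.add_sub_cancel' hq0] at h3
  obtain ⟨p, -, hp, hpr⟩ := Nat.forall_exists_prime_gt_and_eq_mod hu 0
  have : Fact p.Prime := ⟨hp⟩
  have hmod : p ≡ r [MOD 4 * q] := (ZMod.natCast_eq_natCast_iff _ _ _).1 hpr
  have h4 : p % 4 ≠ 3 := by
    have : p ≡ 1 [MOD 4] := (hmod.of_mul_right q).trans hr4
    rw [Nat.ModEq] at this
    omega
  obtain ⟨a, b, hab⟩ := Nat.Prime.sq_add_sq h4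
  refine ⟨a, b, ?_⟩
  have h5 : p ≡ q - 1 [MOD q] := (hmod.of_mul_left 4).trans hrq
  have h6 := (ZMod.natCast_eq_natCast_iff _ _ _).2 h5
  rw [← hab, Nat.cast_sub hq0, ZMod.natCast_self] at h6
  push_cast at h6
  rw [h6]; ring

end

/-! ### Fourth powers of quadratic Gauss sums -/

section

open Finset

theorem circExp_eq_of_eq_add_int {s t : ℝ} (n : ℤ) (h : s = t + n) : circExp s = circExp t := by
  rw [h, circExp_add_int]

theorem sum_range_shift_of_periodic {g : ℕ → ℂ} {n : ℕ} (hg : ∀ y, g (y + n) = g y) (j : ℕ) :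
    ∑ y ∈ range n, g (y + j) = ∑ y ∈ range n, g y := by
  induction j with
  | zero => rfl
  | succ j ih =>
    have h := sum_range_succ' (fun y => g (y + j)) n
    rw [sum_range_succ] at h
    rw [← ih]
    have h2 : g (n + j) = g (0 + j) := by rw [add_comm n, hg, zero_add]
    rw [h2] at h
    rw [add_right_cancel h]
    exact sum_congr rfl fun y _ => by rw [add_assoc, add_comm 1]

theorem sum_range_mul_of_periodic {g : ℕ → ℂ} {n : ℕ} (hg : ∀ y, g (y + n) = g y) (c : ℕ) :
    ∑ y ∈ range (c * n), g y = c * ∑ y ∈ range n, g y := by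
  have hg' : ∀ c y, g (y + c * n) = g y := by
    intro c
    induction c with
    | zero => simp
    | succ c ih => intro y; rw [add_mul, one_mul, ← add_assoc, hg, ih]
  induction c with
  | zero => simp
  | succ c ih =>
    rw [add_mul, one_mul, sum_range_add, ih]
    push_cast
    rw [add_mul, one_mul]
    congr 1
    exact sum_congr rfl fun y _ => by rw [add_comm, hg']

theorem sum_range_two_mul_of_periodic {f : ℕ → ℂ} {n : ℕ} (hf : ∀ y, f (y + 2 * n) = f y)
    {m : ℕ} (hm : Odd m) :
    ∑ x ∈ range (2 * n), f x =
      ∑ y ∈ range n, f (2 * y) + ∑ y ∈ range n, f (2 * y + m) := by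
  obtain ⟨j, rfl⟩ := hm
  have h1 : ∑ x ∈ range (2 * n), f x =
      ∑ y ∈ range n, f (2 * y) + ∑ y ∈ range n, f (2 * y + 1) := by
    clear hf
    induction n with
    | zero => simp
    | succ n ih =>
      rw [show 2 * (n + 1) = 2 * n + 1 + 1 by ring, sum_range_succ, sum_range_succ, ih,
        sum_range_succ, sum_range_succ]
      ring
  rw [h1]
  congr 1
  have h2 := sum_range_shift_of_periodic (g := fun y => f (2 * y + 1)) (n := n)
    (fun y => by
      rw [← hf (2 * y + 1)]; congr 1; ring) j
  rw [← h2]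
  refine sum_congr rfl fun y _ => ?_
  congr 1; ring

theorem quadGauss_zero_right (q : ℕ) (a : ℤ) :
    quadGauss q a 0 = ∑ x ∈ range q, circExp ((a : ℝ) * (x : ℝ) ^ 2 / q) := by
  refine sum_congr rfl fun x _ => ?_
  push_cast
  congr 2
  ring

theorem circExp_sq_div_periodic {q : ℕ} (hq : 0 < q) (a : ℤ) (y : ℕ) :
    circExp ((a : ℝ) * ((y + q : ℕ) : ℝ) ^ 2 / q) = circExp ((a : ℝ) * (y : ℝ) ^ 2 / q) := by
  have hq' : (q : ℝ) ≠ 0 := by positivity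
  refine circExp_eq_of_eq_add_int (a * (2 * y + q)) ?_
  push_cast
  field_simp
  ring

/-- The fourth power of a quadratic Gauss sum of modulus `q` is `gaussSign q * q ^ 2`. -/
def gaussSign (q : ℕ) : ℤ := if Odd q then 1 else if 4 ∣ q then -4 else 0

/-- The square of the Gauss sum is a sum over pairs (x, y) of a character of a(x² + y²). With u² +
v² = -1, the bijection (x, y) ↦ (ux + vy, vx - uy) negates x² + y², so the square equals its own
conjugate. -/
theorem quadGauss_sq_of_odd {q : ℕ} (hq : Odd q) {a : ℤ} :
    (starRingEnd ℂ) (quadGauss q a 0) ^ 2 = quadGauss q a 0 ^ 2 := by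
  have : NeZero q := ⟨by rintro rfl; simp at hq⟩
  obtain ⟨u, v, huv⟩ := exists_sq_add_sq_eq_neg_one hq
  have h1 : (starRingEnd ℂ) (quadGauss q a 0) =
      ∑ x : ZMod q, ZMod.stdAddChar (-((a : ZMod q) * x ^ 2)) := by
    rw [quadGauss_eq_zmod, map_sum]
    refine sum_congr rfl fun x _ => ?_
    rw [conj_stdAddChar]
    simp
  have h2 : quadGauss q a 0 = ∑ x : ZMod q, ZMod.stdAddChar ((a : ZMod q) * x ^ 2) := by
    rw [quadGauss_eq_zmod]
    simp
  let φ : ZMod q × ZMod q → ZMod q × ZMod q := fun p =>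
    (u * p.1 + v * p.2, v * p.1 - u * p.2)
  let φ' : ZMod q × ZMod q → ZMod q × ZMod q := fun p =>
    (-(u * p.1 + v * p.2), -(v * p.1 - u * p.2))
  have hbij : Function.Bijective φ := by
    refine Function.bijective_iff_has_inverse.2 ⟨φ', fun p => ?_, fun p => ?_⟩
    · ext
      · simp only [φ, φ']; linear_combination (-p.1) * huv
      · simp only [φ, φ']; linear_combination (-p.2) * huv
    · ext
      · simp only [φ, φ']; linear_combination (-p.1) * huv
      · simp only [φ, φ']; linear_combination (-p.2) * huv
  have h3 : ∀ b : ZMod q, (∑ x : ZMod q, ZMod.stdAddChar (b * x ^ 2)) ^ 2 =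
      ∑ p : ZMod q × ZMod q, ZMod.stdAddChar (b * (p.1 ^ 2 + p.2 ^ 2)) := by
    intro b
    rw [sq, sum_mul_sum, ← sum_product', univ_product_univ]
    refine sum_congr rfl fun p _ => ?_
    rw [← AddChar.map_add_eq_mul, mul_add]
  rw [h1, h2, h3]
  simp_rw [← neg_mul]
  rw [h3, ← hbij.sum_comp]
  refine sum_congr rfl fun p _ => ?_
  congr 1
  simp only [φ]
  linear_combination (-(a : ZMod q) * (p.1 ^ 2 + p.2 ^ 2)) * huv

/-- The square G² is real, so G⁴ = G²·conj(G)² = |G|⁴ = q². -/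
theorem quadGauss_pow_four_of_odd {q : ℕ} (hq : Odd q) {a : ℤ} (ha : IsCoprime a q) :
    quadGauss q a 0 ^ 4 = (q : ℂ) ^ 2 := by
  rw [← quadGauss_mul_conj_of_odd hq ha 0, mul_pow, quadGauss_sq_of_odd hq]
  ring

/-- The residues 2y and 2y + m cancel in pairs, their phases differing by am/2 with am odd. -/
theorem quadGauss_two_mul_odd {m : ℕ} (hm : Odd m) {a : ℤ} (ha : Odd a) :
    quadGauss (2 * m) a 0 = 0 := by
  have hm0 : 0 < m := hm.pos
  have hm' : (m : ℝ) ≠ 0 := by positivity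
  rw [quadGauss_zero_right, sum_range_two_mul_of_periodic
    (f := fun x : ℕ => circExp ((a : ℝ) * (x : ℝ) ^ 2 / (2 * m : ℕ)))
    (circExp_sq_div_periodic (by omega) a) hm, ← sum_add_distrib]
  refine sum_eq_zero fun y _ => ?_
  have h : (a : ℝ) * ((2 * y + m : ℕ) : ℝ) ^ 2 / (2 * m : ℕ) =
      (a : ℝ) * ((2 * y : ℕ) : ℝ) ^ 2 / (2 * m : ℕ) + ((a * m : ℤ) : ℝ) / 2 + (2 * a * y : ℤ) := by
    push_cast
    field_simp
    ring
  have hodd : Odd (a * m : ℤ) := ha.mul (by exact_mod_cast hm)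
  rw [h, circExp_add_int, circExp_add, circExp_half_odd hodd]
  ring

/-- The odd x cancel, since the shift x ↦ x + 4r changes the phase by ax/2 modulo 1. The even x = 2y
run through two periods of the sum to modulus 4r. -/
theorem quadGauss_sixteen_mul {r : ℕ} (hr : 0 < r) {a : ℤ} (ha : Odd a) :
    quadGauss (16 * r) a 0 = 2 * quadGauss (4 * r) a 0 := by
  have hr' : (r : ℝ) ≠ 0 := by positivity
  have h16 : 16 * r = 2 * (8 * r) := by ring
  have hper := circExp_sq_div_periodic (q := 16 * r) (by omega) a
  have hodd0 : ∑ y ∈ range (8 * r),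
      circExp ((a : ℝ) * ((2 * y + 1 : ℕ) : ℝ) ^ 2 / (16 * r : ℕ)) = 0 := by
    have h := sum_range_shift_of_periodic
      (g := fun y : ℕ => circExp ((a : ℝ) * ((2 * y + 1 : ℕ) : ℝ) ^ 2 / (16 * r : ℕ)))
      (n := 8 * r) (fun y => by
        have := hper (2 * y + 1)
        rw [← this]
        congr 5
        ring) (2 * r)
    have h2 : ∀ y : ℕ, circExp ((a : ℝ) * ((2 * (y + 2 * r) + 1 : ℕ) : ℝ) ^ 2 / (16 * r : ℕ)) =
        -circExp ((a : ℝ) * ((2 * y + 1 : ℕ) : ℝ) ^ 2 / (16 * r : ℕ)) := by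
      intro y
      have h3 : (a : ℝ) * ((2 * (y + 2 * r) + 1 : ℕ) : ℝ) ^ 2 / (16 * r : ℕ) =
          (a : ℝ) * ((2 * y + 1 : ℕ) : ℝ) ^ 2 / (16 * r : ℕ) + ((a * (2 * y + 1) : ℤ) : ℝ) / 2 +
            (a * r : ℤ) := by
        push_cast
        field_simp
        ring
      have hodd : Odd (a * (2 * y + 1) : ℤ) := ha.mul ⟨y, rfl⟩
      rw [h3, circExp_add_int, circExp_add, circExp_half_odd hodd]
      ring
    simp only [h2, sum_neg_distrib] at h
    exact self_eq_neg.1 h.symm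
  have hsplit := sum_range_two_mul_of_periodic
    (f := fun x : ℕ => circExp ((a : ℝ) * (x : ℝ) ^ 2 / (16 * r : ℕ))) (n := 8 * r) (m := 1)
    (fun y => by rw [← h16]; exact hper y) odd_one
  rw [quadGauss_zero_right, quadGauss_zero_right]
  rw [← h16] at hsplit
  rw [hsplit, hodd0, add_zero]
  have h4 := sum_range_mul_of_periodic (g := fun x : ℕ => circExp ((a : ℝ) * (x : ℝ) ^ 2 / (4 * r : ℕ)))
    (circExp_sq_div_periodic (q := 4 * r) (by omega) a) 2
  rw [← mul_assoc] at h4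
  norm_num at h4 ⊢
  rw [← h4]
  refine sum_congr rfl fun y _ => ?_
  congr 1
  field_simp
  ring

/-- Even residues are written 2y and odd ones 2y + m; in the latter the phase splits as ay²/m + am/4
modulo 1. Each class covers two periods modulo m. -/
theorem quadGauss_four_mul_odd {m : ℕ} (hm : Odd m) {a : ℤ} :
    quadGauss (4 * m) a 0 =
      2 * quadGauss m a 0 * (1 + circExp (((a * m : ℤ) : ℝ) / 4)) := by
  have hm0 : 0 < m := hm.pos
  have hm' : (m : ℝ) ≠ 0 := by positivity
  have h4 : 4 * m = 2 * (2 * m) := by ring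
  have hper := circExp_sq_div_periodic (q := 4 * m) (by omega) a
  have hsplit := sum_range_two_mul_of_periodic
    (f := fun x : ℕ => circExp ((a : ℝ) * (x : ℝ) ^ 2 / (4 * m : ℕ))) (n := 2 * m) (m := m)
    (fun y => by rw [← h4]; exact hper y) hm
  rw [← h4] at hsplit
  have h2 := sum_range_mul_of_periodic (g := fun x : ℕ => circExp ((a : ℝ) * (x : ℝ) ^ 2 / (m : ℕ)))
    (circExp_sq_div_periodic hm0 a) 2
  rw [quadGauss_zero_right, quadGauss_zero_right, hsplit, mul_add, mul_one]
  push_cast at h2 ⊢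
  rw [← h2, sum_mul]
  congr 1
  · refine sum_congr rfl fun y _ => ?_
    congr 1
    field_simp
    ring
  · refine sum_congr rfl fun y _ => ?_
    rw [← circExp_add]
    refine circExp_eq_of_eq_add_int (a * y) ?_
    push_cast
    field_simp
    ring

/-- Even residues give a multiple of the sum to modulus 2m, which vanishes. For odd residues 2y + m
the constant am/8 splits off, and the remaining phase a(y² + my)/(2m) reduces, on y even or odd
alike, to 2ay²/m modulo 1. -/
theorem quadGauss_eight_mul_odd {m : ℕ} (hm : Odd m) {a : ℤ} (ha : Odd a) :
    quadGauss (8 * m) a 0 =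
      4 * quadGauss m (2 * a) 0 * circExp (((a * m : ℤ) : ℝ) / 8) := by
  have hm0 : 0 < m := hm.pos
  have hm' : (m : ℝ) ≠ 0 := by positivity
  have h8 : 8 * m = 2 * (4 * m) := by ring
  have hper := circExp_sq_div_periodic (q := 8 * m) (by omega) a
  have hsplit := sum_range_two_mul_of_periodic
    (f := fun x : ℕ => circExp ((a : ℝ) * (x : ℝ) ^ 2 / (8 * m : ℕ))) (n := 4 * m) (m := m)
    (fun y => by rw [← h8]; exact hper y) hm
  rw [← h8] at hsplit
  have heven : ∑ y ∈ range (4 * m),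
      circExp ((a : ℝ) * ((2 * y : ℕ) : ℝ) ^ 2 / (8 * m : ℕ)) = 0 := by
    have h2 := sum_range_mul_of_periodic (g := fun x : ℕ => circExp ((a : ℝ) * (x : ℝ) ^ 2 / (2 * m : ℕ)))
      (circExp_sq_div_periodic (q := 2 * m) (by omega) a) 2
    have h0 := quadGauss_two_mul_odd hm ha
    rw [quadGauss_zero_right] at h0
    rw [h0, mul_zero, ← mul_assoc] at h2
    norm_num at h2 ⊢
    rw [← h2]
    refine sum_congr rfl fun y _ => ?_
    congr 1
    field_simp
    ring
  have hodd : ∑ y ∈ range (4 * m),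
      circExp ((a : ℝ) * ((2 * y + m : ℕ) : ℝ) ^ 2 / (8 * m : ℕ)) =
      (∑ y ∈ range (4 * m), circExp ((a : ℝ) * ((y : ℝ) ^ 2 + m * y) / (2 * m : ℕ))) *
        circExp (((a * m : ℤ) : ℝ) / 8) := by
    rw [sum_mul]
    refine sum_congr rfl fun y _ => ?_
    rw [← circExp_add]
    congr 1
    push_cast
    field_simp
    ring
  have hper2 : ∀ y : ℕ, circExp ((a : ℝ) * (((y + 2 * m : ℕ) : ℝ) ^ 2 + m * (y + 2 * m : ℕ)) /
      (2 * m : ℕ)) = circExp ((a : ℝ) * ((y : ℝ) ^ 2 + m * y) / (2 * m : ℕ)) := by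
    intro y
    refine circExp_eq_of_eq_add_int (a * (2 * y + 3 * m)) ?_
    push_cast
    field_simp
    ring
  have hq := sum_range_mul_of_periodic
    (g := fun y : ℕ => circExp ((a : ℝ) * ((y : ℝ) ^ 2 + m * y) / (2 * m : ℕ))) hper2 2
  have hq2 := sum_range_two_mul_of_periodic
    (f := fun y : ℕ => circExp ((a : ℝ) * ((y : ℝ) ^ 2 + m * y) / (2 * m : ℕ))) hper2 hm
  have h5 : ∑ y ∈ range m,
      circExp ((a : ℝ) * (((2 * y : ℕ) : ℝ) ^ 2 + m * (2 * y : ℕ)) / (2 * m : ℕ)) =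
      quadGauss m (2 * a) 0 := by
    rw [quadGauss_zero_right]
    refine sum_congr rfl fun y _ => ?_
    refine circExp_eq_of_eq_add_int (a * y) ?_
    push_cast
    field_simp
  have h6 : ∑ y ∈ range m,
      circExp ((a : ℝ) * (((2 * y + m : ℕ) : ℝ) ^ 2 + m * (2 * y + m : ℕ)) / (2 * m : ℕ)) =
      quadGauss m (2 * a) 0 := by
    rw [quadGauss_zero_right]
    refine sum_congr rfl fun y _ => ?_
    refine circExp_eq_of_eq_add_int (a * (3 * y + m)) ?_
    push_cast
    field_simp
    ring
  rw [h5, h6] at hq2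
  rw [quadGauss_zero_right, hsplit, heven, zero_add, hodd]
  rw [← mul_assoc] at hq
  norm_num at hq hq2 ⊢
  left
  rw [hq, hq2]
  ring

theorem one_add_circExp_quarter_pow_four {j : ℤ} (hj : Odd j) :
    (1 + circExp ((j : ℝ) / 4)) ^ 4 = -4 := by
  have h : circExp ((j : ℝ) / 4) ^ 2 = -1 := by
    rw [← circExp_half_odd hj, ← circExp_nat_mul]
    congr 1
    push_cast
    ring
  linear_combination (circExp ((j : ℝ) / 4) ^ 2 + 4 * circExp ((j : ℝ) / 4) + 5) * h

/-- The point is that the fourth power does not depend on a: the sums over numerators in the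
four-square singular series become Ramanujan sums. Odd moduli and moduli 2m, 4m, 8m with m odd are
explicit; a factor 16 descends to q/4, as (2G)⁴ = 16G⁴ matches the change in q². -/
theorem quadGauss_pow_four {q : ℕ} (hq : 0 < q) {a : ℤ} (ha : IsCoprime a q) :
    quadGauss q a 0 ^ 4 = (gaussSign q : ℂ) * (q : ℂ) ^ 2 := by
  induction q using Nat.strong_induction_on with
  | _ q ih =>
  rcases Nat.even_or_odd q with he | ho
  swap
  · rw [quadGauss_pow_four_of_odd ho ha, gaussSign, if_pos ho]
    simp
  have hnodd : ¬ Odd q := Nat.not_odd_iff_even.2 he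
  have haodd : Odd a := by
    have h2 : IsCoprime a (2 : ℤ) := ha.of_isCoprime_of_dvd_right (by exact_mod_cast he.two_dvd)
    exact Int.isCoprime_two_right.1 h2
  by_cases h4 : 4 ∣ q
  swap
  · obtain ⟨m, rfl⟩ := he.two_dvd
    have hm : Odd m := by
      rw [← Nat.not_even_iff_odd]
      rintro hm
      exact h4 (by obtain ⟨c, rfl⟩ := hm.two_dvd; exact ⟨c, by ring⟩)
    rw [quadGauss_two_mul_odd hm haodd, gaussSign, if_neg hnodd, if_neg h4]
    simp
  rw [gaussSign, if_neg hnodd, if_pos h4]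
  by_cases h16 : 16 ∣ q
  · obtain ⟨r, rfl⟩ := h16
    have hr : 0 < r := by omega
    have hcop : IsCoprime a ((4 * r : ℕ) : ℤ) :=
      ha.of_isCoprime_of_dvd_right (Int.natCast_dvd_natCast.2 ⟨4, by ring⟩)
    have := ih (4 * r) (by omega) (by omega) hcop
    rw [gaussSign, if_neg (by rw [Nat.not_odd_iff_even]; exact ⟨2 * r, by ring⟩),
      if_pos ⟨r, rfl⟩] at this
    rw [quadGauss_sixteen_mul hr haodd, mul_pow, this]
    push_cast
    ring
  obtain ⟨s, rfl⟩ := h4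
  rcases Nat.even_or_odd s with hs | hs
  · obtain ⟨m, rfl⟩ := hs.two_dvd
    have hm : Odd m := by
      rw [← Nat.not_even_iff_odd]
      rintro hm
      exact h16 (by obtain ⟨c, rfl⟩ := hm.two_dvd; exact ⟨c, by ring⟩)
    have h8 : 4 * (2 * m) = 8 * m := by ring
    rw [h8] at ha ⊢
    have hcop : IsCoprime (2 * a) (m : ℤ) := by
      refine IsCoprime.mul_left ?_ (ha.of_isCoprime_of_dvd_right (Int.natCast_dvd_natCast.2 ⟨8, by ring⟩))
      exact Int.isCoprime_two_left.2 (by exact_mod_cast hm)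
    have hodd : Odd (a * m : ℤ) := haodd.mul (by exact_mod_cast hm)
    have h9 : circExp (((a * m : ℤ) : ℝ) / 8) ^ 4 = -1 := by
      rw [← circExp_half_odd hodd, ← circExp_nat_mul]
      congr 1
      push_cast
      ring
    rw [quadGauss_eight_mul_odd hm haodd, mul_pow, mul_pow, quadGauss_pow_four_of_odd hm hcop, h9]
    push_cast
    ring
  · have hcop : IsCoprime a (s : ℤ) :=
      ha.of_isCoprime_of_dvd_right (Int.natCast_dvd_natCast.2 ⟨4, by ring⟩)
    have hodd : Odd (a * s : ℤ) := haodd.mul (by exact_mod_cast hs)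
    rw [quadGauss_four_mul_odd hs, mul_pow, mul_pow, quadGauss_pow_four_of_odd hs hcop,
      one_add_circExp_quarter_pow_four hodd]
    push_cast
    ring

end

/-! ### Ramanujan sums and the truncated four-square singular series -/

section

open Finset
open scoped ArithmeticFunction.Moebius

theorem sum_Ioc_divisorsAntidiagonal {R : Type*} [AddCommMonoid R] (f : ℕ → ℕ → R) (Q : ℕ) :
    ∑ q ∈ Ioc 0 Q, ∑ x ∈ q.divisorsAntidiagonal, f x.1 x.2 =
      ∑ d ∈ Ioc 0 Q, ∑ k ∈ Ioc 0 (Q / d), f d k := by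
  rw [sum_sigma', sum_sigma']
  refine sum_bij' (fun p _ => ⟨p.2.1, p.2.2⟩) (fun p _ => ⟨p.1 * p.2, (p.1, p.2)⟩) ?_ ?_ ?_ ?_ ?_
  · rintro ⟨q, d, k⟩ h
    simp only [mem_sigma, mem_Ioc, Nat.mem_divisorsAntidiagonal] at h ⊢
    obtain ⟨⟨h0, h1⟩, h2, h3⟩ := h
    subst h2
    have hd : 0 < d := Nat.pos_of_mul_pos_right h0
    have hk : 0 < k := Nat.pos_of_mul_pos_left h0
    exact ⟨⟨hd, (Nat.le_mul_of_pos_right d hk).trans h1⟩, hk,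
      (Nat.le_div_iff_mul_le hd).2 (by rwa [mul_comm])⟩
  · rintro ⟨d, k⟩ h
    simp only [mem_sigma, mem_Ioc, Nat.mem_divisorsAntidiagonal] at h ⊢
    have := (Nat.le_div_iff_mul_le h.1.1).1 h.2.2
    exact ⟨⟨Nat.mul_pos h.1.1 h.2.1, by rwa [mul_comm]⟩, trivial, (Nat.mul_pos h.1.1 h.2.1).ne'⟩
  · rintro ⟨q, d, k⟩ h
    simp only [mem_sigma, mem_Ioc, Nat.mem_divisorsAntidiagonal] at h
    obtain ⟨-, rfl, -⟩ := h
    rfl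
  · rintro ⟨d, k⟩ _
    rfl
  · rintro ⟨q, d, k⟩ _
    rfl

theorem sum_divisors_mul_of_coprime {R : Type*} [AddCommMonoid R] {a b : ℕ} (hab : a.Coprime b)
    (ha : a ≠ 0) (hb : b ≠ 0) (f : ℕ → R) :
    ∑ d ∈ (a * b).divisors, f d = ∑ x ∈ a.divisors, ∑ y ∈ b.divisors, f (x * y) := by
  rw [← sum_product']
  refine sum_bij' (fun d _ => (d.gcd a, d.gcd b)) (fun p _ => p.1 * p.2) ?_ ?_ ?_ ?_ ?_
  · intro d _
    simp [ha, hb, Nat.gcd_dvd_right]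
  · rintro ⟨x, y⟩ h
    simp only [mem_product, Nat.mem_divisors] at h ⊢
    exact ⟨Nat.mul_dvd_mul h.1.1 h.2.1, Nat.mul_ne_zero ha hb⟩
  · intro d hd
    rw [← hab.gcd_mul d]
    exact Nat.gcd_eq_left (Nat.dvd_of_mem_divisors hd)
  · rintro ⟨x, y⟩ h
    simp only [mem_product, Nat.mem_divisors] at h ⊢
    have h1 : Nat.Coprime y a := (hab.symm.coprime_dvd_left h.2.1)
    have h2 : Nat.Coprime x b := (hab.coprime_dvd_left h.1.1)
    rw [Nat.Coprime.gcd_mul_right_cancel x h1, Nat.Coprime.gcd_mul_left_cancel y h2,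
      Nat.gcd_eq_left h.1.1, Nat.gcd_eq_left h.2.1]
  · intro d hd
    rw [← hab.gcd_mul d, Nat.gcd_eq_left (Nat.dvd_of_mem_divisors hd)]

/-- The sum over the primitive residues `u` modulo `q` of `exp (-2πi n u / q)`. -/
noncomputable def ramanujanSum (q n : ℕ) : ℂ :=
  ∑ u ∈ range q with u.Coprime q, circExp (-((n * u : ℕ) : ℝ) / q)

theorem sum_range_circExp {q : ℕ} (hq : 0 < q) (n : ℤ) :
    ∑ u ∈ range q, circExp ((n * u : ℤ) / q : ℝ) = if (q : ℤ) ∣ n then (q : ℂ) else 0 := by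
  have : NeZero q := ⟨hq.ne'⟩
  calc _ = ∑ u ∈ range q, ZMod.stdAddChar ((u : ZMod q) * (n : ZMod q)) := by
        refine sum_congr rfl fun u _ => ?_
        have := circExp_div_eq_stdAddChar q (n * u)
        rw [this]
        push_cast
        rw [mul_comm]
    _ = _ := by
        rw [sum_range_eq_sum_zmod q (fun u => ZMod.stdAddChar (u * (n : ZMod q))),
          AddChar.sum_mulShift _ (ZMod.isPrimitive_stdAddChar q), ZMod.card]
        simp only [ZMod.intCast_zmod_eq_zero_iff_dvd]
        split_ifs <;> simp

theorem sum_moebius_divisors_gcd {u q : ℕ} (hq : 0 < q) :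
    (∑ d ∈ q.divisors with d ∣ u, (μ d : ℂ)) = if u.Coprime q then 1 else 0 := by
  have h1 : {d ∈ q.divisors | d ∣ u} = (u.gcd q).divisors := by
    ext d
    simp only [mem_filter, Nat.mem_divisors, Nat.dvd_gcd_iff]
    have h0 : u.gcd q ≠ 0 := Nat.gcd_ne_zero_right hq.ne'
    have h0' := hq.ne'
    tauto
  have h2 := congrArg (fun f => f (u.gcd q)) ArithmeticFunction.moebius_mul_coe_zeta
  simp only [ArithmeticFunction.coe_mul_zeta_apply, ArithmeticFunction.one_apply] at h2
  rw [h1]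
  have h3 := congrArg (Int.cast : ℤ → ℂ) h2
  push_cast at h3
  rw [h3]

/-- Möbius inversion removes the coprimality; the multiples u = dv then give a complete sum modulo e
= q/d, which is e or 0 according as e divides n. -/
theorem ramanujanSum_eq {q : ℕ} (hq : 0 < q) (n : ℕ) :
    ramanujanSum q n =
      ∑ x ∈ q.divisorsAntidiagonal, if x.1 ∣ n then (x.1 : ℂ) * (μ x.2 : ℂ) else 0 := by
  have h1 : ramanujanSum q n = ∑ u ∈ range q, ∑ d ∈ q.divisors,
      if d ∣ u then (μ d : ℂ) * circExp (-((n * u : ℕ) : ℝ) / q) else 0 := by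
    rw [ramanujanSum, sum_filter]
    refine sum_congr rfl fun u _ => ?_
    rw [← sum_filter, ← sum_mul, sum_moebius_divisors_gcd hq]
    split_ifs <;> simp
  have h3 := Nat.sum_divisorsAntidiagonal' (n := q)
    (f := fun e d => if e ∣ n then (e : ℂ) * (μ d : ℂ) else 0)
  rw [h1, sum_comm, h3]
  refine sum_congr rfl fun d hd => ?_
  obtain ⟨⟨e, rfl⟩, -⟩ := Nat.mem_divisors.1 hd
  have hd0 : 0 < d := Nat.pos_of_mul_pos_right hq
  have he0 : 0 < e := Nat.pos_of_mul_pos_left hq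
  rw [Nat.mul_div_cancel_left e hd0]
  have h2 : ∑ u ∈ range (d * e), (if d ∣ u then
      (μ d : ℂ) * circExp (-((n * u : ℕ) : ℝ) / (d * e : ℕ)) else 0) =
      ∑ v ∈ range e, (μ d : ℂ) * circExp (((-n : ℤ) * v : ℤ) / e : ℝ) := by
    rw [← sum_filter]
    refine (sum_bij (fun v _ => d * v) ?_ ?_ ?_ ?_).symm
    · intro v hv
      simp only [mem_filter, mem_range] at hv ⊢
      exact ⟨Nat.mul_lt_mul_of_pos_left hv hd0, Dvd.intro v rfl⟩
    · intro v _ w _ h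
      exact Nat.eq_of_mul_eq_mul_left hd0 h
    · intro u hu
      simp only [mem_filter, mem_range] at hu
      obtain ⟨v, rfl⟩ := hu.2
      exact ⟨v, mem_range.2 (Nat.lt_of_mul_lt_mul_left hu.1), rfl⟩
    · intro v _
      congr 2
      have : (d : ℝ) ≠ 0 := by positivity
      have : (e : ℝ) ≠ 0 := by positivity
      push_cast
      field_simp
  rw [h2, ← mul_sum, sum_range_circExp he0]
  simp only [dvd_neg, Int.natCast_dvd_natCast]
  split_ifs
  · ring
  · simp

/-- The sum of `μ k / k ^ 2` over the odd numbers `k ≤ K`. -/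
noncomputable def oddMoebiusSum (K : ℕ) : ℝ :=
  ∑ k ∈ Ioc 0 K, if Odd k then (μ k : ℝ) / (k : ℝ) ^ 2 else 0

/-- Telescoping: the term at k = 2j + 1 is at most 1/(4j(j + 1)) = 1/(4j) - 1/(4(j + 1)), and (K +
1)/2 is the number of odd integers up to K. -/
theorem abs_oddMoebiusSum_sub_one_le {K : ℕ} (hK : 1 ≤ K) :
    |oddMoebiusSum K - 1| ≤ 1 / 4 - 1 / (4 * ((K + 1) / 2 : ℕ)) := by
  induction K, hK using Nat.le_induction with
  | base => simp [oddMoebiusSum]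
  | succ K hK ih =>
    have hs : oddMoebiusSum (K + 1) = oddMoebiusSum K +
        if Odd (K + 1) then (μ (K + 1) : ℝ) / ((K + 1 : ℕ) : ℝ) ^ 2 else 0 := by
      rw [oddMoebiusSum, sum_Ioc_succ_top (Nat.zero_le K), oddMoebiusSum]
    rcases Nat.even_or_odd (K + 1) with he | ho
    · rw [hs, if_neg (Nat.not_odd_iff_even.2 he), add_zero]
      obtain ⟨j, hj⟩ := he
      have : (K + 1 + 1) / 2 = (K + 1) / 2 := by omega
      rwa [this]
    · rw [hs, if_pos ho]
      obtain ⟨j, hj⟩ := ho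
      have hj0 : 1 ≤ j := by omega
      have h1 : (K + 1 + 1) / 2 = j + 1 := by omega
      have h2 : (K + 1) / 2 = j := by omega
      rw [h1]
      rw [h2] at ih
      rw [hj]
      have hmu : |(μ (2 * j + 1) : ℝ)| ≤ 1 := by
        exact_mod_cast ArithmeticFunction.abs_moebius_le_one (n := 2 * j + 1)
      have hjr : (1 : ℝ) ≤ j := by exact_mod_cast hj0
      have h3 : |(μ (2 * j + 1) : ℝ) / ((2 * j + 1 : ℕ) : ℝ) ^ 2| ≤
          1 / (4 * j) - 1 / (4 * ((j + 1 : ℕ) : ℝ)) := by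
        rw [abs_div, abs_of_nonneg (by positivity : (0 : ℝ) ≤ ((2 * j + 1 : ℕ) : ℝ) ^ 2)]
        calc _ ≤ 1 / ((2 * j + 1 : ℕ) : ℝ) ^ 2 := by gcongr
          _ ≤ 1 / (4 * j * (j + 1)) := by
            apply one_div_le_one_div_of_le (by positivity)
            push_cast
            nlinarith
          _ = _ := by push_cast; field_simp; ring
      calc _ = |(oddMoebiusSum K - 1) + (μ (2 * j + 1) : ℝ) / ((2 * j + 1 : ℕ) : ℝ) ^ 2| := by
            congr 1; ring
        _ ≤ _ := abs_add_le _ _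
        _ ≤ _ := by linarith

theorem oddMoebiusSum_bounds {K : ℕ} (hK : 1 ≤ K) :
    3 / 4 ≤ oddMoebiusSum K ∧ oddMoebiusSum K ≤ 5 / 4 := by
  have h := abs_le.1 (abs_oddMoebiusSum_sub_one_le hK)
  have h0 : (0 : ℝ) ≤ 1 / (4 * ((K + 1) / 2 : ℕ)) := by positivity
  constructor <;> linarith [h.1, h.2]

theorem oddMoebiusSum_zero : oddMoebiusSum 0 = 0 := by simp [oddMoebiusSum]

theorem oddMoebiusSum_nonneg (K : ℕ) : 0 ≤ oddMoebiusSum K := by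
  rcases Nat.eq_zero_or_pos K with rfl | h
  · rw [oddMoebiusSum_zero]
  · linarith [(oddMoebiusSum_bounds h).1]

theorem oddMoebiusSum_le (K : ℕ) : oddMoebiusSum K ≤ 5 / 4 := by
  rcases Nat.eq_zero_or_pos K with rfl | h
  · rw [oddMoebiusSum_zero]; norm_num
  · exact (oddMoebiusSum_bounds h).2

theorem sum_Ioc_eq_sum_odd_add_even {f : ℕ → ℝ} (K : ℕ) :
    ∑ k ∈ Ioc 0 K, f k =
      ∑ k ∈ Ioc 0 K, (if Odd k then f k else 0) + ∑ k ∈ Ioc 0 (K / 2), f (2 * k) := by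
  induction K with
  | zero => simp
  | succ K ih =>
    rw [sum_Ioc_succ_top (Nat.zero_le K), sum_Ioc_succ_top (Nat.zero_le K), ih]
    rcases Nat.even_or_odd (K + 1) with he | ho
    · rw [if_neg (Nat.not_odd_iff_even.2 he)]
      obtain ⟨j, hj⟩ := he
      have h1 : (K + 1) / 2 = K / 2 + 1 := by omega
      have h2 : 2 * (K / 2 + 1) = K + 1 := by omega
      rw [h1, sum_Ioc_succ_top (Nat.zero_le _), h2]
      ring
    · rw [if_pos ho]
      obtain ⟨j, hj⟩ := ho
      have h1 : (K + 1) / 2 = K / 2 := by omega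
      rw [h1]
      ring

theorem gaussSign_mul_odd (d : ℕ) {k : ℕ} (hk : Odd k) : gaussSign (d * k) = gaussSign d := by
  have h1 : Odd (d * k) ↔ Odd d := by simp [Nat.odd_mul, hk]
  have h2 : 4 ∣ d * k ↔ 4 ∣ d := by
    refine ⟨fun h => ?_, fun h => h.mul_right k⟩
    refine Nat.Coprime.dvd_of_dvd_mul_right ?_ h
    rw [show 4 = 2 ^ 2 by norm_num]
    exact (Nat.coprime_two_left.2 hk).pow_left 2
  simp only [gaussSign, h1, h2]

theorem moebius_two_mul (k : ℕ) : (μ (2 * k) : ℝ) = if Odd k then -(μ k : ℝ) else 0 := by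
  split_ifs with hk
  · rw [ArithmeticFunction.isMultiplicative_moebius.map_mul_of_coprime
      (Nat.coprime_two_left.2 hk), ArithmeticFunction.moebius_apply_prime Nat.prime_two]
    simp
  · rw [ArithmeticFunction.moebius_eq_zero_of_not_squarefree]
    · simp
    · intro h
      obtain ⟨j, hj⟩ := (Nat.not_odd_iff_even.1 hk).two_dvd
      have := h 2 ⟨j, by rw [hj]; ring⟩
      exact absurd (Nat.isUnit_iff.1 this) (by norm_num)

/-- Only odd k and twice odd k survive the Möbius function, and an odd factor does not change
`gaussSign`. -/
theorem sum_gaussSign_moebius (d K : ℕ) :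
    ∑ k ∈ Ioc 0 K, (gaussSign (d * k) : ℝ) * (μ k : ℝ) / (k : ℝ) ^ 2 =
      gaussSign d * oddMoebiusSum K - gaussSign (2 * d) / 4 * oddMoebiusSum (K / 2) := by
  rw [sum_Ioc_eq_sum_odd_add_even, oddMoebiusSum, oddMoebiusSum, mul_sum, mul_sum,
    sub_eq_add_neg, ← sum_neg_distrib]
  congr 1
  · refine sum_congr rfl fun k _ => ?_
    split_ifs with hk
    · rw [gaussSign_mul_odd d hk]; ring
    · simp
  · refine sum_congr rfl fun k hk => ?_
    rw [moebius_two_mul]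
    split_ifs with hk
    · rw [show d * (2 * k) = 2 * d * k by ring, gaussSign_mul_odd _ hk]
      push_cast
      ring
    · simp

/-- The singular series of sums of four squares, truncated at `Q`. -/
noncomputable def truncSingularSeries (n Q : ℕ) : ℝ :=
  ∑ q ∈ Ioc 0 Q, (gaussSign q : ℝ) / (q : ℝ) ^ 2 *
    ∑ x ∈ q.divisorsAntidiagonal, if x.1 ∣ n then (x.1 : ℝ) * (μ x.2 : ℝ) else 0

/-- The contribution of the divisor `d` of `n` to the truncated singular series. -/
noncomputable def singularTerm (Q d : ℕ) : ℝ :=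
  (1 / (d : ℝ)) * (gaussSign d * oddMoebiusSum (Q / d) -
    gaussSign (2 * d) / 4 * oddMoebiusSum (Q / d / 2))

/-- With q = dk the sum over k decouples for each divisor d of n. Divisors d > Q may be kept, their
inner sums being empty. -/
theorem truncSingularSeries_eq {n : ℕ} (hn : n ≠ 0) (Q : ℕ) :
    truncSingularSeries n Q = ∑ d ∈ n.divisors, singularTerm Q d := by
  have h1 : truncSingularSeries n Q = ∑ q ∈ Ioc 0 Q, ∑ x ∈ q.divisorsAntidiagonal,
      (fun d k : ℕ => if d ∣ n then
        (1 / (d : ℝ)) * ((gaussSign (d * k) : ℝ) * (μ k : ℝ) / (k : ℝ) ^ 2) else 0) x.1 x.2 := by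
    refine sum_congr rfl fun q hq => ?_
    rw [mul_sum]
    refine sum_congr rfl fun x hx => ?_
    obtain ⟨hx1, hq0⟩ := Nat.mem_divisorsAntidiagonal.1 hx
    subst hx1
    have h1 : (x.1 : ℝ) ≠ 0 := by
      have := left_ne_zero_of_mul hq0
      exact_mod_cast this
    have h2 : (x.2 : ℝ) ≠ 0 := by
      have := right_ne_zero_of_mul hq0
      exact_mod_cast this
    simp only
    split_ifs
    · push_cast
      field_simp
    · simp
  rw [h1, sum_Ioc_divisorsAntidiagonal (fun d k : ℕ => if d ∣ n then
        (1 / (d : ℝ)) * ((gaussSign (d * k) : ℝ) * (μ k : ℝ) / (k : ℝ) ^ 2) else 0)]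
  have h2 : ∀ d, ∑ k ∈ Ioc 0 (Q / d), (if d ∣ n then
      (1 / (d : ℝ)) * ((gaussSign (d * k) : ℝ) * (μ k : ℝ) / (k : ℝ) ^ 2) else 0) =
      if d ∣ n then singularTerm Q d else 0 := by
    intro d
    split_ifs
    · rw [← mul_sum, sum_gaussSign_moebius, singularTerm]
    · simp
  simp only [h2]
  rw [← sum_filter]
  have hz : ∀ d, Q < d → singularTerm Q d = 0 := by
    intro d hd
    rw [singularTerm, Nat.div_eq_of_lt hd]
    simp [oddMoebiusSum_zero]
  refine sum_subset_zero_on_sdiff ?_ ?_ (fun _ _ => rfl)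
  · intro d hd
    simp only [mem_filter, Nat.mem_divisors] at hd ⊢
    exact ⟨hd.2, hn⟩
  · intro d hd
    simp only [mem_sdiff, mem_filter, Nat.mem_divisors, mem_Ioc, not_and] at hd
    refine hz d ?_
    by_contra hcon
    exact hd.2 ⟨Nat.pos_of_dvd_of_pos hd.1.1 (Nat.pos_of_ne_zero hn), by omega⟩ hd.1.1

/-- When 8 ∤ n every divisor of n has the form d, 2d or 4d with d odd; the common factor 1/d is
isolated so that the three can be compared. -/
theorem singularTerm_of_odd (Q : ℕ) {d : ℕ} (hd : Odd d) :
    singularTerm Q d = (1 / (d : ℝ)) * oddMoebiusSum (Q / d) ∧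
    singularTerm Q (2 * d) = (1 / (d : ℝ)) * (1 / 2 * oddMoebiusSum (Q / d / 4)) ∧
    singularTerm Q (4 * d) = (1 / (d : ℝ)) *
      (-oddMoebiusSum (Q / d / 4) + 1 / 4 * oddMoebiusSum (Q / d / 8)) := by
  have h1 : gaussSign d = 1 := by rw [gaussSign, if_pos hd]
  have h2 : gaussSign (2 * d) = 0 := by
    rw [gaussSign, if_neg (by simp), if_neg]
    obtain ⟨j, rfl⟩ := hd
    omega
  have h4 : gaussSign (2 * (2 * d)) = -4 := by
    rw [gaussSign, if_neg (by simp), if_pos ⟨d, by ring⟩]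
  have h4' : gaussSign (4 * d) = -4 := by
    rw [show 4 * d = 2 * (2 * d) by ring, h4]
  have h8 : gaussSign (2 * (4 * d)) = -4 := by
    rw [gaussSign, if_neg (by simp), if_pos ⟨2 * d, by ring⟩]
  have hd0 : (d : ℝ) ≠ 0 := by
    have := hd.pos.ne'
    exact_mod_cast this
  have e1 : Q / (2 * d) / 2 = Q / d / 4 := by
    rw [Nat.div_div_eq_div_mul, Nat.div_div_eq_div_mul]; congr 1; ring
  have e2 : Q / (4 * d) / 2 = Q / d / 8 := by
    rw [Nat.div_div_eq_div_mul, Nat.div_div_eq_div_mul]; congr 1; ring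
  have e3 : Q / (4 * d) = Q / d / 4 := by
    rw [Nat.div_div_eq_div_mul]; congr 1; ring
  refine ⟨?_, ?_, ?_⟩
  · rw [singularTerm, h1, h2]
    push_cast
    ring
  · rw [singularTerm, h2, h4, e1]
    push_cast
    field_simp
    ring
  · rw [singularTerm, h4', h8, e2, e3]
    push_cast
    field_simp
    ring

/-- Divisors are grouped by their odd part d. The only negative contribution, from 4d, is half
absorbed by 2d, so when d ≤ Q each group is at least 1/d times 3/4 - (1/2)(5/4) = 1/8; when d > Q
the group vanishes. All groups are nonnegative and d = 1 alone gives 1/8. -/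
theorem le_truncSingularSeries {n Q : ℕ} (hn : ¬ 8 ∣ n) (hQ : 1 ≤ Q) :
    1 / 8 ≤ truncSingularSeries n Q := by
  have hn0 : n ≠ 0 := by rintro rfl; simp at hn
  obtain ⟨k, m, hm, rfl⟩ := Nat.exists_eq_two_pow_mul_odd hn0
  have hk : k < 3 := by
    by_contra hcon
    exact hn ((pow_dvd_pow 2 (by omega : 3 ≤ k)).mul_right m)
  have hm0 : m ≠ 0 := hm.pos.ne'
  have hcop : Nat.Coprime (2 ^ k) m := (Nat.coprime_two_left.2 hm).pow_left k
  rw [truncSingularSeries_eq hn0, sum_divisors_mul_of_coprime hcop (by positivity) hm0, sum_comm]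
  have key : ∀ d ∈ m.divisors, 0 ≤ ∑ x ∈ (2 ^ k).divisors, singularTerm Q (x * d) ∧
      (d = 1 → 1 / 8 ≤ ∑ x ∈ (2 ^ k).divisors, singularTerm Q (x * d)) := by
    intro d hd
    have hdm := Nat.dvd_of_mem_divisors hd
    have hdo : Odd d := by
      rw [← Nat.not_even_iff_odd]
      intro he
      exact Nat.not_even_iff_odd.2 hm (he.trans_dvd hdm)
    have hd0 : (0 : ℝ) < d := by exact_mod_cast hdo.pos
    obtain ⟨t1, t2, t4⟩ := singularTerm_of_odd Q hdo
    have main : ∃ B : ℝ, ∑ x ∈ (2 ^ k).divisors, singularTerm Q (x * d) = (1 / (d : ℝ)) * B ∧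
        0 ≤ B ∧ (1 ≤ Q / d → 1 / 8 ≤ B) := by
      have p4 := oddMoebiusSum_nonneg (Q / d / 4)
      have p8 := oddMoebiusSum_nonneg (Q / d / 8)
      have u4 := oddMoebiusSum_le (Q / d / 4)
      have p1 := oddMoebiusSum_nonneg (Q / d)
      have b1 := fun h : 1 ≤ Q / d => (oddMoebiusSum_bounds h).1
      have z : ¬ 1 ≤ Q / d → oddMoebiusSum (Q / d / 4) = 0 := by
        intro h
        rw [Nat.lt_one_iff.1 (not_le.1 h), Nat.zero_div, oddMoebiusSum_zero]
      interval_cases k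
      · refine ⟨oddMoebiusSum (Q / d), ?_, p1, fun h => by linarith [b1 h]⟩
        simp [t1]
      · refine ⟨oddMoebiusSum (Q / d) + 1 / 2 * oddMoebiusSum (Q / d / 4), ?_, by positivity,
          fun h => by linarith [b1 h]⟩
        rw [show (2 ^ 1 : ℕ).divisors = {1, 2} by decide]
        rw [sum_pair (by norm_num), one_mul, t1, t2]
        ring
      · refine ⟨oddMoebiusSum (Q / d) + (1 / 2 * oddMoebiusSum (Q / d / 4) +
          (-oddMoebiusSum (Q / d / 4) + 1 / 4 * oddMoebiusSum (Q / d / 8))), ?_, ?_,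
          fun h => by linarith [b1 h]⟩
        · rw [show (2 ^ 2 : ℕ).divisors = {1, 2, 4} by decide]
          rw [sum_insert (by simp), sum_pair (by norm_num), one_mul, t1, t2, t4]
          ring
        · by_cases h : 1 ≤ Q / d
          · linarith [b1 h]
          · rw [z h]; linarith
    obtain ⟨B, hB, hB0, hB1⟩ := main
    rw [hB]
    refine ⟨by positivity, ?_⟩
    rintro rfl
    have := hB1 (by simpa using hQ)
    simpa using this
  have h1 : 1 ∈ m.divisors := Nat.one_mem_divisors.2 hm0
  exact ((key 1 h1).2 rfl).trans (single_le_sum (fun d hd => (key d hd).1) h1)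

end

/-! ### The theta series near rational points -/

section

open Finset

theorem hasSum_int_inv_sq : HasSum (fun k : ℤ => 1 / (k : ℝ) ^ 2) (Real.pi ^ 2 / 3) := by
  have h := hasSum_zeta_two
  -- The subtracted term at k = 0 is 1/0 = 0 by convention.
  have h2 : HasSum (fun k : ℤ => 1 / (k : ℝ) ^ 2)
      (Real.pi ^ 2 / 6 + Real.pi ^ 2 / 6 - 1 / ((0 : ℤ) : ℝ) ^ 2) := by
    refine HasSum.of_nat_of_neg ?_ ?_
    · simpa using h
    · simpa using h
  convert h2 using 1
  norm_num
  ring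

/-- Only exp(-t) ≤ 1/t is needed: quadratic decay makes the sum over nonzero k of size 1/ρ. -/
theorem exp_neg_mul_sq_le {ρ : ℝ} (hρ : 0 < ρ) {k : ℤ} (hk : k ≠ 0) :
    Real.exp (-(Real.pi * ρ * (k : ℝ) ^ 2)) ≤ 1 / (Real.pi * ρ) * (1 / (k : ℝ) ^ 2) := by
  have hk' : (k : ℝ) ≠ 0 := by exact_mod_cast hk
  have hpos : 0 < Real.pi * ρ * (k : ℝ) ^ 2 := by positivity
  rw [Real.exp_neg, one_div_mul_one_div, one_div]
  apply inv_anti₀ hpos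
  linarith [Real.add_one_le_exp (Real.pi * ρ * (k : ℝ) ^ 2)]

theorem summable_gaussian_int {ρ : ℝ} (hρ : 0 < ρ) :
    Summable fun k : ℤ => Real.exp (-(Real.pi * ρ * (k : ℝ) ^ 2)) := by
  have h1 : Summable fun k : ℤ =>
      1 / (Real.pi * ρ) * (1 / (k : ℝ) ^ 2) + (if k = 0 then 1 else 0 : ℝ) :=
    (hasSum_int_inv_sq.summable.mul_left _).add (hasSum_ite_eq 0 1).summable
  refine Summable.of_nonneg_of_le (fun k => (Real.exp_pos _).le) (fun k => ?_) h1
  by_cases hk : k = 0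
  · subst hk; simp
  · rw [if_neg hk, add_zero]
    exact exp_neg_mul_sq_le hρ hk

theorem inv_pi_mul_pi_sq_le {ρ : ℝ} (hρ : 0 < ρ) :
    1 / (Real.pi * ρ) * (Real.pi ^ 2 / 3) ≤ 2 / ρ := by
  have h : 1 / (Real.pi * ρ) * (Real.pi ^ 2 / 3) = (Real.pi / 3) / ρ := by
    have := Real.pi_ne_zero
    field_simp
  rw [h]
  gcongr
  linarith [Real.pi_lt_four]

/-- The terms of the theta series `∑ exp (-πηx²) exp (2πiαx²)`. -/
noncomputable def thetaTerm (η α : ℝ) (x : ℤ) : ℂ :=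
  (Real.exp (-(Real.pi * η * (x : ℝ) ^ 2)) : ℂ) * circExp (α * (x : ℝ) ^ 2)

/-- The theta series `∑ exp (-πηx²) exp (2πiαx²)`. -/
noncomputable def thetaSum (η α : ℝ) : ℂ := ∑' x : ℤ, thetaTerm η α x

theorem norm_thetaTerm (η α : ℝ) (x : ℤ) :
    ‖thetaTerm η α x‖ = Real.exp (-(Real.pi * η * (x : ℝ) ^ 2)) := by
  rw [thetaTerm, norm_mul, norm_circExp, mul_one, Complex.norm_real, Real.norm_eq_abs,
    abs_of_pos (Real.exp_pos _)]

theorem summable_norm_thetaTerm {η : ℝ} (hη : 0 < η) (α : ℝ) :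
    Summable fun x : ℤ => ‖thetaTerm η α x‖ := by
  simp only [norm_thetaTerm]
  exact summable_gaussian_int hη

theorem tsum_int_eq_sum_range_tsum {f : ℤ → ℂ} (hf : Summable f) {q : ℕ} (hq : 0 < q) :
    ∑' x : ℤ, f x = ∑ r ∈ range q, ∑' m : ℤ, f (r + q * m) := by
  have : NeZero q := ⟨hq.ne'⟩
  have hs : Summable fun p : ℤ × Fin q => f (p.2 + q * p.1) := by
    have := (Equiv.summable_iff (Int.divModEquiv q).symm).2 hf
    refine this.congr fun p => ?_
    simp [add_comm, mul_comm]
  rw [← (Int.divModEquiv q).symm.tsum_eq]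
  have h1 : ∀ p : ℤ × Fin q, f ((Int.divModEquiv q).symm p) = f (p.2 + q * p.1) := by
    intro p
    simp [add_comm, mul_comm]
  simp only [h1]
  have hs2 : Summable fun p : Fin q × ℤ => f (p.1 + q * p.2) := hs.prod_symm
  rw [← (Equiv.prodComm (Fin q) ℤ).tsum_eq]
  simp only [Equiv.prodComm_apply, Prod.fst_swap, Prod.snd_swap]
  rw [Summable.tsum_prod hs2, tsum_fintype]
  rw [← Fin.sum_univ_eq_sum_range (fun r => ∑' m : ℤ, f (r + q * m))]

/-- The Gaussian weights on the dual side of Poisson summation. -/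
noncomputable def dualTerm (w : ℂ) (k : ℤ) : ℂ := Complex.exp (-Real.pi * w * (k : ℂ) ^ 2)

theorem norm_dualTerm (w : ℂ) (k : ℤ) :
    ‖dualTerm w k‖ = Real.exp (-(Real.pi * w.re * (k : ℝ) ^ 2)) := by
  rw [dualTerm, Complex.norm_exp]
  congr 1
  have : (-Real.pi * w * (k : ℂ) ^ 2) = ((-(Real.pi * (k : ℝ) ^ 2) : ℝ) : ℂ) * w := by
    push_cast; ring
  rw [this, Complex.re_ofReal_mul]
  ring

theorem summable_norm_dualTerm {w : ℂ} (hw : 0 < w.re) : Summable fun k : ℤ => ‖dualTerm w k‖ := by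
  simp only [norm_dualTerm]
  exact summable_gaussian_int hw

theorem inv_re_pos {z : ℂ} (hz : 0 < z.re) : 0 < (z⁻¹).re := by
  rw [Complex.inv_re]
  have : z ≠ 0 := by rintro rfl; simp at hz
  exact div_pos hz (Complex.normSq_pos.2 this)

/-- Poisson summation after expanding (r + qm)²: completing the square on the dual side cancels
exp(-πzr²) and leaves the phase kr/q. -/
theorem tsum_gaussian_progression {z : ℂ} (hz : 0 < z.re) {q : ℕ} (hq : 0 < q) (r : ℕ) :
    ∑' m : ℤ, Complex.exp (-Real.pi * z * (r + q * m : ℂ) ^ 2) =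
      1 / ((q : ℂ) ^ 2 * z) ^ (1 / 2 : ℂ) *
        ∑' k : ℤ, circExp ((k * r : ℝ) / q) * dualTerm (((q : ℂ) ^ 2 * z)⁻¹) k := by
  have hq' : (q : ℂ) ≠ 0 := by exact_mod_cast hq.ne'
  have hz0 : z ≠ 0 := by rintro rfl; simp at hz
  have hre : 0 < ((q : ℂ) ^ 2 * z).re := by
    have : ((q : ℂ) ^ 2 * z) = (((q : ℝ) ^ 2 : ℝ) : ℂ) * z := by push_cast; ring
    rw [this, Complex.re_ofReal_mul]
    positivity
  have h := Complex.tsum_exp_neg_quadratic hre (-z * q * r)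
  have h1 : ∀ m : ℤ, Complex.exp (-Real.pi * z * (r + q * m : ℂ) ^ 2) =
      Complex.exp (-Real.pi * z * (r : ℂ) ^ 2) *
        Complex.exp (-Real.pi * ((q : ℂ) ^ 2 * z) * (m : ℂ) ^ 2 +
          2 * Real.pi * (-z * q * r) * m) := by
    intro m
    rw [← Complex.exp_add]
    congr 1
    ring
  have h2 : ∀ k : ℤ, circExp ((k * r : ℝ) / q) * dualTerm (((q : ℂ) ^ 2 * z)⁻¹) k =
      Complex.exp (-Real.pi * z * (r : ℂ) ^ 2) *
        Complex.exp (-Real.pi / ((q : ℂ) ^ 2 * z) * (k + Complex.I * (-z * q * r)) ^ 2) := by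
    intro k
    rw [circExp, dualTerm, ← Complex.exp_add, ← Complex.exp_add]
    congr 1
    have hI : Complex.I ^ 2 = -1 := Complex.I_sq
    push_cast
    field_simp
    ring_nf
    rw [hI]
    ring
  simp only [h1, h2]
  rw [tsum_mul_left, tsum_mul_left, h]
  ring

/-- On a residue class r mod q the phase ax²/q is constant. Poisson summation on each class produces
phases kr/q, and the sum over r assembles them into a Gauss sum with linear term k. -/
theorem thetaSum_add_div {η : ℝ} (hη : 0 < η) (β : ℝ) {q : ℕ} (hq : 0 < q) (a : ℤ) :
    thetaSum η (a / q + β) =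
      1 / ((q : ℂ) ^ 2 * (η - 2 * β * Complex.I)) ^ (1 / 2 : ℂ) *
        ∑' k : ℤ, quadGauss q a k * dualTerm (((q : ℂ) ^ 2 * (η - 2 * β * Complex.I))⁻¹) k := by
  set z : ℂ := η - 2 * β * Complex.I with hzdef
  have hzre : z.re = η := by simp [hzdef]
  have hz : 0 < z.re := by rw [hzre]; exact hη
  have hq' : (q : ℝ) ≠ 0 := by exact_mod_cast hq.ne'
  have hwre : 0 < (((q : ℂ) ^ 2 * z)⁻¹).re := by
    apply inv_re_pos
    have : ((q : ℂ) ^ 2 * z) = (((q : ℝ) ^ 2 : ℝ) : ℂ) * z := by push_cast; ring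
    rw [this, Complex.re_ofReal_mul]
    positivity
  rw [thetaSum, tsum_int_eq_sum_range_tsum (summable_norm_thetaTerm hη _).of_norm hq]
  have h1 : ∀ r : ℕ, ∀ m : ℤ, thetaTerm η (a / q + β) (r + q * m) =
      circExp ((a : ℝ) * (r : ℝ) ^ 2 / q) *
        Complex.exp (-Real.pi * z * (r + q * m : ℂ) ^ 2) := by
    intro r m
    have e1 : circExp ((a / q + β) * ((r + q * m : ℤ) : ℝ) ^ 2) =
        circExp ((a : ℝ) * (r : ℝ) ^ 2 / q) * circExp (β * (r + q * m : ℝ) ^ 2) := by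
      rw [← circExp_add]
      refine circExp_eq_of_eq_add_int (a * (2 * r * m + q * m ^ 2)) ?_
      push_cast
      field_simp
      ring
    rw [thetaTerm, e1, mul_left_comm]
    congr 1
    rw [circExp, Complex.ofReal_exp, ← Complex.exp_add]
    congr 1
    rw [hzdef]
    push_cast
    ring
  simp only [h1, tsum_mul_left]
  simp only [tsum_gaussian_progression hz hq]
  have h2 : ∀ r : ℕ, circExp ((a : ℝ) * (r : ℝ) ^ 2 / q) *
      (1 / ((q : ℂ) ^ 2 * z) ^ (1 / 2 : ℂ) *
        ∑' k : ℤ, circExp ((k * r : ℝ) / q) * dualTerm (((q : ℂ) ^ 2 * z)⁻¹) k) =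
      1 / ((q : ℂ) ^ 2 * z) ^ (1 / 2 : ℂ) *
        ∑' k : ℤ, circExp ((a : ℝ) * (r : ℝ) ^ 2 / q) *
          (circExp ((k * r : ℝ) / q) * dualTerm (((q : ℂ) ^ 2 * z)⁻¹) k) := by
    intro r
    rw [tsum_mul_left]
    ring
  simp only [h2]
  rw [← mul_sum]
  congr 1
  rw [← Summable.tsum_finsetSum]
  · refine tsum_congr fun k => ?_
    rw [quadGauss, sum_mul]
    refine sum_congr rfl fun r _ => ?_
    rw [← mul_assoc, ← circExp_add]
    congr 2
    push_cast
    ring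
  · intro r _
    refine Summable.mul_left _ (Summable.of_norm ?_)
    simp only [norm_mul, norm_circExp, one_mul]
    exact summable_norm_dualTerm hwre

/-- The dual theta series, weighted by Gauss sums. -/
noncomputable def dualSum (q : ℕ) (a : ℤ) (w : ℂ) : ℂ := ∑' k : ℤ, quadGauss q a k * dualTerm w k

theorem norm_quadGauss_le {q : ℕ} (hq : 0 < q) {a : ℤ} (ha : IsCoprime a q) (k : ℤ) :
    ‖quadGauss q a k‖ ≤ √(2 * q) :=
  Real.le_sqrt_of_sq_le (norm_quadGauss_sq_le hq ha k)

/-- The frequency k = 0 carries the main term; the others share the bound √(2q) for the Gauss sum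
and are summed with weights 1/k². -/
theorem norm_dualSum_sub_le {q : ℕ} (hq : 0 < q) {a : ℤ} (ha : IsCoprime a q) {w : ℂ}
    (hw : 0 < w.re) : ‖dualSum q a w - quadGauss q a 0‖ ≤ √(2 * q) * (2 / w.re) := by
  have hn : ∀ k, ‖quadGauss q a k * dualTerm w k‖ ≤ √(2 * q) * ‖dualTerm w k‖ := by
    intro k
    rw [norm_mul]
    gcongr
    exact norm_quadGauss_le hq ha k
  have hs : Summable fun k => quadGauss q a k * dualTerm w k :=
    Summable.of_norm_bounded ((summable_norm_dualTerm hw).mul_left _) hn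
  have h0 : quadGauss q a 0 * dualTerm w 0 = quadGauss q a 0 := by simp [dualTerm]
  rw [dualSum, hs.tsum_eq_add_tsum_ite 0, h0, add_sub_cancel_left]
  have hb : HasSum (fun k : ℤ => √(2 * q) * (1 / (Real.pi * w.re) * (1 / (k : ℝ) ^ 2)))
      (√(2 * q) * (1 / (Real.pi * w.re) * (Real.pi ^ 2 / 3))) :=
    (hasSum_int_inv_sq.mul_left _).mul_left _
  calc _ ≤ √(2 * q) * (1 / (Real.pi * w.re) * (Real.pi ^ 2 / 3)) := by
        refine tsum_of_norm_bounded hb fun k => ?_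
        split_ifs with hk
        · rw [norm_zero]; positivity
        · refine (hn k).trans ?_
          gcongr
          rw [norm_dualTerm]
          exact exp_neg_mul_sq_le hw hk
    _ ≤ _ := by
        gcongr
        exact inv_pi_mul_pi_sq_le hw

theorem norm_dualSum_le {q : ℕ} (hq : 0 < q) {a : ℤ} (ha : IsCoprime a q) {w : ℂ}
    (hw : 0 < w.re) : ‖dualSum q a w‖ ≤ √(2 * q) * (1 + 2 / w.re) := by
  have h1 := norm_dualSum_sub_le hq ha hw
  have h2 := norm_quadGauss_le hq ha 0
  have h3 := norm_add_le (dualSum q a w - quadGauss q a 0) (quadGauss q a 0)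
  rw [sub_add_cancel] at h3
  linarith

theorem norm_sub_two_mul_I_sq (η β : ℝ) :
    ‖(η : ℂ) - 2 * β * Complex.I‖ ^ 2 = η ^ 2 + 4 * β ^ 2 := by
  rw [Complex.sq_norm, Complex.normSq_apply]
  simp
  ring

/-- Squaring removes the branch of the square root in the Poisson factor. -/
theorem thetaSum_sq_add_div {η : ℝ} (hη : 0 < η) (β : ℝ) {q : ℕ} (hq : 0 < q) (a : ℤ) :
    thetaSum η (a / q + β) ^ 2 =
      dualSum q a (((q : ℂ) ^ 2 * (η - 2 * β * Complex.I))⁻¹) ^ 2 /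
        ((q : ℂ) ^ 2 * (η - 2 * β * Complex.I)) := by
  rw [thetaSum_add_div hη β hq a, ← dualSum, mul_pow, div_pow, one_pow, one_div 2,
    Complex.cpow_ofNat_inv_pow]
  ring

theorem dual_re {η : ℝ} (β : ℝ) {q : ℕ} (hq : 0 < q) :
    (((q : ℂ) ^ 2 * (η - 2 * β * Complex.I))⁻¹).re =
      η / ((q : ℝ) ^ 2 * (η ^ 2 + 4 * β ^ 2)) := by
  have : (((q : ℂ) ^ 2 * (η - 2 * β * Complex.I))⁻¹) =
      ((((q : ℝ) ^ 2)⁻¹ : ℝ) : ℂ) * ((η : ℂ) - 2 * β * Complex.I)⁻¹ := by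
    push_cast
    rw [mul_inv]
  rw [this, Complex.re_ofReal_mul, Complex.inv_re, ← Complex.sq_norm, norm_sub_two_mul_I_sq]
  simp
  field_simp

/-- An upper bound for the theta series near a rational number. -/
theorem norm_thetaSum_pow_four_le {η : ℝ} (hη : 0 < η) (β : ℝ) {q : ℕ} (hq : 0 < q) {a : ℤ}
    (ha : IsCoprime a q) {B : ℝ} (hB : (q : ℝ) ^ 2 * (η ^ 2 + 4 * β ^ 2) ≤ B * η) :
    ‖thetaSum η (a / q + β)‖ ^ 4 ≤
      4 * (1 + 2 * B) ^ 4 * ((q : ℝ) ^ 2)⁻¹ * (η ^ 2 + 4 * β ^ 2)⁻¹ := by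
  have hq' : (0 : ℝ) < q := by exact_mod_cast hq
  set D := η ^ 2 + 4 * β ^ 2 with hD
  have hD0 : 0 < D := by positivity
  have hw := dual_re (η := η) β hq
  rw [← hD] at hw
  have hw0 : 0 < (((q : ℂ) ^ 2 * (η - 2 * β * Complex.I))⁻¹).re := by rw [hw]; positivity
  have h1 := norm_dualSum_le hq ha hw0
  rw [hw] at h1
  -- The dual parameter w has real part η/(q²D), so `hB` says exactly that 1/Re w ≤ B.
  have h2 : 2 / (η / ((q : ℝ) ^ 2 * D)) ≤ 2 * B := by
    rw [div_div_eq_mul_div, div_le_iff₀ hη]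
    linarith
  have h3 : ‖thetaSum η (a / q + β)‖ ^ 4 =
      ‖dualSum q a (((q : ℂ) ^ 2 * (η - 2 * β * Complex.I))⁻¹)‖ ^ 4 / ((q : ℝ) ^ 4 * D) := by
    have h4 : ‖thetaSum η (a / q + β)‖ ^ 4 = ‖thetaSum η (a / q + β) ^ 2‖ ^ 2 := by
      rw [norm_pow]; ring
    rw [h4, thetaSum_sq_add_div hη β hq a, norm_div, norm_mul, norm_pow, norm_pow, div_pow,
      mul_pow, norm_sub_two_mul_I_sq, Complex.norm_natCast]
    ring
  rw [h3, div_le_iff₀ (by positivity)]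
  calc _ ≤ (√(2 * q) * (1 + 2 * B)) ^ 4 := by
        gcongr
        refine h1.trans ?_
        gcongr
    _ = (√(2 * q) ^ 2) ^ 2 * (1 + 2 * B) ^ 4 := by ring
    _ = _ := by
        rw [Real.sq_sqrt (by positivity)]
        field_simp
        ring

/-- The approximation of the square of the theta series near a rational number. -/
theorem norm_thetaSum_sq_sub_le {η : ℝ} (hη : 0 < η) (β : ℝ) {q : ℕ} (hq : 0 < q) {a : ℤ}
    (ha : IsCoprime a q) {B : ℝ} (hB : (q : ℝ) ^ 2 * (η ^ 2 + 4 * β ^ 2) ≤ B * η) (hB1 : B ≤ 1) :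
    ‖thetaSum η (a / q + β) ^ 2 -
      quadGauss q a 0 ^ 2 / ((q : ℂ) ^ 2 * (η - 2 * β * Complex.I))‖ ≤ 16 * B / (q * η) := by
  have hq' : (0 : ℝ) < q := by exact_mod_cast hq
  set D := η ^ 2 + 4 * β ^ 2 with hD
  have hD0 : 0 < D := by positivity
  have hw := dual_re (η := η) β hq
  rw [← hD] at hw
  have hw0 : 0 < (((q : ℂ) ^ 2 * (η - 2 * β * Complex.I))⁻¹).re := by rw [hw]; positivity
  have h1 := norm_dualSum_le hq ha hw0
  have h1' := norm_dualSum_sub_le hq ha hw0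
  have h0 := norm_quadGauss_le hq ha 0
  rw [hw] at h1 h1'
  have h2 : 2 / (η / ((q : ℝ) ^ 2 * D)) ≤ 2 * B := by
    rw [div_div_eq_mul_div, div_le_iff₀ hη]
    linarith
  have hB0 : 0 ≤ B := by
    by_contra hcon
    have : B * η < 0 := mul_neg_of_neg_of_pos (not_le.1 hcon) hη
    have : 0 < (q : ℝ) ^ 2 * D := by positivity
    linarith
  set A := dualSum q a (((q : ℂ) ^ 2 * (η - 2 * β * Complex.I))⁻¹)
  have hz : η ≤ ‖(η : ℂ) - 2 * β * Complex.I‖ := by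
    refine le_of_sq_le_sq ?_ (norm_nonneg _)
    rw [norm_sub_two_mul_I_sq]
    nlinarith
  -- The difference of squares factors: one factor is small by the estimate for nonzero frequencies,
  -- the other is at most 4√(2q) because B ≤ 1.
  rw [thetaSum_sq_add_div hη β hq a, ← sub_div, norm_div, norm_mul, norm_pow, Complex.norm_natCast,
    sq_sub_sq, norm_mul]
  have h5 : ‖A + quadGauss q a 0‖ ≤ √(2 * q) * 4 := by
    refine (norm_add_le _ _).trans ?_
    have : ‖A‖ ≤ √(2 * q) * 3 := h1.trans (by gcongr; linarith)
    linarith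
  have h6 : ‖A - quadGauss q a 0‖ ≤ √(2 * q) * (2 * B) := h1'.trans (by gcongr)
  have hs : √(2 * q : ℝ) * √(2 * q) = 2 * q := Real.mul_self_sqrt (by positivity)
  calc _ ≤ (√(2 * q) * 4) * (√(2 * q) * (2 * B)) / ((q : ℝ) ^ 2 * η) := by gcongr
    _ = (√(2 * q) * √(2 * q)) * (8 * B) / ((q : ℝ) ^ 2 * η) := by ring
    _ = _ := by
        rw [hs]
        field_simp
        ring

end

/-! ### The major arc model and its accuracy on the major arcs -/

section

open Finset

/-- The geometric series `∑ exp (-πηm) exp (2πiβm)` over the natural numbers. -/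
noncomputable def geomKernel (η β : ℝ) : ℂ :=
  (1 - Complex.exp (-(Real.pi * ((η : ℂ) - 2 * β * Complex.I))))⁻¹

theorem geomKernel_eq (η β : ℝ) :
    geomKernel η β = (1 - (Real.exp (-(Real.pi * η)) : ℂ) * circExp β)⁻¹ := by
  rw [geomKernel, circExp, Complex.ofReal_exp, ← Complex.exp_add]
  congr 3
  push_cast
  ring

theorem geomKernel_add_int (η β : ℝ) (n : ℤ) : geomKernel η (β + n) = geomKernel η β := by
  rw [geomKernel_eq, geomKernel_eq, circExp_add_int]

theorem norm_sq_one_sub_exp (x y : ℝ) :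
    ‖(1 : ℂ) - (Real.exp (-x) : ℂ) * Complex.exp (y * Complex.I)‖ ^ 2 =
      (1 - Real.exp (-x)) ^ 2 + 2 * Real.exp (-x) * (1 - Real.cos y) := by
  rw [Complex.sq_norm, Complex.normSq_apply]
  simp only [Complex.sub_re, Complex.sub_im, Complex.one_re, Complex.one_im,
    Complex.re_ofReal_mul, Complex.im_ofReal_mul, Complex.exp_ofReal_mul_I_re,
    Complex.exp_ofReal_mul_I_im]
  have := Real.sin_sq_add_cos_sq y
  linear_combination (Real.exp (-x)) ^ 2 * this

theorem exp_neg_le_one_sub_half {x : ℝ} (h0 : 0 ≤ x) (h1 : x ≤ 1) :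
    Real.exp (-x) ≤ 1 - x / 2 := by
  rw [Real.exp_neg]
  have h2 : (1 + x)⁻¹ ≤ 1 - x / 2 := by
    rw [inv_le_iff_one_le_mul₀ (by positivity)]
    nlinarith
  refine le_trans ?_ h2
  apply inv_anti₀ (by positivity)
  linarith [Real.add_one_le_exp x]

/-- The squared modulus is (1 - e⁻ˣ)² + 2e⁻ˣ(1 - cos y), and both parts are bounded below
quadratically in the given range. -/
theorem norm_sq_one_sub_exp_ge {x y : ℝ} (h0 : 0 ≤ x) (h1 : x ≤ 1) (hy : |y| ≤ Real.pi) :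
    (x ^ 2 + y ^ 2) / 8 ≤
      ‖(1 : ℂ) - (Real.exp (-x) : ℂ) * Complex.exp (y * Complex.I)‖ ^ 2 := by
  rw [norm_sq_one_sub_exp]
  have h2 := exp_neg_le_one_sub_half h0 h1
  have h3 : (1 : ℝ) / 3 ≤ Real.exp (-x) := by
    have h4 : Real.exp x ≤ 3 :=
      (Real.exp_le_exp.2 h1).trans (by linarith [Real.exp_one_lt_d9])
    rw [Real.exp_neg, one_div]
    exact inv_anti₀ (Real.exp_pos _) h4
  have h5 := Real.cos_le_one_sub_mul_cos_sq hy
  have h6 : (3 / 16) * y ^ 2 ≤ 1 - Real.cos y := by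
    have h7 : (3 : ℝ) / 16 ≤ 2 / Real.pi ^ 2 := by
      rw [le_div_iff₀ (by positivity)]
      nlinarith [Real.pi_lt_d2, Real.pi_pos]
    nlinarith [sq_nonneg y]
  have h8 : (x / 2) ^ 2 ≤ (1 - Real.exp (-x)) ^ 2 := by
    apply pow_le_pow_left₀ (by positivity)
    linarith
  have h9 : 1 / 8 * y ^ 2 ≤ 2 * Real.exp (-x) * (1 - Real.cos y) := by
    have : 0 ≤ 1 - Real.cos y := by linarith [Real.cos_le_one y]
    calc 1 / 8 * y ^ 2 = 2 * (1 / 3) * ((3 / 16) * y ^ 2) := by ring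
      _ ≤ _ := by gcongr
  nlinarith [sq_nonneg x]

theorem one_sub_exp_lower {η β : ℝ} (hη : 0 < η) (hη4 : η ≤ 1 / 4) (hβ : |β| ≤ 1 / 2) :
    Real.pi ^ 2 * (η ^ 2 + 4 * β ^ 2) / 8 ≤
      ‖(1 : ℂ) - Complex.exp (-(Real.pi * ((η : ℂ) - 2 * β * Complex.I)))‖ ^ 2 := by
  have h := norm_sq_one_sub_exp_ge (x := Real.pi * η) (y := 2 * Real.pi * β) (by positivity)
    (by nlinarith [Real.pi_lt_four]) (by
      rw [abs_mul, abs_of_pos (by positivity)]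
      nlinarith [Real.pi_pos])
  have e : Complex.exp (-(Real.pi * ((η : ℂ) - 2 * β * Complex.I))) =
      (Real.exp (-(Real.pi * η)) : ℂ) *
        Complex.exp (((2 * Real.pi * β : ℝ) : ℂ) * Complex.I) := by
    rw [Complex.ofReal_exp, ← Complex.exp_add]
    congr 1
    push_cast
    ring
  rw [e]
  refine le_trans (le_of_eq ?_) h
  ring

theorem norm_geomKernel_sq_le {η β : ℝ} (hη : 0 < η) (hη4 : η ≤ 1 / 4) (hβ : |β| ≤ 1 / 2) :
    ‖geomKernel η β‖ ^ 2 ≤ (η ^ 2 + 4 * β ^ 2)⁻¹ := by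
  rw [geomKernel, norm_inv, inv_pow]
  apply inv_anti₀ (by positivity)
  refine le_trans ?_ (one_sub_exp_lower hη hη4 hβ)
  have : 8 ≤ Real.pi ^ 2 := by nlinarith [Real.pi_gt_three]
  have h2 : 0 ≤ η ^ 2 + 4 * β ^ 2 := by positivity
  nlinarith

theorem norm_sub_one_add_exp_neg_le {w : ℂ} (hw : 0 ≤ w.re) :
    ‖w - 1 + Complex.exp (-w)‖ ≤ 3 * ‖w‖ ^ 2 := by
  by_cases h : ‖w‖ ≤ 1
  · have h1 := Complex.norm_exp_sub_one_sub_id_le (x := -w) (by rwa [norm_neg])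
    rw [norm_neg] at h1
    have e : w - 1 + Complex.exp (-w) = Complex.exp (-w) - 1 - -w := by ring
    rw [e]
    nlinarith [sq_nonneg ‖w‖]
  · push Not at h
    have h1 : ‖Complex.exp (-w)‖ ≤ 1 := by
      rw [Complex.norm_exp]
      exact Real.exp_le_one_iff.2 (by simpa using hw)
    calc _ ≤ ‖w - 1‖ + ‖Complex.exp (-w)‖ := norm_add_le _ _
      _ ≤ (‖w‖ + ‖(1 : ℂ)‖) + 1 := add_le_add (norm_sub_le _ _) h1
      _ ≤ _ := by
        rw [norm_one]
        nlinarith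

/-- π times the kernel has the same singularity as 1/(η - 2iβ), the factor in the main term of θ².
Replacing one by the other costs O(1), and the kernel is periodic with explicit Fourier
coefficients. -/
theorem norm_pi_mul_geomKernel_sub_le {η β : ℝ} (hη : 0 < η) (hη4 : η ≤ 1 / 4)
    (hβ : |β| ≤ 1 / 2) :
    ‖Real.pi * geomKernel η β - ((η : ℂ) - 2 * β * Complex.I)⁻¹‖ ≤ 30 := by
  set z : ℂ := (η : ℂ) - 2 * β * Complex.I with hz
  set w : ℂ := Real.pi * z with hw
  have hpi := Real.pi_pos
  have hzre : z.re = η := by simp [hz]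
  have hz0 : z ≠ 0 := by intro h; rw [h] at hzre; simp at hzre; linarith
  have hw0 : w ≠ 0 := mul_ne_zero (by exact_mod_cast hpi.ne') hz0
  have hwn : 0 < ‖w‖ := norm_pos_iff.2 hw0
  have hwre : 0 ≤ w.re := by
    rw [hw, Complex.re_ofReal_mul, hzre]; positivity
  have hlow := one_sub_exp_lower hη hη4 hβ
  rw [← hz, ← hw] at hlow
  have hwsq : ‖w‖ ^ 2 = Real.pi ^ 2 * (η ^ 2 + 4 * β ^ 2) := by
    rw [hw, norm_mul, mul_pow, norm_sub_two_mul_I_sq, Complex.norm_real, Real.norm_eq_abs, sq_abs]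
  rw [← hwsq] at hlow
  have hlow2 : ‖w‖ / 3 ≤ ‖1 - Complex.exp (-w)‖ := by
    refine le_of_sq_le_sq ?_ (norm_nonneg _)
    nlinarith [sq_nonneg ‖w‖]
  have hne : 1 - Complex.exp (-w) ≠ 0 := by
    intro h
    rw [h, norm_zero] at hlow2
    linarith
  have e : Real.pi * geomKernel η β - z⁻¹ =
      Real.pi * ((w - 1 + Complex.exp (-w)) / (w * (1 - Complex.exp (-w)))) := by
    have : z⁻¹ = Real.pi * w⁻¹ := by
      rw [hw, mul_inv, ← mul_assoc, mul_inv_cancel₀ (by exact_mod_cast hpi.ne'), one_mul]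
    rw [geomKernel, ← hz, ← hw, this, ← mul_sub]
    congr 1
    field_simp
    ring
  rw [e, norm_mul, norm_div, norm_mul, Complex.norm_real, Real.norm_eq_abs, abs_of_pos hpi]
  calc _ ≤ Real.pi * (3 * ‖w‖ ^ 2 / (‖w‖ * (‖w‖ / 3))) := by
        gcongr
        exact norm_sub_one_add_exp_neg_le hwre
    _ = Real.pi * 9 := by field_simp; ring
    _ ≤ 30 := by nlinarith [Real.pi_lt_d2]

theorem norm_geomKernel_sq_le_of_round {η : ℝ} (hη : 0 < η) (hη4 : η ≤ 1 / 4) (β : ℝ) :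
    ‖geomKernel η β‖ ^ 2 ≤ (η ^ 2 + 4 * (β - round β) ^ 2)⁻¹ := by
  have h := norm_geomKernel_sq_le hη hη4 (abs_sub_round β)
  have e := geomKernel_add_int η (β - round β) (round β)
  rw [sub_add_cancel] at e
  rwa [e]

theorem quadGauss_emod (q : ℕ) (a : ℤ) : quadGauss q (a % q) 0 = quadGauss q a 0 := by
  rcases Nat.eq_zero_or_pos q with rfl | hq
  · simp
  have hq' : (q : ℝ) ≠ 0 := by exact_mod_cast hq.ne'
  rw [quadGauss_zero_right, quadGauss_zero_right]
  refine sum_congr rfl fun x _ => ?_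
  refine circExp_eq_of_eq_add_int (-(a / q * x ^ 2)) ?_
  have h : ((a % q : ℤ) : ℝ) = a - q * (a / q : ℤ) := by
    rw [Int.emod_def]; push_cast; ring
  rw [h]
  push_cast
  field_simp
  ring

/-- The generating function of the major arc model for the number of representations as a sum of
two squares. -/
noncomputable def modelSum (η : ℝ) (Q : ℕ) (α : ℝ) : ℂ :=
  ∑ p ∈ (Ioc 0 Q).sigma fun q => {u ∈ range q | u.Coprime q},
    Real.pi * (quadGauss p.1 p.2 0 ^ 2 / (p.1 : ℂ) ^ 2) * geomKernel η (α - p.2 / p.1)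

theorem norm_quadGauss_sq_div_le {q : ℕ} (hq : 0 < q) {a : ℤ} (ha : IsCoprime a q) :
    ‖quadGauss q a 0 ^ 2 / (q : ℂ) ^ 2‖ ≤ 2 / q := by
  have hq' : (0 : ℝ) < q := by exact_mod_cast hq
  rw [norm_div, norm_pow, norm_pow, Complex.norm_natCast, div_le_div_iff₀ (by positivity) hq']
  have := norm_quadGauss_sq_le hq ha 0
  nlinarith

theorem norm_modelSum_term_le {q u : ℕ} (hq : 0 < q) (hu : u.Coprime q) (K : ℂ) :
    ‖Real.pi * (quadGauss q u 0 ^ 2 / (q : ℂ) ^ 2) * K‖ ≤ 7 / q * ‖K‖ := by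
  rw [norm_mul, norm_mul, Complex.norm_real, Real.norm_eq_abs, abs_of_pos Real.pi_pos]
  have h := norm_quadGauss_sq_div_le hq (a := u) (Nat.isCoprime_iff_coprime.2 hu)
  have hq' : (0 : ℝ) < q := by exact_mod_cast hq
  gcongr
  calc _ ≤ Real.pi * (2 / q) := by gcongr
    _ = (Real.pi * 2) / q := by ring
    _ ≤ 7 / q := by gcongr; linarith [Real.pi_lt_d2]

theorem card_reduced_fractions_le (Q : ℕ) :
    #((Ioc 0 Q).sigma fun q => {u ∈ range q | u.Coprime q}) ≤ Q ^ 2 := by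
  rw [card_sigma]
  calc _ ≤ ∑ q ∈ Ioc 0 Q, Q := by
        refine sum_le_sum fun q hq => ?_
        exact ((card_filter_le _ _).trans (card_range q).le).trans (mem_Ioc.1 hq).2
    _ = _ := by simp [sq]

theorem fraction_sub_ne {q q' : ℕ} (hq : 0 < q) {a : ℤ} (ha : IsCoprime a q)
    {u : ℕ} (hu : u.Coprime q') (huq : u < q') {k : ℤ} (h : a * q' = (u + k * q') * q) :
    q' = q ∧ (u : ℤ) = a % q := by
  have h1 : (q : ℤ) ∣ q' := ha.symm.dvd_of_dvd_mul_left ⟨u + k * q', by rw [h]; ring⟩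
  have hu' : IsCoprime (u + k * q' : ℤ) (q' : ℤ) := by
    have := (Nat.isCoprime_iff_coprime.2 hu).add_mul_left_left k
    rwa [mul_comm (q' : ℤ) k] at this
  have h2 : (q' : ℤ) ∣ q := hu'.symm.dvd_of_dvd_mul_left ⟨a, by rw [← h]; ring⟩
  have h3 : q' = q := Nat.dvd_antisymm (by exact_mod_cast h2) (by exact_mod_cast h1)
  subst h3
  refine ⟨rfl, ?_⟩
  have h4 : (q' : ℤ) ≠ 0 := by exact_mod_cast hq.ne'
  have h5 : a = u + k * q' := mul_right_cancel₀ h4 h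
  rw [h5, Int.add_mul_emod_self_right, Int.emod_eq_of_lt (by positivity) (by exact_mod_cast huq)]

/-- Distinct reduced fractions modulo 1 with denominators up to Q are at least 1/Q² apart. As τ ≤
1/(4Q²), a point within τ of one stays at least 1/(2Q²) from the others, where the kernel is at most
Q². -/
theorem norm_geomKernel_le_of_ne {η : ℝ} (hη : 0 < η) (hη4 : η ≤ 1 / 4) {Q : ℕ} {τ : ℝ}
    (hτ : 4 * (Q : ℝ) ^ 2 * τ ≤ 1) {q q' : ℕ} (hq : 0 < q) (hqQ : q ≤ Q) (hq' : 0 < q')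
    (hqQ' : q' ≤ Q) {a : ℤ} (ha : IsCoprime a q) {u : ℕ} (hu : u.Coprime q') (huq : u < q')
    (hne : ¬ (q' = q ∧ (u : ℤ) = a % q)) {α : ℝ} (hα : |α - a / q| ≤ τ) :
    ‖geomKernel η (α - u / q')‖ ≤ (Q : ℝ) ^ 2 := by
  have hQ0 : (0 : ℝ) < Q := by exact_mod_cast lt_of_lt_of_le hq hqQ
  have hq0 : (0 : ℝ) < q := by exact_mod_cast hq
  have hq0' : (0 : ℝ) < q' := by exact_mod_cast hq'
  set k := round (α - u / q') with hk
  have h1 := norm_geomKernel_sq_le_of_round hη hη4 (α - u / q')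
  rw [← hk] at h1
  have hint : a * q' - (u + k * q') * q ≠ 0 := fun h =>
    hne (fraction_sub_ne hq ha hu huq (sub_eq_zero.1 h))
  have h2 : (1 : ℝ) ≤ |((a * q' - (u + k * q') * q : ℤ) : ℝ)| := by
    exact_mod_cast Int.one_le_abs hint
  have h3 : (a : ℝ) / q - u / q' - k = ((a * q' - (u + k * q') * q : ℤ) : ℝ) / (q * q') := by
    push_cast
    field_simp
    ring
  have h4 : 1 / (Q : ℝ) ^ 2 ≤ |(a : ℝ) / q - u / q' - k| := by
    rw [h3, abs_div, abs_of_pos (by positivity : (0 : ℝ) < q * q')]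
    have h5 : (q : ℝ) * q' ≤ Q ^ 2 := by
      rw [sq]
      gcongr
    gcongr
  have h6 : |(a : ℝ) / q - u / q' - k| ≤ |α - u / q' - k| + |α - a / q| := by
    have := abs_sub (α - u / q' - k) (α - a / q)
    calc _ = |(α - u / q' - k) - (α - a / q)| := by congr 1; ring
      _ ≤ _ := this
  have h7 : τ ≤ 1 / (4 * (Q : ℝ) ^ 2) := by
    rw [le_div_iff₀ (by positivity)]; linarith
  have h8 : 1 / (2 * (Q : ℝ) ^ 2) ≤ |α - u / q' - k| := by
    have e1 : 1 / (Q : ℝ) ^ 2 = 4 * (1 / (4 * (Q : ℝ) ^ 2)) := by field_simp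
    have e2 : 1 / (2 * (Q : ℝ) ^ 2) = 2 * (1 / (4 * (Q : ℝ) ^ 2)) := by field_simp; norm_num
    have e3 : 0 < 1 / (4 * (Q : ℝ) ^ 2) := by positivity
    linarith
  refine le_of_sq_le_sq ?_ (by positivity)
  refine h1.trans ?_
  have h9 : (1 / (2 * (Q : ℝ) ^ 2)) ^ 2 ≤ (α - u / q' - k) ^ 2 := by
    rw [← sq_abs (α - u / q' - k)]
    gcongr
  calc _ ≤ (4 * (1 / (2 * (Q : ℝ) ^ 2)) ^ 2)⁻¹ := by
        apply inv_anti₀ (by positivity)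
        nlinarith [sq_nonneg η]
    _ = _ := by field_simp; norm_num

/-- Near a/q only one term of the model is large, and it matches the main term of θ² up to 2·30. The
other at most Q² fractions contribute at most 7Q² each. -/
theorem norm_thetaSum_sq_sub_modelSum_le {η : ℝ} (hη : 0 < η) (hη4 : η ≤ 1 / 4) {Q : ℕ} {τ : ℝ}
    (hτ : 4 * (Q : ℝ) ^ 2 * τ ≤ 1) {B : ℝ} (hB : (Q : ℝ) ^ 2 * (η ^ 2 + 4 * τ ^ 2) ≤ B * η)
    (hB1 : B ≤ 1) {q : ℕ} (hq : 0 < q) (hqQ : q ≤ Q) {a : ℤ} (ha : IsCoprime a q) {α : ℝ}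
    (hα : |α - a / q| ≤ τ) :
    ‖thetaSum η α ^ 2 - modelSum η Q α‖ ≤ 16 * B / η + 60 + 7 * (Q : ℝ) ^ 4 := by
  have hQ1 : (1 : ℝ) ≤ Q := by exact_mod_cast (show 1 ≤ q from hq).trans hqQ
  have hq0 : (0 : ℝ) < q := by exact_mod_cast hq
  have hq1 : (1 : ℝ) ≤ q := by exact_mod_cast hq
  have hqZ : (0 : ℤ) < q := by exact_mod_cast hq
  set β := α - a / q with hβ
  have hαβ : α = a / q + β := by rw [hβ]; ring
  have hτ0 : 0 ≤ τ := (abs_nonneg _).trans hα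
  have hβsq : β ^ 2 ≤ τ ^ 2 := by rw [← sq_abs β]; gcongr
  have hτ4 : τ ≤ 1 / 4 := by
    have : 1 ≤ (Q : ℝ) ^ 2 := one_le_pow₀ hQ1
    nlinarith
  have hBq : (q : ℝ) ^ 2 * (η ^ 2 + 4 * β ^ 2) ≤ B * η := by
    refine le_trans ?_ hB
    gcongr
  have hB0 : 0 ≤ B := by
    by_contra hcon
    have h1 : B * η < 0 := mul_neg_of_neg_of_pos (not_le.1 hcon) hη
    have h2 : 0 ≤ (Q : ℝ) ^ 2 * (η ^ 2 + 4 * τ ^ 2) := by positivity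
    linarith
  have h1 := norm_thetaSum_sq_sub_le hη β hq ha hBq hB1
  rw [← hαβ] at h1
  have h1' : 16 * B / (q * η) ≤ 16 * B / η := by
    apply div_le_div_of_nonneg_left (by positivity) hη
    nlinarith
  -- The model is indexed by numerators in [0, q), so a is reduced modulo q; the kernel and the
  -- Gauss sum are unaffected.
  set u₀ : ℕ := (a % q).toNat with hu₀
  have hu₀Z : (u₀ : ℤ) = a % q := Int.toNat_of_nonneg (Int.emod_nonneg _ hqZ.ne')
  have hu₀lt : u₀ < q := by
    have := Int.emod_lt_of_pos a hqZ
    rw [← hu₀Z] at this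
    exact_mod_cast this
  have hu₀cop : u₀.Coprime q := by
    rw [← Nat.isCoprime_iff_coprime, hu₀Z]
    have h := ha.add_mul_left_left (-(a / q))
    rwa [mul_neg, ← sub_eq_add_neg, ← Int.emod_def] at h
  have hmem : (⟨q, u₀⟩ : Σ _ : ℕ, ℕ) ∈ (Ioc 0 Q).sigma fun q => {u ∈ range q | u.Coprime q} := by
    simp only [mem_sigma, mem_Ioc, mem_filter, mem_range]
    exact ⟨⟨hq, hqQ⟩, hu₀lt, hu₀cop⟩
  rw [modelSum, ← add_sum_erase _ _ hmem]
  simp only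
  have hmain : Real.pi * (quadGauss q u₀ 0 ^ 2 / (q : ℂ) ^ 2) * geomKernel η (α - u₀ / q) =
      (quadGauss q a 0 ^ 2 / (q : ℂ) ^ 2) * (Real.pi * geomKernel η β) := by
    have e1 : quadGauss q u₀ 0 = quadGauss q a 0 := by rw [hu₀Z, quadGauss_emod]
    have e2 : geomKernel η (α - u₀ / q) = geomKernel η β := by
      rw [← geomKernel_add_int η β (a / q : ℤ)]
      congr 1
      have : (u₀ : ℝ) = a - q * (a / q : ℤ) := by
        have : (u₀ : ℝ) = ((u₀ : ℤ) : ℝ) := by simp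
        rw [this, hu₀Z, Int.emod_def]
        push_cast
        ring
      rw [this, hβ]
      field_simp
      ring
    rw [e1, e2]
    ring
  rw [hmain]
  have hrest : ‖∑ p ∈ ((Ioc 0 Q).sigma fun q => {u ∈ range q | u.Coprime q}).erase ⟨q, u₀⟩,
      Real.pi * (quadGauss p.1 p.2 0 ^ 2 / (p.1 : ℂ) ^ 2) * geomKernel η (α - p.2 / p.1)‖ ≤
      7 * (Q : ℝ) ^ 4 := by
    calc _ ≤ ∑ p ∈ ((Ioc 0 Q).sigma fun q => {u ∈ range q | u.Coprime q}).erase ⟨q, u₀⟩,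
          7 * (Q : ℝ) ^ 2 := by
          refine norm_sum_le_of_le _ ?_
          rintro ⟨q', u⟩ hp
          simp only [mem_erase, mem_sigma, mem_Ioc, mem_filter, mem_range] at hp
          obtain ⟨hne, ⟨hq', hqQ'⟩, huq, hu⟩ := hp
          have hK := norm_geomKernel_le_of_ne hη hη4 hτ hq hqQ hq' hqQ' ha hu huq (by
            rintro ⟨rfl, h⟩
            rw [← hu₀Z] at h
            apply hne
            have : u = u₀ := by exact_mod_cast h
            rw [this]) hα
          refine (norm_modelSum_term_le hq' hu _).trans ?_
          have hq1' : (1 : ℝ) ≤ q' := by exact_mod_cast hq'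
          have : 7 / (q' : ℝ) ≤ 7 := div_le_self (by norm_num) hq1'
          gcongr
      _ ≤ (Q : ℝ) ^ 2 * (7 * (Q : ℝ) ^ 2) := by
          rw [sum_const, nsmul_eq_mul]
          gcongr
          exact_mod_cast (card_erase_le).trans (card_reduced_fractions_le Q)
      _ = _ := by ring
  set R := ∑ p ∈ ((Ioc 0 Q).sigma fun q => {u ∈ range q | u.Coprime q}).erase ⟨q, u₀⟩,
      Real.pi * (quadGauss p.1 p.2 0 ^ 2 / (p.1 : ℂ) ^ 2) * geomKernel η (α - p.2 / p.1)
  set s := quadGauss q a 0 ^ 2 / (q : ℂ) ^ 2 with hs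
  set z : ℂ := (η : ℂ) - 2 * β * Complex.I with hz
  have hK := norm_pi_mul_geomKernel_sub_le hη hη4 (β := β) (by linarith)
  rw [← hz] at hK
  have hs2 : ‖s‖ ≤ 2 := by
    refine (norm_quadGauss_sq_div_le hq ha).trans ?_
    exact div_le_self (by norm_num) hq1
  have e : thetaSum η α ^ 2 - (s * (Real.pi * geomKernel η β) + R) =
      (thetaSum η α ^ 2 - quadGauss q a 0 ^ 2 / ((q : ℂ) ^ 2 * z)) -
        s * (Real.pi * geomKernel η β - z⁻¹) - R := by
    rw [hs]
    field_simp
    ring_nf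
  rw [e]
  calc _ ≤ ‖thetaSum η α ^ 2 - quadGauss q a 0 ^ 2 / ((q : ℂ) ^ 2 * z)‖ +
        ‖s * (Real.pi * geomKernel η β - z⁻¹)‖ + ‖R‖ :=
        (norm_sub_le _ _).trans (add_le_add_left (norm_sub_le _ _) _)
    _ ≤ 16 * B / η + 2 * 30 + 7 * (Q : ℝ) ^ 4 := by
        rw [norm_mul]
        have : ‖s‖ * ‖Real.pi * geomKernel η β - z⁻¹‖ ≤ 2 * 30 := by gcongr
        linarith
    _ = _ := by ring

end

/-! ### Pointwise bound for the error on the whole circle -/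

section

open Finset

/-- The sum of the Poisson-type kernel of width `c` over the fractions of denominator `q` close to
the unit interval. -/
noncomputable def arcSum (c : ℝ) (q : ℕ) (α : ℝ) : ℝ :=
  ∑ a ∈ Ico (-q : ℤ) (2 * q), (c ^ 2 + (α - a / q) ^ 2)⁻¹

theorem arcSum_nonneg (c : ℝ) (q : ℕ) (α : ℝ) : 0 ≤ arcSum c q α :=
  sum_nonneg fun _ _ => by positivity

theorem le_arcSum (c : ℝ) {q : ℕ} {a : ℤ} (ha : -q ≤ a) (ha' : a < 2 * q) (α : ℝ) :
    (c ^ 2 + (α - a / q) ^ 2)⁻¹ ≤ arcSum c q α :=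
  single_le_sum (f := fun a : ℤ => (c ^ 2 + (α - a / q) ^ 2)⁻¹) (fun _ _ => by positivity)
    (mem_Ico.2 ⟨ha, ha'⟩)

/-- Away from the major arcs the narrow kernel of width η may be replaced by one of width τ, whose
integral is much smaller. -/
theorem inv_four_mul_sq_le {τ x : ℝ} (hτ : 0 < τ) (hx : τ < |x|) (η : ℝ) :
    (η ^ 2 + 4 * x ^ 2)⁻¹ ≤ (τ ^ 2 + x ^ 2)⁻¹ := by
  have h : τ ^ 2 ≤ x ^ 2 := by
    rw [← sq_abs x]
    gcongr
  have : 0 < τ ^ 2 := by positivity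
  apply inv_anti₀ (by positivity)
  nlinarith [sq_nonneg η, sq_nonneg x]

/-- For α and u/q in [0, 1] the nearest integer to α - u/q is -1, 0 or 1; this is why `arcSum` runs
over three periods, from -q to 2q. -/
theorem norm_geomKernel_sq_le_arcSum {η : ℝ} (hη : 0 < η) (hη4 : η ≤ 1 / 4) {τ : ℝ} (hτ : 0 < τ)
    {α : ℝ} (hα0 : 0 ≤ α) (hα1 : α ≤ 1) {q u : ℕ} (hq : 0 < q) (hu : u < q) (huq : u.Coprime q)
    (hfar : ∀ a : ℤ, IsCoprime a q → τ < |α - a / q|) :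
    ‖geomKernel η (α - u / q)‖ ^ 2 ≤ arcSum τ q α := by
  have hq0 : (0 : ℝ) < q := by exact_mod_cast hq
  have huq0 : (0 : ℝ) ≤ (u : ℝ) / q := by positivity
  have huq1 : (u : ℝ) / q < 1 := (div_lt_one hq0).2 (by exact_mod_cast hu)
  set k := round (α - u / q) with hk
  have habs := abs_le.1 (abs_sub_round (α - u / q))
  rw [← hk] at habs
  have hk1 : k < 2 := by
    have : (k : ℝ) < 2 := by linarith
    exact_mod_cast this
  have hk0 : -2 < k := by
    have : (-2 : ℝ) < k := by linarith
    exact_mod_cast this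
  have hcop : IsCoprime (u + k * q : ℤ) (q : ℤ) := by
    have := (Nat.isCoprime_iff_coprime.2 huq).add_mul_left_left k
    rwa [mul_comm (q : ℤ) k] at this
  have e : α - u / q - k = α - ((u + k * q : ℤ) : ℝ) / q := by
    push_cast
    field_simp
    ring
  have h1 := norm_geomKernel_sq_le_of_round hη hη4 (α - u / q)
  rw [← hk, e] at h1
  have hqZ : (0 : ℤ) < q := by exact_mod_cast hq
  have huZ : (u : ℤ) < q := by exact_mod_cast hu
  refine h1.trans ((inv_four_mul_sq_le hτ (hfar _ hcop) η).trans (le_arcSum τ ?_ ?_ α))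
  · nlinarith [Int.natCast_nonneg u]
  · nlinarith

/-- Cauchy–Schwarz over at most Q² fractions; each denominator then has at most Q numerators, hence
Q³. -/
theorem norm_modelSum_sq_le {η : ℝ} (hη : 0 < η) (hη4 : η ≤ 1 / 4) {τ : ℝ} (hτ : 0 < τ)
    {α : ℝ} (hα0 : 0 ≤ α) (hα1 : α ≤ 1) {Q : ℕ}
    (hfar : ∀ q : ℕ, 0 < q → q ≤ Q → ∀ a : ℤ, IsCoprime a q → τ < |α - a / q|) :
    ‖modelSum η Q α‖ ^ 2 ≤ 49 * (Q : ℝ) ^ 3 * ∑ q ∈ Ioc 0 Q, arcSum τ q α := by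
  set s := (Ioc 0 Q).sigma fun q => {u ∈ range q | u.Coprime q}
  have h1 : ‖modelSum η Q α‖ ≤ ∑ p ∈ s, 7 * ‖geomKernel η (α - p.2 / p.1)‖ := by
    refine norm_sum_le_of_le _ ?_
    rintro ⟨q, u⟩ hp
    simp only [mem_sigma, mem_Ioc, mem_filter, mem_range] at hp
    refine (norm_modelSum_term_le hp.1.1 hp.2.2 _).trans ?_
    have : 7 / (q : ℝ) ≤ 7 := div_le_self (by norm_num) (by exact_mod_cast hp.1.1)
    gcongr
  have h2 : ∑ p ∈ s, ‖geomKernel η (α - p.2 / p.1)‖ ^ 2 ≤ Q * ∑ q ∈ Ioc 0 Q, arcSum τ q α := by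
    rw [sum_sigma, mul_sum]
    refine sum_le_sum fun q hq => ?_
    rw [mem_Ioc] at hq
    calc _ ≤ ∑ u ∈ range q with u.Coprime q, arcSum τ q α := by
          refine sum_le_sum fun u hu => ?_
          simp only [mem_filter, mem_range] at hu
          exact norm_geomKernel_sq_le_arcSum hη hη4 hτ hα0 hα1 hq.1 hu.1 hu.2 (hfar q hq.1 hq.2)
      _ ≤ _ := by
          rw [sum_const, nsmul_eq_mul]
          refine mul_le_mul_of_nonneg_right ?_ (arcSum_nonneg _ _ _)
          exact_mod_cast ((card_filter_le _ _).trans (card_range q).le).trans hq.2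
  calc _ ≤ (∑ p ∈ s, 7 * ‖geomKernel η (α - p.2 / p.1)‖) ^ 2 := by gcongr
    _ ≤ (#s : ℝ) * ∑ p ∈ s, (7 * ‖geomKernel η (α - p.2 / p.1)‖) ^ 2 := sq_sum_le_card_mul_sum_sq
    _ = 49 * (#s : ℝ) * ∑ p ∈ s, ‖geomKernel η (α - p.2 / p.1)‖ ^ 2 := by
        simp only [mul_pow]
        rw [← mul_sum]
        ring
    _ ≤ 49 * (Q : ℝ) ^ 2 * (Q * ∑ q ∈ Ioc 0 Q, arcSum τ q α) := by
        gcongr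
        exact_mod_cast card_reduced_fractions_le Q
    _ = _ := by ring

/-- Dirichlet's approximation in lowest terms; |qα - a| < 1 with α in [0, 1] forces 0 ≤ a ≤ q by
integrality. -/
theorem exists_coprime_dirichlet {α : ℝ} (hα0 : 0 ≤ α) (hα1 : α ≤ 1) {N : ℕ} (hN : 0 < N) :
    ∃ q : ℕ, ∃ a : ℤ, 0 < q ∧ q ≤ N ∧ IsCoprime a q ∧ 0 ≤ a ∧ a ≤ q ∧
      (q : ℝ) * |α - a / q| ≤ 1 / (N + 1) := by
  obtain ⟨r, hr, hrN⟩ := Real.exists_rat_abs_sub_le_and_den_le α hN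
  have hN' : (0 : ℝ) < N := by exact_mod_cast hN
  have hq : (0 : ℝ) < r.den := by exact_mod_cast r.den_pos
  have hcast : (r : ℝ) = (r.num : ℝ) / (r.den : ℕ) := by rw [Rat.cast_def]
  have h1 : (r.den : ℝ) * |α - r.num / r.den| ≤ 1 / (N + 1) := by
    rw [← hcast]
    calc _ ≤ (r.den : ℝ) * (1 / ((N + 1) * r.den)) := by gcongr
      _ = _ := by field_simp
  have h2 : |(r.den : ℝ) * α - r.num| < 1 := by
    have e : (r.den : ℝ) * α - r.num = r.den * (α - r.num / r.den) := by field_simp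
    rw [e, abs_mul, abs_of_pos hq]
    refine h1.trans_lt ?_
    rw [div_lt_one (by positivity)]
    linarith
  have h3 := abs_lt.1 h2
  refine ⟨r.den, r.num, r.den_pos, hrN, ?_, ?_, ?_, h1⟩
  · rw [Int.isCoprime_iff_gcd_eq_one]
    exact r.reduced
  · have : (-1 : ℝ) < r.num := by nlinarith
    have : (-1 : ℤ) < r.num := by exact_mod_cast this
    omega
  · have : (r.num : ℝ) < r.den + 1 := by nlinarith
    have : (r.num : ℤ) < r.den + 1 := by exact_mod_cast this
    omega

set_option maxHeartbeats 800000 in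
/-- The pointwise bound for the difference between the generating function of sums of two squares
and its model. -/
theorem norm_thetaSum_sq_sub_modelSum_sq_le {η : ℝ} (hη : 0 < η) (hη4 : η ≤ 1 / 4) {τ : ℝ}
    (hτ0 : 0 < τ) {Q N : ℕ} (hN : 0 < N) (hτ : 4 * (Q : ℝ) ^ 2 * τ ≤ 1)
    {B : ℝ} (hB : (Q : ℝ) ^ 2 * (η ^ 2 + 4 * τ ^ 2) ≤ B * η) (hB1 : B ≤ 1)
    (hNη : (N : ℝ) ^ 2 * η ≤ 1) (hNη' : 1 ≤ ((N : ℝ) + 1) ^ 2 * η) {α : ℝ} (hα0 : 0 ≤ α)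
    (hα1 : α ≤ 1) :
    ‖thetaSum η α ^ 2 - modelSum η Q α‖ ^ 2 ≤
      2 * (4 * 11 ^ 4) * ∑ q ∈ Ioc Q N, ((q : ℝ) ^ 2)⁻¹ * arcSum η q α +
      ((16 * B / η + 60 + 7 * (Q : ℝ) ^ 4) ^ 2 * (2 * τ ^ 2) + 2 * (4 * 11 ^ 4) +
        98 * (Q : ℝ) ^ 3) * ∑ q ∈ Ioc 0 Q, arcSum τ q α := by
  set S1 := ∑ q ∈ Ioc Q N, ((q : ℝ) ^ 2)⁻¹ * arcSum η q α with hS1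
  set S2 := ∑ q ∈ Ioc 0 Q, arcSum τ q α with hS2
  set E := 16 * B / η + 60 + 7 * (Q : ℝ) ^ 4 with hE
  have hS1' : ∀ q ∈ Ioc Q N, 0 ≤ ((q : ℝ) ^ 2)⁻¹ * arcSum η q α := fun q _ =>
    mul_nonneg (by positivity) (arcSum_nonneg _ _ _)
  have hS10 : 0 ≤ S1 := sum_nonneg hS1'
  have hS2' : ∀ q ∈ Ioc 0 Q, 0 ≤ arcSum τ q α := fun q _ => arcSum_nonneg _ _ _
  have hS20 : 0 ≤ S2 := sum_nonneg hS2'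
  by_cases hmaj : ∃ q : ℕ, 0 < q ∧ q ≤ Q ∧ ∃ a : ℤ, IsCoprime a q ∧ |α - a / q| ≤ τ
  · obtain ⟨q, hq, hqQ, a, ha, hα⟩ := hmaj
    have hq0 : (0 : ℝ) < q := by exact_mod_cast hq
    have hq1 : (1 : ℝ) ≤ q := by exact_mod_cast hq
    have hqQ' : (q : ℝ) ≤ Q := by exact_mod_cast hqQ
    have h1 := norm_thetaSum_sq_sub_modelSum_le hη hη4 hτ hB hB1 hq hqQ ha hα
    have hqτ : q * τ ≤ 1 / 4 := by
      have : (q : ℝ) * 1 ≤ Q * Q := by gcongr; linarith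
      nlinarith
    have h2 := abs_le.1 hα
    have e : α - a / q = (q * α - a) / q := by field_simp
    rw [e, le_div_iff₀ hq0, div_le_iff₀ hq0] at h2
    have ha1 : -q ≤ a := by
      have : (-q : ℝ) ≤ a := by nlinarith
      exact_mod_cast this
    have ha2 : a < 2 * q := by
      have : (a : ℝ) < 2 * q := by nlinarith
      exact_mod_cast this
    -- On a major arc one term of S2 is at least 1/(2τ²), so the constant error bound E² can be
    -- charged to S2 and later integrated over short arcs only.
    have h3 : 1 ≤ 2 * τ ^ 2 * S2 := by
      have h4 : (τ ^ 2 + (α - a / q) ^ 2)⁻¹ ≤ S2 :=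
        (le_arcSum τ ha1 ha2 α).trans
          (single_le_sum (f := fun q => arcSum τ q α) hS2' (mem_Ioc.2 ⟨hq, hqQ⟩))
      have h5 : (2 * τ ^ 2)⁻¹ ≤ (τ ^ 2 + (α - a / q) ^ 2)⁻¹ := by
        apply inv_anti₀ (by positivity)
        have : (α - a / q) ^ 2 ≤ τ ^ 2 := by rw [← sq_abs (α - a / q)]; gcongr
        linarith
      have h6 := h5.trans h4
      rwa [inv_le_iff_one_le_mul₀ (by positivity), mul_comm] at h6
    have h7 : ‖thetaSum η α ^ 2 - modelSum η Q α‖ ^ 2 ≤ E ^ 2 := by gcongr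
    calc _ ≤ E ^ 2 * 1 := by rwa [mul_one]
      _ ≤ E ^ 2 * (2 * τ ^ 2 * S2) := by gcongr
      _ ≤ _ := by
        have : 0 ≤ 98 * (Q : ℝ) ^ 3 * S2 := by positivity
        linarith
  · push Not at hmaj
    have hM := norm_modelSum_sq_le hη hη4 hτ0 hα0 hα1 hmaj
    obtain ⟨q, a, hq, hqN, ha, ha0, haq, hdir⟩ := exists_coprime_dirichlet hα0 hα1 hN
    have hq0 : (0 : ℝ) < q := by exact_mod_cast hq
    have hqN' : (q : ℝ) ≤ N := by exact_mod_cast hqN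
    have hN0 : (0 : ℝ) < N := by exact_mod_cast hN
    set β := α - a / q with hβ
    have hαβ : α = a / q + β := by rw [hβ]; ring
    -- As N is about η^(-1/2), both q²η² and q²β² are at most η, giving B = 1 + 4 = 5 and the
    -- constant 11 = 1 + 2·5.
    have hBq : (q : ℝ) ^ 2 * (η ^ 2 + 4 * β ^ 2) ≤ 5 * η := by
      have h1 : (q : ℝ) ^ 2 * η ^ 2 ≤ η := by
        calc _ ≤ (N : ℝ) ^ 2 * η ^ 2 := by gcongr
          _ = ((N : ℝ) ^ 2 * η) * η := by ring
          _ ≤ 1 * η := by gcongr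
          _ = η := one_mul _
      have h2 : (q : ℝ) ^ 2 * β ^ 2 ≤ η := by
        calc _ = (q * |β|) ^ 2 := by rw [mul_pow, sq_abs]
          _ ≤ (1 / ((N : ℝ) + 1)) ^ 2 := by gcongr
          _ = 1 / ((N : ℝ) + 1) ^ 2 := by rw [div_pow, one_pow]
          _ ≤ η := by rw [div_le_iff₀ (by positivity)]; linarith
      linarith
    have hF := norm_thetaSum_pow_four_le hη β hq ha hBq
    rw [← hαβ] at hF
    replace hF : ‖thetaSum η α‖ ^ 4 ≤
        4 * 11 ^ 4 * (((q : ℝ) ^ 2)⁻¹ * (η ^ 2 + 4 * β ^ 2)⁻¹) :=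
      hF.trans (le_of_eq (by ring))
    have hsq : ‖thetaSum η α ^ 2 - modelSum η Q α‖ ^ 2 ≤
        2 * ‖thetaSum η α‖ ^ 4 + 2 * ‖modelSum η Q α‖ ^ 2 := by
      have h1 : ‖thetaSum η α ^ 2 - modelSum η Q α‖ ≤ ‖thetaSum η α‖ ^ 2 + ‖modelSum η Q α‖ := by
        rw [← norm_pow]
        exact norm_sub_le _ _
      calc _ ≤ (‖thetaSum η α‖ ^ 2 + ‖modelSum η Q α‖) ^ 2 := by gcongr
        _ ≤ _ := by nlinarith [sq_nonneg (‖thetaSum η α‖ ^ 2 - ‖modelSum η Q α‖)]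
    have ha1 : -(q : ℤ) ≤ a := by omega
    have ha2 : a < 2 * (q : ℤ) := by omega
    have hE0 : 0 ≤ E ^ 2 * (2 * τ ^ 2) * S2 := by positivity
    -- If q ≤ Q, then |β| > τ because α lies on no major arc, and S2 absorbs the bound; otherwise
    -- the denominator is counted in S1.
    by_cases hqQ : q ≤ Q
    · have h1 : (η ^ 2 + 4 * β ^ 2)⁻¹ ≤ S2 :=
        ((inv_four_mul_sq_le hτ0 (hmaj q hq hqQ a ha) η).trans (le_arcSum τ ha1 ha2 α)).trans
          (single_le_sum (f := fun q => arcSum τ q α) hS2' (mem_Ioc.2 ⟨hq, hqQ⟩))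
      have h2 : ((q : ℝ) ^ 2)⁻¹ ≤ 1 := inv_le_one_of_one_le₀
        (one_le_pow₀ (by exact_mod_cast hq))
      have h3 : ‖thetaSum η α‖ ^ 4 ≤ 4 * 11 ^ 4 * (1 * S2) := by
        refine hF.trans ?_
        gcongr
      linarith
    · have h1 : ((q : ℝ) ^ 2)⁻¹ * (η ^ 2 + 4 * β ^ 2)⁻¹ ≤ S1 := by
        refine le_trans ?_ (single_le_sum hS1' (mem_Ioc.2 ⟨not_le.1 hqQ, hqN⟩))
        refine mul_le_mul_of_nonneg_left ?_ (by positivity)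
        refine le_trans ?_ (le_arcSum η ha1 ha2 α)
        exact inv_anti₀ (by positivity) (by linarith [sq_nonneg β])
      have h3 : ‖thetaSum η α‖ ^ 4 ≤ 4 * 11 ^ 4 * S1 := by
        refine hF.trans ?_
        gcongr
      linarith

end

/-! ### Bessel's inequality and Fourier coefficients -/

section

open Finset MeasureTheory

theorem integral_circExp_int (k : ℤ) :
    ∫ α in (0 : ℝ)..1, circExp (α * k) = if k = 0 then 1 else 0 := by
  split_ifs with hk
  · subst hk
    simp [circExp_zero]
  · have hc : (2 * Real.pi * k * Complex.I : ℂ) ≠ 0 := by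
      have : (Real.pi : ℂ) ≠ 0 := by exact_mod_cast Real.pi_ne_zero
      have : (k : ℂ) ≠ 0 := by exact_mod_cast hk
      simp [*]
    have h := integral_exp_mul_complex (a := 0) (b := 1) hc
    have e : ∀ α : ℝ, circExp (α * k) = Complex.exp (2 * Real.pi * k * Complex.I * α) := by
      intro α
      rw [circExp]
      congr 1
      push_cast
      ring
    simp only [e]
    rw [h]
    have h1 : Complex.exp (2 * Real.pi * k * Complex.I * ((1 : ℝ) : ℂ)) = 1 := by
      rw [Complex.exp_eq_one_iff]
      exact ⟨k, by push_cast; ring⟩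
    rw [h1]
    simp

/-- Bessel's inequality for the exponentials on the unit interval. -/
theorem sum_norm_sq_integral_mul_circExp_le {f : ℝ → ℂ} (hf : Continuous f) (S : Finset ℤ) :
    ∑ n ∈ S, ‖∫ α in (0 : ℝ)..1, f α * circExp (α * (-n : ℤ))‖ ^ 2 ≤
      ∫ α in (0 : ℝ)..1, ‖f α‖ ^ 2 := by
  set c : ℤ → ℂ := fun n => ∫ α in (0 : ℝ)..1, f α * circExp (α * (-n : ℤ)) with hc
  have hcont : ∀ k : ℤ, Continuous fun α : ℝ => circExp (α * k) := fun k =>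
    continuous_circExp.comp (continuous_id.mul continuous_const)
  -- P is the conjugate of the projection of f onto the chosen frequencies: ∫ fP and ∫ |P|² both
  -- equal the sum A of the squared coefficients, so 2|fP| ≤ |f|² + |P|² gives 2A ≤ ∫ |f|² + A.
  set P : ℝ → ℂ := fun α => ∑ n ∈ S, (starRingEnd ℂ) (c n) * circExp (α * (-n : ℤ)) with hP
  have hPc : Continuous P := by
    refine continuous_finsetSum _ fun n _ => ?_
    exact continuous_const.mul (hcont _)
  have hfP : ∫ α in (0 : ℝ)..1, f α * P α = ((∑ n ∈ S, ‖c n‖ ^ 2 : ℝ) : ℂ) := by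
    have h1 : ∀ α, f α * P α =
        ∑ n ∈ S, (starRingEnd ℂ) (c n) * (f α * circExp (α * (-n : ℤ))) := by
      intro α
      rw [hP, mul_sum]
      exact sum_congr rfl fun n _ => by ring
    simp only [h1]
    rw [intervalIntegral.integral_finsetSum]
    · rw [Complex.ofReal_sum]
      refine sum_congr rfl fun n _ => ?_
      rw [intervalIntegral.integral_const_mul, Complex.ofReal_pow, ← Complex.conj_mul']
    · intro n _
      exact (continuous_const.mul (hf.mul (hcont _))).intervalIntegrable _ _
  have hPP : ∫ α in (0 : ℝ)..1, ‖P α‖ ^ 2 = ∑ n ∈ S, ‖c n‖ ^ 2 := by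
    have h1 : ∀ α, ((‖P α‖ ^ 2 : ℝ) : ℂ) = ∑ n ∈ S, ∑ m ∈ S,
        (c m * (starRingEnd ℂ) (c n)) * circExp (α * (m - n : ℤ)) := by
      intro α
      rw [Complex.ofReal_pow, ← Complex.mul_conj', hP, map_sum, sum_mul_sum]
      refine sum_congr rfl fun n _ => sum_congr rfl fun m _ => ?_
      rw [map_mul, Complex.conj_conj, conj_circExp]
      have : circExp (α * (m - n : ℤ)) =
          circExp (α * (-n : ℤ)) * circExp (-(α * (-m : ℤ))) := by
        rw [← circExp_add]
        congr 1
        push_cast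
        ring
      rw [this]
      ring
    have h2 : ((∫ α in (0 : ℝ)..1, ‖P α‖ ^ 2 : ℝ) : ℂ) = ((∑ n ∈ S, ‖c n‖ ^ 2 : ℝ) : ℂ) := by
      rw [← intervalIntegral.integral_ofReal]
      simp only [h1]
      have h3 : ∀ n m : ℤ, IntervalIntegrable (fun α : ℝ =>
          (c m * (starRingEnd ℂ) (c n)) * circExp (α * (m - n : ℤ))) volume 0 1 := fun n m =>
        (continuous_const.mul (hcont _)).intervalIntegrable _ _
      have h4 : ∀ n : ℤ, IntervalIntegrable (fun α : ℝ => ∑ m ∈ S,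
          (c m * (starRingEnd ℂ) (c n)) * circExp (α * (m - n : ℤ))) volume 0 1 := fun n =>
        (continuous_finsetSum _ fun m _ => continuous_const.mul (hcont _)).intervalIntegrable _ _
      rw [intervalIntegral.integral_finsetSum fun n _ => h4 n, Complex.ofReal_sum]
      refine sum_congr rfl fun n hn => ?_
      rw [intervalIntegral.integral_finsetSum fun m _ => h3 n m]
      simp only [intervalIntegral.integral_const_mul, integral_circExp_int, sub_eq_zero]
      rw [sum_eq_single n]
      · rw [if_pos rfl, mul_one, Complex.mul_conj', Complex.ofReal_pow]
      · intro m _ hm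
        rw [if_neg hm, mul_zero]
      · intro h; exact absurd hn h
    exact_mod_cast h2
  set A := ∑ n ∈ S, ‖c n‖ ^ 2 with hA
  have hA0 : 0 ≤ A := sum_nonneg fun _ _ => by positivity
  have h3 : A ≤ ∫ α in (0 : ℝ)..1, (‖f α‖ ^ 2 + ‖P α‖ ^ 2) / 2 := by
    have h4 : A = ‖∫ α in (0 : ℝ)..1, f α * P α‖ := by
      rw [hfP, Complex.norm_real, Real.norm_eq_abs, abs_of_nonneg hA0]
    rw [h4]
    refine (intervalIntegral.norm_integral_le_integral_norm zero_le_one).trans ?_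
    refine intervalIntegral.integral_mono_on zero_le_one ?_ ?_ fun α _ => ?_
    · exact (hf.mul hPc).norm.intervalIntegrable _ _
    · exact (((hf.norm.pow 2).add (hPc.norm.pow 2)).div_const 2).intervalIntegrable _ _
    · rw [norm_mul]
      nlinarith [sq_nonneg (‖f α‖ - ‖P α‖)]
  have hf2 : IntervalIntegrable (fun α => ‖f α‖ ^ 2) volume 0 1 :=
    (hf.norm.pow 2).intervalIntegrable _ _
  have hP2 : IntervalIntegrable (fun α => ‖P α‖ ^ 2) volume 0 1 :=
    (hPc.norm.pow 2).intervalIntegrable _ _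
  rw [intervalIntegral.integral_div, intervalIntegral.integral_add hf2 hP2, hPP] at h3
  change A ≤ _
  linarith

/-- The Fourier coefficients of an absolutely convergent trigonometric series. -/
theorem integral_tsum_mul_circExp {ι : Type*} [Countable ι] {c : ι → ℂ}
    (hc : Summable fun i => ‖c i‖) (n : ι → ℤ) (k : ℤ) :
    ∫ α in (0 : ℝ)..1, (∑' i, c i * circExp (α * n i)) * circExp (α * (-k : ℤ)) =
      ∑' i, if n i = k then c i else 0 := by
  have hcont : ∀ k : ℤ, Continuous fun α : ℝ => circExp (α * k) := fun k =>
    continuous_circExp.comp (continuous_id.mul continuous_const)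
  have h1 : ∀ α : ℝ, (∑' i, c i * circExp (α * n i)) * circExp (α * (-k : ℤ)) =
      ∑' i, c i * circExp (α * (n i - k : ℤ)) := by
    intro α
    rw [← tsum_mul_right]
    refine tsum_congr fun i => ?_
    rw [mul_assoc, ← circExp_add]
    congr 2
    push_cast
    ring
  simp only [h1]
  rw [intervalIntegral.integral_of_le zero_le_one]
  have h2 := hasSum_integral_of_summable_integral_norm (μ := volume.restrict (Set.Ioc (0 : ℝ) 1))
    (F := fun i α => c i * circExp (α * (n i - k : ℤ)))
    (fun i => ((continuous_const.mul (hcont _)).integrableOn_Ioc))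
    (by
      simp only [norm_mul, norm_circExp, mul_one]
      simpa using hc)
  rw [← h2.tsum_eq]
  refine tsum_congr fun i => ?_
  rw [← intervalIntegral.integral_of_le zero_le_one, intervalIntegral.integral_const_mul,
    integral_circExp_int]
  simp only [sub_eq_zero]
  split_ifs <;> simp

theorem thetaTerm_eq (η α : ℝ) (x : ℤ) :
    thetaTerm η α x = (Real.exp (-(Real.pi * η * (x : ℝ) ^ 2)) : ℂ) * circExp (α * (x ^ 2 : ℤ)) := by
  rw [thetaTerm]
  push_cast
  rfl

theorem thetaSum_sq_eq_tsum {η : ℝ} (hη : 0 < η) (α : ℝ) :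
    thetaSum η α ^ 2 = ∑' p : ℤ × ℤ, ((Real.exp (-(Real.pi * η * (p.1 : ℝ) ^ 2)) : ℂ) *
      (Real.exp (-(Real.pi * η * (p.2 : ℝ) ^ 2)) : ℂ)) * circExp (α * (p.1 ^ 2 + p.2 ^ 2 : ℤ)) := by
  have h := summable_norm_thetaTerm hη α
  rw [sq, thetaSum, tsum_mul_tsum_of_summable_norm h h]
  refine tsum_congr fun p => ?_
  rw [thetaTerm_eq, thetaTerm_eq]
  have : circExp (α * (p.1 ^ 2 + p.2 ^ 2 : ℤ)) =
      circExp (α * (p.1 ^ 2 : ℤ)) * circExp (α * (p.2 ^ 2 : ℤ)) := by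
    rw [← circExp_add]
    congr 1
    push_cast
    ring
  rw [this]
  ring

theorem integral_thetaSum_sq_eq_zero {η : ℝ} (hη : 0 < η) {k : ℤ}
    (hk : ∀ x y : ℤ, x ^ 2 + y ^ 2 ≠ k) :
    ∫ α in (0 : ℝ)..1, thetaSum η α ^ 2 * circExp (α * (-k : ℤ)) = 0 := by
  simp only [thetaSum_sq_eq_tsum hη]
  rw [integral_tsum_mul_circExp (n := fun p : ℤ × ℤ => p.1 ^ 2 + p.2 ^ 2)]
  · simp [hk]
  · have h1 := summable_norm_thetaTerm hη 0
    have h2 := (h1.mul_of_nonneg h1 (fun _ => norm_nonneg _) (fun _ => norm_nonneg _))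
    refine h2.congr fun p => ?_
    rw [norm_thetaTerm, norm_thetaTerm, norm_mul, Complex.norm_real, Complex.norm_real,
      Real.norm_eq_abs, Real.norm_eq_abs, abs_of_pos (Real.exp_pos _), abs_of_pos (Real.exp_pos _)]

theorem continuous_thetaSum {η : ℝ} (hη : 0 < η) : Continuous (thetaSum η) := by
  unfold thetaSum
  refine continuous_tsum (u := fun x : ℤ => Real.exp (-(Real.pi * η * (x : ℝ) ^ 2))) ?_
    (summable_gaussian_int hη) ?_
  · intro x
    exact continuous_const.mul (continuous_circExp.comp (continuous_id.mul continuous_const))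
  · intro x α
    rw [norm_thetaTerm]

theorem norm_geom_ratio_lt_one {η : ℝ} (hη : 0 < η) (β : ℝ) :
    ‖(Real.exp (-(Real.pi * η)) : ℂ) * circExp β‖ < 1 := by
  rw [norm_mul, norm_circExp, mul_one, Complex.norm_real, Real.norm_eq_abs,
    abs_of_pos (Real.exp_pos _), Real.exp_lt_one_iff]
  have : 0 < Real.pi * η := by positivity
  linarith

theorem continuous_geomKernel {η : ℝ} (hη : 0 < η) : Continuous (geomKernel η) := by
  have : geomKernel η = fun β => (1 - (Real.exp (-(Real.pi * η)) : ℂ) * circExp β)⁻¹ :=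
    funext (geomKernel_eq η)
  rw [this]
  refine Continuous.inv₀ (continuous_const.sub (continuous_const.mul continuous_circExp)) ?_
  intro β h
  have h1 := norm_geom_ratio_lt_one hη β
  rw [← sub_eq_zero.1 h, norm_one] at h1
  exact lt_irrefl _ h1

theorem continuous_modelSum {η : ℝ} (hη : 0 < η) (Q : ℕ) : Continuous (modelSum η Q) := by
  unfold modelSum
  refine continuous_finsetSum _ fun p _ => ?_
  exact continuous_const.mul ((continuous_geomKernel hη).comp (continuous_id.sub continuous_const))

theorem geomKernel_eq_tsum {η : ℝ} (hη : 0 < η) (β : ℝ) :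
    geomKernel η β = ∑' m : ℕ, (Real.exp (-(Real.pi * η * m)) : ℂ) * circExp (β * m) := by
  rw [geomKernel_eq, ← tsum_geometric_of_norm_lt_one (norm_geom_ratio_lt_one hη β)]
  refine tsum_congr fun m => ?_
  rw [mul_pow, mul_comm β, circExp_nat_mul, ← Complex.ofReal_pow, ← Real.exp_nat_mul]
  congr 3
  ring

/-- The geometric series has nonnegative frequencies only, each exactly once, so translation by t
multiplies the k-th coefficient by the phase -tk. -/
theorem integral_geomKernel {η : ℝ} (hη : 0 < η) (t : ℝ) (k : ℕ) :
    ∫ α in (0 : ℝ)..1, geomKernel η (α - t) * circExp (α * (-(k : ℤ) : ℤ)) =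
      (Real.exp (-(Real.pi * η * k)) : ℂ) * circExp (-(t * k)) := by
  have h1 : ∀ α : ℝ, geomKernel η (α - t) =
      ∑' m : ℕ, ((Real.exp (-(Real.pi * η * m)) : ℂ) * circExp (-(t * m))) *
        circExp (α * (m : ℤ)) := by
    intro α
    rw [geomKernel_eq_tsum hη]
    refine tsum_congr fun m => ?_
    rw [mul_assoc (Complex.ofReal _) (circExp _) (circExp _), ← circExp_add]
    congr 2
    push_cast
    ring
  simp only [h1]
  rw [integral_tsum_mul_circExp (n := fun m : ℕ => (m : ℤ)), tsum_eq_single k]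
  · rw [if_pos rfl]
  · intro m hm
    rw [if_neg (by exact_mod_cast hm)]
  · simp only [norm_mul, norm_circExp, mul_one, Complex.norm_real, Real.norm_eq_abs,
      abs_of_pos (Real.exp_pos _)]
    have : ∀ m : ℕ, Real.exp (-(Real.pi * η * m)) = Real.exp (-(Real.pi * η)) ^ m := by
      intro m
      rw [← Real.exp_nat_mul]
      congr 1
      ring
    simp only [this]
    refine summable_geometric_of_lt_one (Real.exp_pos _).le ?_
    rw [Real.exp_lt_one_iff]
    have : 0 < Real.pi * η := by positivity
    linarith

/-- The major arc model for the number of representations as a sum of two squares, divided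
by `π`. -/
noncomputable def modelCoeff (Q k : ℕ) : ℂ :=
  ∑ p ∈ (Ioc 0 Q).sigma fun q => {u ∈ range q | u.Coprime q},
    quadGauss p.1 p.2 0 ^ 2 / (p.1 : ℂ) ^ 2 * circExp (-(p.2 / p.1 * k))

theorem integral_modelSum {η : ℝ} (hη : 0 < η) (Q k : ℕ) :
    ∫ α in (0 : ℝ)..1, modelSum η Q α * circExp (α * (-(k : ℤ) : ℤ)) =
      Real.pi * (Real.exp (-(Real.pi * η * k)) : ℂ) * modelCoeff Q k := by
  simp only [modelSum, sum_mul]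
  rw [intervalIntegral.integral_finsetSum]
  · rw [modelCoeff, mul_sum]
    refine sum_congr rfl fun p _ => ?_
    simp only [mul_assoc]
    rw [intervalIntegral.integral_const_mul, intervalIntegral.integral_const_mul,
      integral_geomKernel hη]
    ring_nf
  · intro p _
    refine Continuous.intervalIntegrable ?_ _ _
    refine (continuous_const.mul ((continuous_geomKernel hη).comp
      (continuous_id.sub continuous_const))).mul ?_
    exact continuous_circExp.comp (continuous_id.mul continuous_const)

end

/-! ### Mean values over the arcs -/

section

open Finset MeasureTheory

theorem inv_sq_add_sq_eq {c : ℝ} (hc : 0 < c) (x : ℝ) :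
    (c ^ 2 + x ^ 2)⁻¹ = (c ^ 2)⁻¹ * (1 + (x / c) ^ 2)⁻¹ := by
  rw [← mul_inv]
  congr 1
  field_simp

theorem integrable_inv_sq_add_sq {c : ℝ} (hc : 0 < c) :
    Integrable fun x : ℝ => (c ^ 2 + x ^ 2)⁻¹ := by
  simp only [inv_sq_add_sq_eq hc]
  exact (integrable_inv_one_add_sq.comp_div hc.ne').const_mul _

theorem integral_univ_inv_sq_add_sq {c : ℝ} (hc : 0 < c) :
    ∫ x : ℝ, (c ^ 2 + x ^ 2)⁻¹ = Real.pi / c := by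
  simp only [inv_sq_add_sq_eq hc]
  rw [integral_const_mul, Measure.integral_comp_div (fun x : ℝ => (1 + x ^ 2)⁻¹) c,
    integral_univ_inv_one_add_sq, abs_of_pos hc, smul_eq_mul]
  field_simp

/-- Each term is translated by its own fraction and extended to the real line. All terms then carry
the same kernel, of mass π/c, and the translates of W are summed before integrating. -/
theorem integral_arcSum_mul_le {c : ℝ} (hc : 0 < c) {q : ℕ} (hq : 0 < q) {W : ℝ → ℝ}
    (hW : Continuous W) (hW0 : ∀ x, 0 ≤ W x) {A : ℝ}
    (hA : ∀ β, ∑ a ∈ Ico (-q : ℤ) (2 * q), W (β + a / q) ≤ A) :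
    ∫ α in (0 : ℝ)..1, arcSum c q α * W α ≤ A * (Real.pi / c) := by
  have hWA : ∀ x, W x ≤ A := by
    intro x
    refine le_trans ?_ (hA x)
    have h0 : (0 : ℤ) ∈ Ico (-q : ℤ) (2 * q) := by
      rw [mem_Ico]; omega
    have := single_le_sum (f := fun a : ℤ => W (x + a / q)) (fun _ _ => hW0 _) h0
    simpa using this
  have hint : ∀ a : ℤ, Integrable fun β : ℝ => (c ^ 2 + β ^ 2)⁻¹ * W (β + a / q) := by
    intro a
    refine ((integrable_inv_sq_add_sq hc).mul_const A).mono' ?_ ?_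
    · exact ((integrable_inv_sq_add_sq hc).aestronglyMeasurable).mul
        (hW.comp (continuous_id.add continuous_const)).aestronglyMeasurable
    · refine Filter.Eventually.of_forall fun β => ?_
      have h1 : 0 ≤ (c ^ 2 + β ^ 2)⁻¹ := by positivity
      rw [Real.norm_eq_abs, abs_of_nonneg (mul_nonneg h1 (hW0 _))]
      gcongr
      exact hWA _
  have hint2 : ∀ a : ℤ, Integrable fun α : ℝ => (c ^ 2 + (α - a / q) ^ 2)⁻¹ * W α := by
    intro a
    refine ((hint a).comp_sub_right ((a : ℝ) / q)).congr (Filter.Eventually.of_forall fun β => ?_)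
    simp
  have hle : ∀ a : ℤ, ∫ α in (0 : ℝ)..1, (c ^ 2 + (α - a / q) ^ 2)⁻¹ * W α ≤
      ∫ β : ℝ, (c ^ 2 + β ^ 2)⁻¹ * W (β + a / q) := by
    intro a
    have e := integral_sub_right_eq_self (μ := volume)
      (fun β : ℝ => (c ^ 2 + β ^ 2)⁻¹ * W (β + a / q)) ((a : ℝ) / q)
    simp only [sub_add_cancel] at e
    rw [← e, intervalIntegral.integral_of_le zero_le_one]
    refine setIntegral_le_integral (hint2 a) (Filter.Eventually.of_forall fun β => ?_)
    exact mul_nonneg (by positivity) (hW0 _)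
  calc _ = ∑ a ∈ Ico (-q : ℤ) (2 * q),
        ∫ α in (0 : ℝ)..1, (c ^ 2 + (α - a / q) ^ 2)⁻¹ * W α := by
        simp only [arcSum, sum_mul]
        exact intervalIntegral.integral_finsetSum fun a _ => (hint2 a).intervalIntegrable
    _ ≤ ∑ a ∈ Ico (-q : ℤ) (2 * q), ∫ β : ℝ, (c ^ 2 + β ^ 2)⁻¹ * W (β + a / q) :=
        sum_le_sum fun a _ => hle a
    _ = ∫ β : ℝ, ∑ a ∈ Ico (-q : ℤ) (2 * q), (c ^ 2 + β ^ 2)⁻¹ * W (β + a / q) :=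
        (integral_finsetSum _ fun a _ => hint a).symm
    _ ≤ ∫ β : ℝ, A * (c ^ 2 + β ^ 2)⁻¹ := by
        refine integral_mono (integrable_finsetSum _ fun a _ => hint a)
          ((integrable_inv_sq_add_sq hc).const_mul A) fun β => ?_
        simp only
        rw [← mul_sum, mul_comm]
        exact mul_le_mul_of_nonneg_right (hA β) (by positivity)
    _ = _ := by rw [integral_const_mul, integral_univ_inv_sq_add_sq hc]

theorem sum_Ico_circExp {q : ℕ} (hq : 0 < q) (k : ℤ) :
    ∑ a ∈ Ico (-q : ℤ) (2 * q), circExp ((a : ℝ) / q * k) =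
      if (q : ℤ) ∣ k then (3 * q : ℂ) else 0 := by
  have hq' : (q : ℝ) ≠ 0 := by exact_mod_cast hq.ne'
  have h1 : ∑ a ∈ Ico (-q : ℤ) (2 * q), circExp ((a : ℝ) / q * k) =
      ∑ j ∈ range (3 * q), circExp ((k * j : ℤ) / q : ℝ) := by
    symm
    refine sum_bij (fun j _ => (j : ℤ) - q) ?_ ?_ ?_ ?_
    · intro j hj
      rw [mem_range] at hj
      rw [mem_Ico]
      omega
    · intro i _ j _ h
      omega
    · intro a ha
      rw [mem_Ico] at ha
      exact ⟨(a + q).toNat, mem_range.2 (by omega), by omega⟩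
    · intro j _
      refine circExp_eq_of_eq_add_int k ?_
      push_cast
      field_simp
      ring
  rw [h1, sum_range_mul_of_periodic (g := fun j : ℕ => circExp ((k * j : ℤ) / q : ℝ)),
    sum_range_circExp hq]
  · split_ifs
    · push_cast; ring
    · simp
  · intro y
    refine circExp_eq_of_eq_add_int k ?_
    push_cast
    field_simp

/-- On expanding the square, the sum over a (three full periods) detects the congruence modulo q
between frequencies; the weights, at most 1, and the remaining phases are then dropped. -/
theorem sum_Ico_norm_sq_le {ι : Type*} [DecidableEq ι] (P : Finset ι) {w : ι → ℝ}
    (hw0 : ∀ i, 0 ≤ w i) (hw1 : ∀ i, w i ≤ 1) (n : ι → ℤ) {q : ℕ} (hq : 0 < q) (β : ℝ) :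
    ∑ a ∈ Ico (-q : ℤ) (2 * q), ‖∑ i ∈ P, (w i : ℂ) * circExp ((β + a / q) * n i)‖ ^ 2 ≤
      3 * q * #{x ∈ P ×ˢ P | (q : ℤ) ∣ n x.1 - n x.2} := by
  have h1 : ∀ a : ℤ, ((‖∑ i ∈ P, (w i : ℂ) * circExp ((β + a / q) * n i)‖ ^ 2 : ℝ) : ℂ) =
      ∑ x ∈ P ×ˢ P, (w x.1 * w x.2 * circExp (β * (n x.1 - n x.2 : ℤ))) *
        circExp ((a : ℝ) / q * (n x.1 - n x.2 : ℤ)) := by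
    intro a
    rw [Complex.ofReal_pow, ← Complex.mul_conj', map_sum, sum_mul_sum, ← sum_product']
    refine sum_congr rfl fun x _ => ?_
    rw [map_mul, conj_circExp, Complex.conj_ofReal]
    have : circExp (β * (n x.1 - n x.2 : ℤ)) * circExp ((a : ℝ) / q * (n x.1 - n x.2 : ℤ)) =
        circExp ((β + a / q) * n x.1) * circExp (-((β + a / q) * n x.2)) := by
      rw [← circExp_add, ← circExp_add]
      congr 1
      push_cast
      ring
    rw [mul_assoc (_ * _) (circExp _) (circExp _), this]
    ring
  have h2 : ((∑ a ∈ Ico (-q : ℤ) (2 * q),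
      ‖∑ i ∈ P, (w i : ℂ) * circExp ((β + a / q) * n i)‖ ^ 2 : ℝ) : ℂ) =
      ∑ x ∈ P ×ˢ P, (w x.1 * w x.2 * circExp (β * (n x.1 - n x.2 : ℤ))) *
        (if (q : ℤ) ∣ n x.1 - n x.2 then (3 * q : ℂ) else 0) := by
    rw [Complex.ofReal_sum]
    simp only [h1]
    rw [sum_comm]
    refine sum_congr rfl fun x _ => ?_
    rw [← mul_sum, sum_Ico_circExp hq]
  have h3 : 0 ≤ ∑ a ∈ Ico (-q : ℤ) (2 * q),
      ‖∑ i ∈ P, (w i : ℂ) * circExp ((β + a / q) * n i)‖ ^ 2 :=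
    sum_nonneg fun _ _ => by positivity
  rw [← abs_of_nonneg h3, ← Real.norm_eq_abs, ← Complex.norm_real, h2]
  calc _ ≤ ∑ x ∈ P ×ˢ P, if (q : ℤ) ∣ n x.1 - n x.2 then (3 * q : ℝ) else 0 := by
        refine norm_sum_le_of_le _ fun x _ => ?_
        rw [norm_mul, norm_mul, norm_circExp, mul_one, norm_mul, Complex.norm_real,
          Complex.norm_real, Real.norm_eq_abs, Real.norm_eq_abs, abs_of_nonneg (hw0 _),
          abs_of_nonneg (hw0 _)]
        have h4 : w x.1 * w x.2 ≤ 1 := mul_le_one₀ (hw1 _) (hw0 _) (hw1 _)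
        split_ifs
        · rw [norm_mul, Complex.norm_natCast]
          norm_num
          have : (0 : ℝ) ≤ 3 * q := by positivity
          nlinarith
        · simp
    _ = _ := by
        rw [← sum_filter, sum_const, nsmul_eq_mul]
        ring

/-- The weighted exponential sum over the small squares. -/
noncomputable def smallSum (η : ℝ) (M : ℕ) (α : ℝ) : ℂ :=
  ∑ a ∈ Ioc 0 M, (Real.exp (-(Real.pi * η * (a : ℝ) ^ 2)) : ℂ) * circExp (α * (a ^ 2 : ℤ))

/-- The number of quadruples of positive integers `a, b, c, d ≤ M` for which
`a² + b² ≡ c² + d²` modulo `q`. -/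
def quadCount (M q : ℕ) : ℕ :=
  #{x ∈ (Ioc 0 M ×ˢ Ioc 0 M) ×ˢ (Ioc 0 M ×ˢ Ioc 0 M) |
    (q : ℤ) ∣ ((x.1.1 : ℤ) ^ 2 + (x.1.2 : ℤ) ^ 2) - ((x.2.1 : ℤ) ^ 2 + (x.2.2 : ℤ) ^ 2)}

theorem smallSum_sq (η : ℝ) (M : ℕ) (α : ℝ) :
    smallSum η M α ^ 2 = ∑ p ∈ Ioc 0 M ×ˢ Ioc 0 M,
      ((Real.exp (-(Real.pi * η * ((p.1 : ℝ) ^ 2 + (p.2 : ℝ) ^ 2))) : ℝ) : ℂ) *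
        circExp (α * ((p.1 : ℤ) ^ 2 + (p.2 : ℤ) ^ 2 : ℤ)) := by
  rw [sq, smallSum, sum_mul_sum, ← sum_product']
  refine sum_congr rfl fun p _ => ?_
  have h1 : circExp (α * ((p.1 : ℤ) ^ 2 + (p.2 : ℤ) ^ 2 : ℤ)) =
      circExp (α * ((p.1 : ℤ) ^ 2 : ℤ)) * circExp (α * ((p.2 : ℤ) ^ 2 : ℤ)) := by
    rw [← circExp_add]
    congr 1
    push_cast
    ring
  have h2 : Real.exp (-(Real.pi * η * ((p.1 : ℝ) ^ 2 + (p.2 : ℝ) ^ 2))) =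
      Real.exp (-(Real.pi * η * (p.1 : ℝ) ^ 2)) * Real.exp (-(Real.pi * η * (p.2 : ℝ) ^ 2)) := by
    rw [← Real.exp_add]
    congr 1
    ring
  rw [h1, h2, Complex.ofReal_mul]
  ring

theorem continuous_smallSum (η : ℝ) (M : ℕ) : Continuous (smallSum η M) := by
  unfold smallSum
  refine continuous_finsetSum _ fun a _ => ?_
  exact continuous_const.mul (continuous_circExp.comp (continuous_id.mul continuous_const))

theorem sum_Ico_smallSum_pow_four_le {η : ℝ} (hη : 0 < η) (M : ℕ) {q : ℕ} (hq : 0 < q) (β : ℝ) :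
    ∑ a ∈ Ico (-q : ℤ) (2 * q), ‖smallSum η M (β + a / q)‖ ^ 4 ≤ 3 * q * quadCount M q := by
  have h := sum_Ico_norm_sq_le (Ioc 0 M ×ˢ Ioc 0 M)
    (w := fun p : ℕ × ℕ => Real.exp (-(Real.pi * η * ((p.1 : ℝ) ^ 2 + (p.2 : ℝ) ^ 2))))
    (fun _ => (Real.exp_pos _).le)
    (fun p => Real.exp_le_one_iff.2 (by
      have : 0 ≤ Real.pi * η * ((p.1 : ℝ) ^ 2 + (p.2 : ℝ) ^ 2) := by positivity
      linarith))
    (fun p : ℕ × ℕ => (p.1 : ℤ) ^ 2 + (p.2 : ℤ) ^ 2) hq β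
  refine le_trans (le_of_eq (sum_congr rfl fun a _ => ?_)) h
  rw [← smallSum_sq, norm_pow]
  ring

theorem quadCount_le (M q : ℕ) : quadCount M q ≤ M ^ 4 := by
  refine (card_filter_le _ _).trans (le_of_eq ?_)
  simp
  ring

set_option maxHeartbeats 800000 in
/-- The mean square of the error of the model, weighted by the small squares. -/
theorem integral_norm_sq_error_le {η : ℝ} (hη : 0 < η) (hη4 : η ≤ 1 / 4) {τ : ℝ}
    (hτ0 : 0 < τ) {Q N : ℕ} (hN : 0 < N) (hτ : 4 * (Q : ℝ) ^ 2 * τ ≤ 1)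
    {B : ℝ} (hB : (Q : ℝ) ^ 2 * (η ^ 2 + 4 * τ ^ 2) ≤ B * η) (hB1 : B ≤ 1)
    (hNη : (N : ℝ) ^ 2 * η ≤ 1) (hNη' : 1 ≤ ((N : ℝ) + 1) ^ 2 * η) (M : ℕ) :
    ∫ α in (0 : ℝ)..1, ‖(thetaSum η α ^ 2 - modelSum η Q α) * smallSum η M α ^ 2‖ ^ 2 ≤
      2 * (4 * 11 ^ 4) * (3 * (Real.pi / η)) * ∑ q ∈ Ioc Q N, (quadCount M q : ℝ) / q +
      ((16 * B / η + 60 + 7 * (Q : ℝ) ^ 4) ^ 2 * (2 * τ ^ 2) + 2 * (4 * 11 ^ 4) +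
        98 * (Q : ℝ) ^ 3) * (3 * (Q : ℝ) ^ 2 * (M : ℝ) ^ 4 * (Real.pi / τ)) := by
  set W : ℝ → ℝ := fun α => ‖smallSum η M α‖ ^ 4 with hW
  have hWc : Continuous W := (continuous_smallSum η M).norm.pow 4
  have hW0 : ∀ x, 0 ≤ W x := fun x => by positivity
  set C1 : ℝ := 2 * (4 * 11 ^ 4) with hC1
  set C2 : ℝ := (16 * B / η + 60 + 7 * (Q : ℝ) ^ 4) ^ 2 * (2 * τ ^ 2) + 2 * (4 * 11 ^ 4) +
    98 * (Q : ℝ) ^ 3 with hC2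
  have hC10 : 0 ≤ C1 := by positivity
  have hC20 : 0 ≤ C2 := by positivity
  have hac : ∀ (c : ℝ) (_ : 0 < c) (q : ℕ), Continuous (arcSum c q) := by
    intro c hc q
    unfold arcSum
    refine continuous_finsetSum _ fun a _ => ?_
    refine Continuous.inv₀ (by fun_prop) fun x => ?_
    positivity
  have hpt : ∀ α ∈ Set.Icc (0 : ℝ) 1,
      ‖(thetaSum η α ^ 2 - modelSum η Q α) * smallSum η M α ^ 2‖ ^ 2 ≤
      C1 * ∑ q ∈ Ioc Q N, ((q : ℝ) ^ 2)⁻¹ * (arcSum η q α * W α) +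
        C2 * ∑ q ∈ Ioc 0 Q, arcSum τ q α * W α := by
    intro α hα
    have h := norm_thetaSum_sq_sub_modelSum_sq_le hη hη4 hτ0 hN hτ hB hB1 hNη hNη' hα.1 hα.2
    rw [norm_mul, mul_pow, norm_pow (smallSum η M α), ← pow_mul]
    calc _ ≤ _ := mul_le_mul_of_nonneg_right h (hW0 α)
      _ = _ := by
        rw [add_mul, mul_assoc C1, mul_assoc C2, sum_mul, sum_mul]
        simp only [mul_assoc]
  have hi1 : ∀ q : ℕ, IntervalIntegrable (fun α => arcSum η q α * W α) volume 0 1 := fun q =>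
    ((hac η hη q).mul hWc).intervalIntegrable _ _
  have hi2 : ∀ q : ℕ, IntervalIntegrable (fun α => arcSum τ q α * W α) volume 0 1 := fun q =>
    ((hac τ hτ0 q).mul hWc).intervalIntegrable _ _
  have hi3 : IntervalIntegrable (fun α => ∑ q ∈ Ioc Q N, ((q : ℝ) ^ 2)⁻¹ * (arcSum η q α * W α))
      volume 0 1 :=
    (continuous_finsetSum _ fun q _ =>
      continuous_const.mul ((hac η hη q).mul hWc)).intervalIntegrable _ _
  have hi4 : IntervalIntegrable (fun α => ∑ q ∈ Ioc 0 Q, arcSum τ q α * W α) volume 0 1 :=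
    (continuous_finsetSum _ fun q _ => (hac τ hτ0 q).mul hWc).intervalIntegrable _ _
  have hi5 : IntervalIntegrable
      (fun α => ‖(thetaSum η α ^ 2 - modelSum η Q α) * smallSum η M α ^ 2‖ ^ 2) volume 0 1 :=
    ((((continuous_thetaSum hη).pow 2).sub (continuous_modelSum hη Q)).mul
      ((continuous_smallSum η M).pow 2)).norm.pow 2 |>.intervalIntegrable _ _
  calc _ ≤ ∫ α in (0 : ℝ)..1, (C1 * ∑ q ∈ Ioc Q N, ((q : ℝ) ^ 2)⁻¹ * (arcSum η q α * W α) +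
        C2 * ∑ q ∈ Ioc 0 Q, arcSum τ q α * W α) :=
        intervalIntegral.integral_mono_on zero_le_one hi5
          ((hi3.const_mul C1).add (hi4.const_mul C2)) hpt
    _ = C1 * ∑ q ∈ Ioc Q N, (((q : ℝ) ^ 2)⁻¹ * ∫ α in (0 : ℝ)..1, arcSum η q α * W α) +
        C2 * ∑ q ∈ Ioc 0 Q, ∫ α in (0 : ℝ)..1, arcSum τ q α * W α := by
        rw [intervalIntegral.integral_add (hi3.const_mul C1) (hi4.const_mul C2),
          intervalIntegral.integral_const_mul, intervalIntegral.integral_const_mul,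
          intervalIntegral.integral_finsetSum fun q _ => (hi1 q).const_mul _,
          intervalIntegral.integral_finsetSum fun q _ => hi2 q]
        simp only [intervalIntegral.integral_const_mul]
    _ ≤ C1 * ∑ q ∈ Ioc Q N, (3 * (Real.pi / η)) * ((quadCount M q : ℝ) / q) +
        C2 * ∑ q ∈ Ioc 0 Q, 3 * Q * (M : ℝ) ^ 4 * (Real.pi / τ) := by
        refine add_le_add (mul_le_mul_of_nonneg_left (sum_le_sum fun q hq => ?_) hC10)
          (mul_le_mul_of_nonneg_left (sum_le_sum fun q hq => ?_) hC20)
        · rw [mem_Ioc] at hq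
          have hq0 : 0 < q := by omega
          have hq1 : (0 : ℝ) < q := by exact_mod_cast hq0
          have h := integral_arcSum_mul_le hη hq0 hWc hW0
            (fun β => sum_Ico_smallSum_pow_four_le hη M hq0 β)
          calc _ ≤ ((q : ℝ) ^ 2)⁻¹ * (3 * q * quadCount M q * (Real.pi / η)) := by gcongr
            _ = _ := by field_simp
        -- For q ≤ Q the trivial count M⁴ suffices, because the kernel of width τ has only mass π/τ.
        · rw [mem_Ioc] at hq
          refine (integral_arcSum_mul_le hτ0 hq.1 hWc hW0
            (fun β => sum_Ico_smallSum_pow_four_le hη M hq.1 β)).trans ?_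
          have h1 : (q : ℝ) ≤ Q := by exact_mod_cast hq.2
          have h2 : (quadCount M q : ℝ) ≤ (M : ℝ) ^ 4 := by exact_mod_cast quadCount_le M q
          gcongr
    _ = _ := by
        rw [← mul_sum, sum_const, Nat.card_Ioc, nsmul_eq_mul, Nat.sub_zero]
        ring

end

/-! ### Counting a² + b² ≡ c² + d² on average over the modulus -/

section

open Finset

theorem sum_Ioc_one_div_le (Z : ℕ) :
    ∑ q ∈ Ioc 0 Z, 1 / (q : ℝ) ≤ 1 + Real.log Z := by
  have h := harmonic_le_one_add_log Z
  rw [harmonic_eq_sum_Icc] at h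
  push_cast at h
  refine le_trans (le_of_eq ?_) h
  refine sum_congr ?_ fun q _ => by rw [one_div]
  ext q
  simp [Nat.lt_iff_add_one_le]

theorem sum_Ioc_filter_dvd_one_div_le (Z : ℕ) {e : ℕ} (he : 0 < e) :
    ∑ q ∈ Ioc 0 Z with e ∣ q, 1 / (q : ℝ) ≤ 1 / e * (1 + Real.log Z) := by
  have h1 : ∑ q ∈ Ioc 0 Z with e ∣ q, 1 / (q : ℝ) ≤ ∑ k ∈ Ioc 0 Z, 1 / (e : ℝ) * (1 / k) := by
    have h2 : {q ∈ Ioc 0 Z | e ∣ q} ⊆ (Ioc 0 Z).image fun k => e * k := by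
      intro q hq
      simp only [mem_filter, mem_Ioc] at hq
      obtain ⟨⟨h0, h1⟩, k, rfl⟩ := hq
      refine mem_image.2 ⟨k, mem_Ioc.2 ⟨Nat.pos_of_mul_pos_left h0, ?_⟩, rfl⟩
      exact (Nat.le_mul_of_pos_left k he).trans h1
    refine (sum_le_sum_of_subset_of_nonneg h2 fun _ _ _ => by positivity).trans ?_
    rw [sum_image fun i _ j _ h => Nat.eq_of_mul_eq_mul_left he h]
    refine sum_le_sum fun k _ => le_of_eq ?_
    push_cast
    rw [one_div_mul_one_div]
  refine h1.trans ?_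
  rw [← mul_sum]
  gcongr
  exact sum_Ioc_one_div_le Z

/-- The gcd is at most the sum of the common divisors e. There are at most Z/e multiples u, and the
multiples w contribute (1/e)(1 + log Z'), so after the weight e a harmonic sum over e is left. -/
theorem sum_gcd_div_le (Z Z' : ℕ) :
    ∑ u ∈ Ioc 0 Z, ∑ w ∈ Ioc 0 Z', (u.gcd w : ℝ) / w ≤
      Z * (1 + Real.log Z) * (1 + Real.log Z') := by
  have hlog : 0 ≤ Real.log Z' := Real.log_natCast_nonneg _
  have h1 : ∀ u ∈ Ioc 0 Z, ∀ w ∈ Ioc 0 Z', (u.gcd w : ℝ) / w ≤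
      ∑ e ∈ Ioc 0 Z, if e ∣ u then (if e ∣ w then (e : ℝ) * (1 / w) else 0) else 0 := by
    intro u hu w _
    rw [mem_Ioc] at hu
    have hmem : u.gcd w ∈ Ioc 0 Z :=
      mem_Ioc.2 ⟨Nat.gcd_pos_of_pos_left _ hu.1, (Nat.gcd_le_left w hu.1).trans hu.2⟩
    refine le_trans (le_of_eq ?_) (single_le_sum
      (f := fun e : ℕ => if e ∣ u then (if e ∣ w then (e : ℝ) * (1 / w) else 0) else 0)
      (fun e _ => by split_ifs <;> positivity) hmem)
    rw [if_pos (Nat.gcd_dvd_left u w), if_pos (Nat.gcd_dvd_right u w)]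
    ring
  calc _ ≤ ∑ u ∈ Ioc 0 Z, ∑ w ∈ Ioc 0 Z', ∑ e ∈ Ioc 0 Z,
        if e ∣ u then (if e ∣ w then (e : ℝ) * (1 / w) else 0) else 0 :=
        sum_le_sum fun u hu => sum_le_sum fun w hw => h1 u hu w hw
    _ = ∑ e ∈ Ioc 0 Z, ∑ u ∈ Ioc 0 Z, if e ∣ u then
        (e : ℝ) * ∑ w ∈ Ioc 0 Z' with e ∣ w, 1 / (w : ℝ) else 0 := by
        rw [sum_comm]
        rw [sum_congr rfl fun w _ => sum_comm, sum_comm]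
        refine sum_congr rfl fun e _ => ?_
        rw [sum_comm]
        refine sum_congr rfl fun u _ => ?_
        split_ifs
        · rw [mul_sum, sum_filter]
        · simp
    _ ≤ ∑ e ∈ Ioc 0 Z, Z * (1 + Real.log Z') * (1 / (e : ℝ)) := by
        refine sum_le_sum fun e he => ?_
        rw [mem_Ioc] at he
        have he0 : (0 : ℝ) < e := by exact_mod_cast he.1
        rw [← sum_filter, sum_const, nsmul_eq_mul, Nat.Ioc_filter_dvd_card_eq_div]
        have h2 := sum_Ioc_filter_dvd_one_div_le Z' he.1
        have h3 : ((Z / e : ℕ) : ℝ) ≤ Z / e := Nat.cast_div_le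
        calc _ ≤ (Z / e : ℝ) * (e * (1 / e * (1 + Real.log Z'))) := by gcongr
          _ = _ := by field_simp
    _ ≤ _ := by
        rw [← mul_sum]
        have := sum_Ioc_one_div_le Z
        calc _ ≤ Z * (1 + Real.log Z') * (1 + Real.log Z) := by gcongr
          _ = _ := by ring

/-- Any two solutions v of uv ≡ -k mod q agree modulo m = q/gcd(u, q), so at most one residue class
modulo m occurs. -/
theorem card_filter_dvd_mul_add_le (Z : ℕ) (u : ℕ) {q : ℕ} (hq : 0 < q) (k : ℤ) :
    (#{v ∈ Ioc 0 Z | (q : ℤ) ∣ (u : ℤ) * (v : ℕ) + k} : ℝ) ≤ Z * ((u.gcd q : ℝ) / q) + 1 := by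
  set g := u.gcd q with hg
  have hg0 : 0 < g := Nat.gcd_pos_of_pos_right _ hq
  obtain ⟨m, hm⟩ : g ∣ q := Nat.gcd_dvd_right u q
  have hm0 : 0 < m := Nat.pos_of_ne_zero (by rintro rfl; omega)
  have hgm : (g : ℝ) / q = 1 / m := by
    have : (q : ℝ) = g * m := by exact_mod_cast hm
    rw [this]
    have : (g : ℝ) ≠ 0 := by positivity
    field_simp
  rw [hgm]
  rcases Finset.eq_empty_or_nonempty {v ∈ Ioc 0 Z | (q : ℤ) ∣ (u : ℤ) * (v : ℕ) + k} with h0 | ⟨v₀, hv₀⟩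
  · rw [h0]
    simp only [card_empty, Nat.cast_zero]
    positivity
  · have hsub : {v ∈ Ioc 0 Z | (q : ℤ) ∣ (u : ℤ) * (v : ℕ) + k} ⊆
        {v ∈ Ioc 0 Z | v ≡ v₀ [MOD m]} := by
      intro v hv
      rw [mem_filter] at hv hv₀ ⊢
      refine ⟨hv.1, ?_⟩
      have h1 : (q : ℤ) ∣ (u : ℤ) * ((v₀ : ℤ) - v) := by
        have e : (u : ℤ) * ((v₀ : ℤ) - v) = (u * v₀ + k) - (u * v + k) := by ring
        rw [e]
        exact dvd_sub hv₀.2 hv.2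
      obtain ⟨u', hu'⟩ : g ∣ u := Nat.gcd_dvd_left u q
      have h2 : (m : ℤ) ∣ (u' : ℤ) * ((v₀ : ℤ) - v) := by
        have hgZ : (g : ℤ) ≠ 0 := by exact_mod_cast hg0.ne'
        have e1 : (q : ℤ) = g * m := by exact_mod_cast hm
        have e2 : (u : ℤ) = g * u' := by exact_mod_cast hu'
        rw [e1, e2, mul_assoc] at h1
        exact (mul_dvd_mul_iff_left hgZ).1 h1
      have hcop : Nat.Coprime m u' := by
        have := Nat.coprime_div_gcd_div_gcd (m := u) (n := q) (by rw [← hg]; exact hg0)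
        rw [← hg] at this
        have e1 : u / g = u' := by
          conv_lhs => rw [hu']
          exact Nat.mul_div_cancel_left _ hg0
        have e2 : q / g = m := by
          conv_lhs => rw [hm]
          exact Nat.mul_div_cancel_left _ hg0
        rw [e1, e2] at this
        exact this.symm
      have h3 : (m : ℤ) ∣ (v₀ : ℤ) - v :=
        (Nat.isCoprime_iff_coprime.2 hcop).dvd_of_dvd_mul_left h2
      exact (Nat.modEq_iff_dvd).2 h3
    have hcard := card_le_card hsub
    have hmr : (0 : ℝ) < m := by exact_mod_cast hm0
    have h4 := Nat.Ioc_filter_modEq_card 0 Z hm0 v₀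
    have h5 : ((#{v ∈ Ioc 0 Z | v ≡ v₀ [MOD m]} : ℤ) : ℝ) ≤ Z * (1 / m) + 1 := by
      rw [h4]
      rw [Int.cast_max]
      refine max_le ?_ (by push_cast; positivity)
      push_cast
      have f1 := Int.floor_le (((Z : ℝ) - v₀) / m)
      have f2 := Int.lt_floor_add_one (((0 : ℕ) - v₀ : ℝ) / m)
      have e1 : ((⌊((Z : ℚ) - v₀) / m⌋ : ℤ) : ℝ) ≤ ((Z : ℝ) - v₀) / m := by
        have := Int.floor_le (((Z : ℚ) - v₀) / m)
        have h := (Rat.cast_le (K := ℝ)).2 this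
        push_cast at h
        exact h
      have e2 : ((0 : ℝ) - v₀) / m < (⌊((0 : ℚ) - v₀) / m⌋ : ℤ) + 1 := by
        have := Int.lt_floor_add_one (((0 : ℚ) - v₀) / m)
        have h := (Rat.cast_lt (K := ℝ)).2 this
        push_cast at h
        exact h
      have e3 : ((Z : ℝ) - v₀) / m = Z * (1 / m) + ((0 : ℝ) - v₀) / m := by ring
      linarith
    have h6 : (#{v ∈ Ioc 0 Z | (q : ℤ) ∣ (u : ℤ) * (v : ℕ) + k} : ℝ) ≤
        ((#{v ∈ Ioc 0 Z | v ≡ v₀ [MOD m]} : ℤ) : ℝ) := by exact_mod_cast hcard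
    exact h6.trans h5

/-- The values of the difference of two sums of two squares. -/
def quadDiff (x : (ℕ × ℕ) × (ℕ × ℕ)) : ℤ :=
  ((x.1.1 : ℤ) ^ 2 + (x.1.2 : ℤ) ^ 2) - ((x.2.1 : ℤ) ^ 2 + (x.2.2 : ℤ) ^ 2)

/-- The quadruples of positive integers that are at most `M`. -/
def quadBox (M : ℕ) : Finset ((ℕ × ℕ) × (ℕ × ℕ)) :=
  (Ioc 0 M ×ˢ Ioc 0 M) ×ˢ (Ioc 0 M ×ˢ Ioc 0 M)

theorem mem_quadBox {M : ℕ} {x : (ℕ × ℕ) × (ℕ × ℕ)} : x ∈ quadBox M ↔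
    ((0 < x.1.1 ∧ x.1.1 ≤ M) ∧ (0 < x.1.2 ∧ x.1.2 ≤ M)) ∧
      ((0 < x.2.1 ∧ x.2.1 ≤ M) ∧ (0 < x.2.2 ∧ x.2.2 ≤ M)) := by
  simp only [quadBox, mem_product, mem_Ioc]

/-- The equation reads (a - c)(a + c) = (d - b)(d + b). With u = a - c, v = a + c and w = d - b it
gives w ∣ uv, and (u, w, v) determines the quadruple because w ≠ 0. The summand 0 fits the shape of
`card_filter_dvd_mul_add_le`. -/
theorem card_quadDiff_eq_zero_of_lt_le (M : ℕ) :
    #{x ∈ quadBox M | quadDiff x = 0 ∧ x.2.1 < x.1.1} ≤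
      ∑ u ∈ Ioc 0 (2 * M), ∑ w ∈ Ioc 0 (2 * M),
        #{v ∈ Ioc 0 (2 * M) | ((w : ℕ) : ℤ) ∣ (u : ℤ) * (v : ℕ) + 0} := by
  simp only [card_filter, ← sum_product']
  rw [← card_filter, ← card_filter]
  refine card_le_card_of_injOn (fun x => (x.1.1 - x.2.1, x.2.2 - x.1.2, x.1.1 + x.2.1)) ?_ ?_
  · rintro ⟨⟨a, b⟩, c, d⟩ hx
    simp only [coe_filter, mem_quadBox, Set.mem_ofPred_eq] at hx
    simp only [quadDiff] at hx
    obtain ⟨⟨⟨⟨ha0, ha⟩, hb0, hb⟩, ⟨hc0, hc⟩, hd0, hd⟩, h0, hlt⟩ := hx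
    have hbd : b < d := by
      by_contra hcon
      have h1 : (d : ℤ) ≤ b := by exact_mod_cast not_lt.1 hcon
      have h2 : (c : ℤ) < a := by exact_mod_cast hlt
      nlinarith
    simp only [coe_filter, mem_product, mem_Ioc, Set.mem_ofPred_eq]
    refine ⟨⟨⟨by omega, by omega⟩, ⟨by omega, by omega⟩, by omega, by omega⟩, ?_⟩
    refine ⟨(d : ℤ) + b, ?_⟩
    rw [Nat.cast_sub hlt.le, Nat.cast_sub hbd.le]
    push_cast
    linarith
  · rintro ⟨⟨a, b⟩, c, d⟩ hx ⟨⟨a', b'⟩, c', d'⟩ hx' h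
    simp only [coe_filter, mem_quadBox, Set.mem_ofPred_eq] at hx hx'
    simp only [quadDiff] at hx hx'
    obtain ⟨-, h0, hlt⟩ := hx
    obtain ⟨-, h0', hlt'⟩ := hx'
    simp only [Prod.mk.injEq] at h
    obtain ⟨h1, h2, h3⟩ := h
    have ha : a = a' := by omega
    have hc : c = c' := by omega
    subst ha hc
    have key : ∀ b d : ℕ, ((a : ℤ) ^ 2 + (b : ℤ) ^ 2) - ((c : ℤ) ^ 2 + (d : ℤ) ^ 2) = 0 → b < d := by
      intro b d h
      by_contra hcon
      have h1 : (d : ℤ) ≤ b := by exact_mod_cast not_lt.1 hcon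
      have h2 : (c : ℤ) < a := by exact_mod_cast hlt
      nlinarith
    have hbd := key b d h0
    have hbd' := key b' d' h0'
    have hw : (d : ℤ) - b = d' - b' := by omega
    have hw0 : (d : ℤ) - b ≠ 0 := by omega
    have ht : (d : ℤ) + b = d' + b' := by
      refine mul_left_cancel₀ hw0 ?_
      have : ((d : ℤ) - b) * (d' + b') = (d' - b') * (d' + b') := by rw [hw]
      rw [this]
      linarith
    obtain ⟨rfl, rfl⟩ : b = b' ∧ d = d' := by omega
    rfl

theorem card_filter_quadBox_swap_le (M : ℕ) {P R : (ℕ × ℕ) × (ℕ × ℕ) → Prop} [DecidablePred P]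
    [DecidablePred R] (h : ∀ x, P x → R (x.2, x.1)) :
    #{x ∈ quadBox M | P x} ≤ #{x ∈ quadBox M | R x} := by
  refine card_le_card_of_injOn (fun x => (x.2, x.1)) ?_ ?_
  · intro x hx
    simp only [coe_filter, mem_quadBox, Set.mem_ofPred_eq] at hx ⊢
    exact ⟨⟨hx.1.2, hx.1.1⟩, h x hx.2⟩
  · intro x _ y _ hxy
    simp only [Prod.mk.injEq] at hxy
    exact Prod.ext hxy.2 hxy.1

theorem card_filter_quadBox_flip_le (M : ℕ) {P R : (ℕ × ℕ) × (ℕ × ℕ) → Prop} [DecidablePred P]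
    [DecidablePred R] (h : ∀ x : (ℕ × ℕ) × (ℕ × ℕ), P x → R ((x.1.2, x.1.1), (x.2.2, x.2.1))) :
    #{x ∈ quadBox M | P x} ≤ #{x ∈ quadBox M | R x} := by
  refine card_le_card_of_injOn (fun x => ((x.1.2, x.1.1), (x.2.2, x.2.1))) ?_ ?_
  · intro x hx
    simp only [coe_filter, mem_quadBox, Set.mem_ofPred_eq] at hx ⊢
    exact ⟨⟨⟨hx.1.1.2, hx.1.1.1⟩, hx.1.2.2, hx.1.2.1⟩, h x hx.2⟩
  · rintro ⟨⟨a, b⟩, c, d⟩ _ ⟨⟨a', b'⟩, c', d'⟩ _ hxy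
    simp only [Prod.mk.injEq] at hxy ⊢
    tauto

theorem card_quadDiff_eq_zero_diag_le (M : ℕ) :
    #{x ∈ quadBox M | quadDiff x = 0 ∧ x.1.1 = x.2.1} ≤ M ^ 2 := by
  have : #(Ioc 0 M ×ˢ Ioc 0 M) = M ^ 2 := by simp [sq]
  rw [← this]
  refine card_le_card_of_injOn (fun x => x.1) ?_ ?_
  · intro x hx
    simp only [coe_filter, mem_quadBox, Set.mem_ofPred_eq] at hx
    simp only [coe_product, Set.mem_prod, mem_coe, mem_Ioc]
    exact hx.1.1
  · rintro ⟨⟨a, b⟩, c, d⟩ hx ⟨⟨a', b'⟩, c', d'⟩ hx' h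
    simp only [coe_filter, mem_quadBox, Set.mem_ofPred_eq] at hx hx'
    simp only [quadDiff] at hx hx'
    simp only [Prod.mk.injEq] at h ⊢
    obtain ⟨rfl, rfl⟩ := h
    obtain ⟨-, h0, rfl⟩ := hx
    obtain ⟨-, h0', rfl⟩ := hx'
    have : (d : ℤ) ^ 2 = (d' : ℤ) ^ 2 := by linarith
    have : d ^ 2 = d' ^ 2 := by exact_mod_cast this
    exact ⟨⟨rfl, rfl⟩, rfl, Nat.pow_left_injective (by norm_num : 2 ≠ 0) this⟩

/-- The cases a > c and a < c are exchanged by symmetry, each at most 8M² times the square of the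
logarithmic factor; the case a = c has at most M² solutions, hence 17. -/
theorem card_quadDiff_eq_zero_le {M : ℕ} (hM : 0 < M) :
    (#{x ∈ quadBox M | quadDiff x = 0} : ℝ) ≤
      17 * (M : ℝ) ^ 2 * (1 + Real.log (2 * M : ℕ)) ^ 2 := by
  have h1 := card_quadDiff_eq_zero_of_lt_le M
  have h2 := card_filter_quadBox_swap_le M (P := fun x => quadDiff x = 0 ∧ x.1.1 < x.2.1)
    (R := fun x => quadDiff x = 0 ∧ x.2.1 < x.1.1) (by
      rintro ⟨⟨a, b⟩, c, d⟩ ⟨h, h'⟩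
      refine ⟨?_, h'⟩
      simp only [quadDiff] at h ⊢
      linarith)
  have h3 := card_quadDiff_eq_zero_diag_le M
  have hsplit : #{x ∈ quadBox M | quadDiff x = 0} ≤
      #{x ∈ quadBox M | quadDiff x = 0 ∧ x.2.1 < x.1.1} +
      #{x ∈ quadBox M | quadDiff x = 0 ∧ x.1.1 < x.2.1} +
      #{x ∈ quadBox M | quadDiff x = 0 ∧ x.1.1 = x.2.1} := by
    refine le_trans (card_le_card ?_) ((card_union_le _ _).trans
      (Nat.add_le_add_right (card_union_le _ _) _))
    intro x hx
    simp only [mem_union, mem_filter] at hx ⊢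
    rcases lt_trichotomy x.1.1 x.2.1 with h | h | h <;> tauto
  have h4 : ((∑ u ∈ Ioc 0 (2 * M), ∑ w ∈ Ioc 0 (2 * M),
      #{v ∈ Ioc 0 (2 * M) | ((w : ℕ) : ℤ) ∣ (u : ℤ) * (v : ℕ) + 0} : ℕ) : ℝ) ≤
      8 * (M : ℝ) ^ 2 * (1 + Real.log (2 * M : ℕ)) ^ 2 := by
    have hl : 0 ≤ Real.log (2 * M : ℕ) := Real.log_natCast_nonneg _
    rw [Nat.cast_sum]
    calc _ ≤ ∑ u ∈ Ioc 0 (2 * M), ∑ w ∈ Ioc 0 (2 * M),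
          ((2 * M : ℕ) * ((u.gcd w : ℝ) / w) + 1) := by
          refine sum_le_sum fun u _ => ?_
          rw [Nat.cast_sum]
          refine sum_le_sum fun w hw => ?_
          exact card_filter_dvd_mul_add_le _ u (mem_Ioc.1 hw).1 0
      _ = (2 * M : ℕ) * ∑ u ∈ Ioc 0 (2 * M), ∑ w ∈ Ioc 0 (2 * M), (u.gcd w : ℝ) / w +
          (2 * M : ℕ) ^ 2 := by
          simp only [sum_add_distrib, ← mul_sum]
          simp
          ring
      _ ≤ (2 * M : ℕ) * ((2 * M : ℕ) * (1 + Real.log (2 * M : ℕ)) * (1 + Real.log (2 * M : ℕ))) +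
          (2 * M : ℕ) ^ 2 := by
          gcongr
          exact sum_gcd_div_le _ _
      _ ≤ _ := by
          have h5 : 1 ≤ (1 + Real.log (2 * M : ℕ)) ^ 2 := one_le_pow₀ (by linarith)
          have h6 : 0 ≤ (M : ℝ) ^ 2 := by positivity
          push_cast at h5 ⊢
          nlinarith
  have h5 : (1 : ℝ) ≤ (1 + Real.log (2 * M : ℕ)) ^ 2 :=
    one_le_pow₀ (by linarith [Real.log_natCast_nonneg (2 * M)])
  have h6 : 0 ≤ (M : ℝ) ^ 2 := by positivity
  have h7 : (#{x ∈ quadBox M | quadDiff x = 0} : ℝ) ≤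
      2 * ((∑ u ∈ Ioc 0 (2 * M), ∑ w ∈ Ioc 0 (2 * M),
      #{v ∈ Ioc 0 (2 * M) | ((w : ℕ) : ℤ) ∣ (u : ℤ) * (v : ℕ) + 0} : ℕ) : ℝ) + (M : ℝ) ^ 2 := by
    have : #{x ∈ quadBox M | quadDiff x = 0} ≤ 2 * (∑ u ∈ Ioc 0 (2 * M), ∑ w ∈ Ioc 0 (2 * M),
      #{v ∈ Ioc 0 (2 * M) | ((w : ℕ) : ℤ) ∣ (u : ℤ) * (v : ℕ) + 0}) + M ^ 2 := by omega
    exact_mod_cast this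
  nlinarith

/-- With b and d fixed and u = a - c, the sum v = a + c solves a linear congruence modulo q. -/
theorem card_dvd_quadDiff_of_lt_le (M : ℕ) {q : ℕ} (hq : 0 < q) :
    (#{x ∈ quadBox M | (q : ℤ) ∣ quadDiff x ∧ x.2.1 < x.1.1} : ℝ) ≤
      (M : ℝ) ^ 2 * ∑ u ∈ Ioc 0 M, ((2 * M : ℕ) * ((u.gcd q : ℝ) / q) + 1) := by
  have h1 : #{x ∈ quadBox M | (q : ℤ) ∣ quadDiff x ∧ x.2.1 < x.1.1} ≤
      ∑ p ∈ Ioc 0 M ×ˢ Ioc 0 M, ∑ u ∈ Ioc 0 M,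
        #{v ∈ Ioc 0 (2 * M) | (q : ℤ) ∣ (u : ℤ) * (v : ℕ) + ((p.1 : ℤ) ^ 2 - (p.2 : ℤ) ^ 2)} := by
    simp only [card_filter]
    rw [← sum_product' (f := fun (p : ℕ × ℕ) (u : ℕ) => ∑ v ∈ Ioc 0 (2 * M),
      if (q : ℤ) ∣ (u : ℤ) * (v : ℕ) + ((p.1 : ℤ) ^ 2 - (p.2 : ℤ) ^ 2) then 1 else 0),
      ← sum_product' (f := fun (y : (ℕ × ℕ) × ℕ) (v : ℕ) =>
        if (q : ℤ) ∣ (y.2 : ℤ) * (v : ℕ) + ((y.1.1 : ℤ) ^ 2 - (y.1.2 : ℤ) ^ 2) then 1 else 0),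
      ← card_filter, ← card_filter]
    refine card_le_card_of_injOn
      (fun x => (((x.1.2, x.2.2), x.1.1 - x.2.1), x.1.1 + x.2.1)) ?_ ?_
    · rintro ⟨⟨a, b⟩, c, d⟩ hx
      simp only [coe_filter, mem_quadBox, Set.mem_ofPred_eq] at hx
      simp only [quadDiff] at hx
      obtain ⟨⟨⟨⟨ha0, ha⟩, hb0, hb⟩, ⟨hc0, hc⟩, hd0, hd⟩, h0, hlt⟩ := hx
      simp only [coe_filter, mem_product, mem_Ioc, Set.mem_ofPred_eq]
      refine ⟨⟨⟨⟨⟨hb0, hb⟩, hd0, hd⟩, by omega, by omega⟩, by omega, by omega⟩, ?_⟩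
      rw [Nat.cast_sub hlt.le]
      push_cast
      have e : ((a : ℤ) - c) * (a + c) + ((b : ℤ) ^ 2 - (d : ℤ) ^ 2) =
        ((a : ℤ) ^ 2 + (b : ℤ) ^ 2) - ((c : ℤ) ^ 2 + (d : ℤ) ^ 2) := by ring
      rwa [e]
    · rintro ⟨⟨a, b⟩, c, d⟩ hx ⟨⟨a', b'⟩, c', d'⟩ hx' h
      simp only [coe_filter, mem_quadBox, Set.mem_ofPred_eq] at hx hx'
      simp only [quadDiff] at hx hx'
      simp only [Prod.mk.injEq] at h ⊢
      omega
  calc _ ≤ ((∑ p ∈ Ioc 0 M ×ˢ Ioc 0 M, ∑ u ∈ Ioc 0 M,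
        #{v ∈ Ioc 0 (2 * M) | (q : ℤ) ∣ (u : ℤ) * (v : ℕ) + ((p.1 : ℤ) ^ 2 - (p.2 : ℤ) ^ 2)} : ℕ) :
          ℝ) := by exact_mod_cast h1
    _ ≤ ∑ p ∈ Ioc 0 M ×ˢ Ioc 0 M, ∑ u ∈ Ioc 0 M, ((2 * M : ℕ) * ((u.gcd q : ℝ) / q) + 1) := by
        rw [Nat.cast_sum]
        refine sum_le_sum fun p _ => ?_
        rw [Nat.cast_sum]
        refine sum_le_sum fun u _ => ?_
        exact card_filter_dvd_mul_add_le _ u hq _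
    _ = _ := by
        rw [sum_const, nsmul_eq_mul]
        simp [sq]

/-- A nonzero difference needs a ≠ c or b ≠ d, giving four cases equivalent under symmetry to a > c.
-/
theorem card_dvd_quadDiff_ne_zero_le (M : ℕ) {q : ℕ} (hq : 0 < q) :
    (#{x ∈ quadBox M | (q : ℤ) ∣ quadDiff x ∧ quadDiff x ≠ 0} : ℝ) ≤
      4 * ((M : ℝ) ^ 2 * ∑ u ∈ Ioc 0 M, ((2 * M : ℕ) * ((u.gcd q : ℝ) / q) + 1)) := by
  have h1 := card_dvd_quadDiff_of_lt_le M hq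
  have hneg : ∀ x : (ℕ × ℕ) × (ℕ × ℕ), quadDiff (x.2, x.1) = -quadDiff x := by
    intro x; simp only [quadDiff]; ring
  have hflip : ∀ x : (ℕ × ℕ) × (ℕ × ℕ),
      quadDiff ((x.1.2, x.1.1), (x.2.2, x.2.1)) = quadDiff x := by
    intro x; simp only [quadDiff]; ring
  have h2 := card_filter_quadBox_swap_le M (P := fun x => (q : ℤ) ∣ quadDiff x ∧ x.1.1 < x.2.1)
    (R := fun x => (q : ℤ) ∣ quadDiff x ∧ x.2.1 < x.1.1) (by
      rintro x ⟨h, h'⟩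
      refine ⟨?_, h'⟩
      rw [hneg]
      exact (dvd_neg).2 h)
  have h3 := card_filter_quadBox_flip_le M (P := fun x => (q : ℤ) ∣ quadDiff x ∧ x.2.2 < x.1.2)
    (R := fun x => (q : ℤ) ∣ quadDiff x ∧ x.2.1 < x.1.1) (by
      rintro x ⟨h, h'⟩
      refine ⟨?_, h'⟩
      rwa [hflip])
  have h4 := card_filter_quadBox_flip_le M (P := fun x => (q : ℤ) ∣ quadDiff x ∧ x.1.2 < x.2.2)
    (R := fun x => (q : ℤ) ∣ quadDiff x ∧ x.1.1 < x.2.1) (by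
      rintro x ⟨h, h'⟩
      refine ⟨?_, h'⟩
      rwa [hflip])
  have hsplit : #{x ∈ quadBox M | (q : ℤ) ∣ quadDiff x ∧ quadDiff x ≠ 0} ≤
      #{x ∈ quadBox M | (q : ℤ) ∣ quadDiff x ∧ x.2.1 < x.1.1} +
      #{x ∈ quadBox M | (q : ℤ) ∣ quadDiff x ∧ x.1.1 < x.2.1} +
      #{x ∈ quadBox M | (q : ℤ) ∣ quadDiff x ∧ x.2.2 < x.1.2} +
      #{x ∈ quadBox M | (q : ℤ) ∣ quadDiff x ∧ x.1.2 < x.2.2} := by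
    refine le_trans (card_le_card ?_) ((card_union_le _ _).trans (Nat.add_le_add_right
      ((card_union_le _ _).trans (Nat.add_le_add_right (card_union_le _ _) _)) _))
    rintro ⟨⟨a, b⟩, c, d⟩ hx
    simp only [mem_union, mem_filter] at hx ⊢
    rcases lt_trichotomy a c with h | h | h
    · tauto
    · rcases lt_trichotomy b d with h' | h' | h'
      · tauto
      · exfalso
        apply hx.2.2
        simp only [quadDiff]
        rw [h, h']
        ring
      · tauto
    · tauto
  have h5 : #{x ∈ quadBox M | (q : ℤ) ∣ quadDiff x ∧ quadDiff x ≠ 0} ≤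
      4 * #{x ∈ quadBox M | (q : ℤ) ∣ quadDiff x ∧ x.2.1 < x.1.1} := by omega
  have h6 : (#{x ∈ quadBox M | (q : ℤ) ∣ quadDiff x ∧ quadDiff x ≠ 0} : ℝ) ≤
      4 * (#{x ∈ quadBox M | (q : ℤ) ∣ quadDiff x ∧ x.2.1 < x.1.1} : ℝ) := by exact_mod_cast h5
  linarith

theorem card_dvd_quadDiff_eq_zero_of_lt {M q : ℕ} (hq : 2 * M ^ 2 < q) :
    #{x ∈ quadBox M | (q : ℤ) ∣ quadDiff x ∧ quadDiff x ≠ 0} = 0 := by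
  rw [card_eq_zero, filter_eq_empty_iff]
  rintro ⟨⟨a, b⟩, c, d⟩ hx ⟨h1, h2⟩
  simp only [mem_quadBox] at hx
  obtain ⟨⟨⟨-, ha⟩, -, hb⟩, ⟨-, hc⟩, -, hd⟩ := hx
  refine h2 (Int.eq_zero_of_abs_lt_dvd h1 ?_)
  simp only [quadDiff]
  have e1 : a ^ 2 ≤ M ^ 2 := Nat.pow_le_pow_left ha 2
  have e2 : b ^ 2 ≤ M ^ 2 := Nat.pow_le_pow_left hb 2
  have e3 : c ^ 2 ≤ M ^ 2 := Nat.pow_le_pow_left hc 2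
  have e4 : d ^ 2 ≤ M ^ 2 := Nat.pow_le_pow_left hd 2
  zify at e1 e2 e3 e4 hq
  rw [abs_lt]
  constructor <;> nlinarith [sq_nonneg (a : ℤ), sq_nonneg (b : ℤ), sq_nonneg (c : ℤ),
    sq_nonneg (d : ℤ)]

theorem quadCount_le_add (M q : ℕ) : quadCount M q ≤
    #{x ∈ quadBox M | quadDiff x = 0} +
      #{x ∈ quadBox M | (q : ℤ) ∣ quadDiff x ∧ quadDiff x ≠ 0} := by
  refine le_trans (card_le_card ?_) (card_union_le _ _)
  intro x hx
  simp only [mem_union, mem_filter] at hx ⊢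
  change x ∈ quadBox M ∧ (q : ℤ) ∣ quadDiff x at hx
  tauto

/-- The weighted sum of the numbers of solutions of `a² + b² ≡ c² + d²` to moduli beyond `Q`. -/
theorem sum_quadCount_div_le {M Q N : ℕ} (hM : 0 < M) (hQ : 0 < Q) :
    ∑ q ∈ Ioc Q N, (quadCount M q : ℝ) / q ≤
      17 * (M : ℝ) ^ 2 * (1 + Real.log (2 * M ^ 2 : ℕ)) ^ 2 * (1 + Real.log N) +
      8 * (M : ℝ) ^ 4 * (1 + Real.log (2 * M ^ 2 : ℕ)) ^ 2 / Q +
      4 * (M : ℝ) ^ 3 * (1 + Real.log (2 * M ^ 2 : ℕ)) := by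
  set l := 1 + Real.log (2 * M ^ 2 : ℕ) with hl
  have hQ0 : (0 : ℝ) < Q := by exact_mod_cast hQ
  have hMM : M ≤ M ^ 2 := Nat.le_self_pow (by norm_num) M
  have hl1 : 1 + Real.log (2 * M : ℕ) ≤ l := by
    have : Real.log (2 * M : ℕ) ≤ Real.log (2 * M ^ 2 : ℕ) := by
      apply Real.log_le_log
      · exact_mod_cast (by omega : 0 < 2 * M)
      · exact_mod_cast (by omega : 2 * M ≤ 2 * M ^ 2)
    linarith
  have hl2 : 1 + Real.log M ≤ l := by
    have : Real.log (M : ℕ) ≤ Real.log (2 * M ^ 2 : ℕ) := by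
      apply Real.log_le_log
      · exact_mod_cast hM
      · exact_mod_cast (by omega : M ≤ 2 * M ^ 2)
    linarith
  have hlM : 0 ≤ Real.log M := Real.log_natCast_nonneg _
  have hl2M : 0 ≤ Real.log (2 * M : ℕ) := Real.log_natCast_nonneg _
  have hlN : 0 ≤ Real.log N := Real.log_natCast_nonneg _
  have hl0 : 0 ≤ l := by linarith
  have hpart1 : ∑ q ∈ Ioc Q N, (#{x ∈ quadBox M | quadDiff x = 0} : ℝ) / q ≤
      17 * (M : ℝ) ^ 2 * l ^ 2 * (1 + Real.log N) := by
    have h1 : ∑ q ∈ Ioc Q N, (1 : ℝ) / q ≤ 1 + Real.log N := by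
      refine le_trans (sum_le_sum_of_subset_of_nonneg ?_ fun _ _ _ => by positivity)
        (sum_Ioc_one_div_le N)
      exact Ioc_subset_Ioc_left (Nat.zero_le _)
    have h2 : (#{x ∈ quadBox M | quadDiff x = 0} : ℝ) ≤ 17 * (M : ℝ) ^ 2 * l ^ 2 := by
      refine (card_quadDiff_eq_zero_le hM).trans ?_
      gcongr
    calc _ = (#{x ∈ quadBox M | quadDiff x = 0} : ℝ) * ∑ q ∈ Ioc Q N, (1 : ℝ) / q := by
          rw [mul_sum]
          exact sum_congr rfl fun q _ => by ring
      _ ≤ _ := by gcongr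
  have hpart2 : ∑ q ∈ Ioc Q N,
      (#{x ∈ quadBox M | (q : ℤ) ∣ quadDiff x ∧ quadDiff x ≠ 0} : ℝ) / q ≤
      8 * (M : ℝ) ^ 4 * l ^ 2 / Q + 4 * (M : ℝ) ^ 3 * l := by
    have h1 : ∑ q ∈ Ioc Q N,
        (#{x ∈ quadBox M | (q : ℤ) ∣ quadDiff x ∧ quadDiff x ≠ 0} : ℝ) / q ≤
        ∑ q ∈ Ioc Q (2 * M ^ 2),
          (#{x ∈ quadBox M | (q : ℤ) ∣ quadDiff x ∧ quadDiff x ≠ 0} : ℝ) / q := by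
      have h2 : ∀ q ∈ Ioc Q N,
          (#{x ∈ quadBox M | (q : ℤ) ∣ quadDiff x ∧ quadDiff x ≠ 0} : ℝ) / q =
          if q ≤ 2 * M ^ 2 then
            (#{x ∈ quadBox M | (q : ℤ) ∣ quadDiff x ∧ quadDiff x ≠ 0} : ℝ) / q else 0 := by
        intro q _
        split_ifs with h
        · rfl
        · rw [card_dvd_quadDiff_eq_zero_of_lt (not_le.1 h)]
          simp
      rw [sum_congr rfl h2, ← sum_filter]
      refine sum_le_sum_of_subset_of_nonneg ?_ fun _ _ _ => by positivity
      intro q hq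
      simp only [mem_filter, mem_Ioc] at hq ⊢
      exact ⟨hq.1.1, hq.2⟩
    refine h1.trans ?_
    have h3 : ∀ q ∈ Ioc Q (2 * M ^ 2),
        (#{x ∈ quadBox M | (q : ℤ) ∣ quadDiff x ∧ quadDiff x ≠ 0} : ℝ) / q ≤
        8 * (M : ℝ) ^ 3 / Q * ∑ u ∈ Ioc 0 M, (u.gcd q : ℝ) / q + 4 * (M : ℝ) ^ 3 * (1 / q) := by
      intro q hq
      rw [mem_Ioc] at hq
      have hq0 : 0 < q := by omega
      have hqr : (0 : ℝ) < q := by exact_mod_cast hq0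
      have hQq : (Q : ℝ) ≤ q := by exact_mod_cast hq.1.le
      have h4 := card_dvd_quadDiff_ne_zero_le M hq0
      rw [sum_add_distrib, ← mul_sum] at h4
      set G := ∑ u ∈ Ioc 0 M, (u.gcd q : ℝ) / q with hG
      have hG0 : 0 ≤ G := sum_nonneg fun _ _ => by positivity
      -- Only one factor 1/q is traded for 1/Q; the one inside G is kept for the average of gcd(u,
      -- q)/q.
      have h5 : (M : ℝ) ^ 3 * G / q ≤ (M : ℝ) ^ 3 * G / Q := by gcongr
      calc _ ≤ 4 * ((M : ℝ) ^ 2 * ((2 * M : ℕ) * G + ∑ u ∈ Ioc 0 M, (1 : ℝ))) / q := by gcongr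
        _ = 8 * ((M : ℝ) ^ 3 * G / q) + 4 * (M : ℝ) ^ 3 * (1 / q) := by
          simp
          ring
        _ ≤ 8 * ((M : ℝ) ^ 3 * G / Q) + 4 * (M : ℝ) ^ 3 * (1 / q) := by linarith
        _ = _ := by ring
    refine (sum_le_sum h3).trans ?_
    rw [sum_add_distrib, ← mul_sum, ← mul_sum]
    have hsub : Ioc Q (2 * M ^ 2) ⊆ Ioc 0 (2 * M ^ 2) := Ioc_subset_Ioc_left (Nat.zero_le _)
    have h6 : ∑ q ∈ Ioc Q (2 * M ^ 2), ∑ u ∈ Ioc 0 M, (u.gcd q : ℝ) / q ≤ M * l * l := by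
      calc _ ≤ ∑ q ∈ Ioc 0 (2 * M ^ 2), ∑ u ∈ Ioc 0 M, (u.gcd q : ℝ) / q :=
            sum_le_sum_of_subset_of_nonneg hsub fun _ _ _ =>
              sum_nonneg fun _ _ => by positivity
        _ ≤ M * (1 + Real.log M) * l := by
            rw [sum_comm]
            exact sum_gcd_div_le _ _
        _ ≤ _ := by gcongr
    have h7 : ∑ q ∈ Ioc Q (2 * M ^ 2), 1 / (q : ℝ) ≤ l :=
      (sum_le_sum_of_subset_of_nonneg hsub fun _ _ _ => by positivity).trans
        (sum_Ioc_one_div_le _)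
    calc _ ≤ 8 * (M : ℝ) ^ 3 / Q * (M * l * l) + 4 * (M : ℝ) ^ 3 * l := by gcongr
      _ = _ := by ring
  calc _ ≤ ∑ q ∈ Ioc Q N, ((#{x ∈ quadBox M | quadDiff x = 0} : ℝ) / q +
        (#{x ∈ quadBox M | (q : ℤ) ∣ quadDiff x ∧ quadDiff x ≠ 0} : ℝ) / q) := by
        refine sum_le_sum fun q _ => ?_
        rw [← add_div]
        gcongr
        exact_mod_cast quadCount_le_add M q
    _ ≤ _ := by
        rw [sum_add_distrib]
        linarith

end

/-! ### The model at an unrepresented integer -/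

section

open Finset MeasureTheory

/-- The coefficients of the error term at an integer that is not represented. -/
theorem integral_error_mul_circExp_eq {η : ℝ} (hη : 0 < η) (Q : ℕ) {M n : ℕ}
    (hn : 2 * M ^ 2 ≤ n) (h : ∀ a ∈ Ioc 0 M, ∀ b ∈ Ioc 0 M, ∀ x y : ℤ,
      x ^ 2 + y ^ 2 ≠ (n : ℤ) - (a : ℤ) ^ 2 - (b : ℤ) ^ 2) :
    ∫ α in (0 : ℝ)..1, ((thetaSum η α ^ 2 - modelSum η Q α) * smallSum η M α ^ 2) *
        circExp (α * (-(n : ℤ) : ℤ)) =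
      -(Real.pi * (Real.exp (-(Real.pi * η * n)) : ℂ) *
        ∑ p ∈ Ioc 0 M ×ˢ Ioc 0 M, modelCoeff Q (n - p.1 ^ 2 - p.2 ^ 2)) := by
  have hθ := continuous_thetaSum hη
  have hm := continuous_modelSum hη Q
  have he : ∀ k : ℤ, Continuous fun α : ℝ => circExp (α * k) := fun k =>
    continuous_circExp.comp (continuous_id.mul continuous_const)
  simp only [smallSum_sq, mul_sum, sum_mul]
  rw [intervalIntegral.integral_finsetSum, ← sum_neg_distrib]
  · refine sum_congr rfl fun p hp => ?_
    rw [mem_product] at hp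
    have h1 := mem_Ioc.1 hp.1
    have h2 := mem_Ioc.1 hp.2
    have h3 : p.1 ^ 2 ≤ M ^ 2 := Nat.pow_le_pow_left h1.2 2
    have h4 : p.2 ^ 2 ≤ M ^ 2 := Nat.pow_le_pow_left h2.2 2
    set k := n - p.1 ^ 2 - p.2 ^ 2 with hk
    have hkn : n = k + p.1 ^ 2 + p.2 ^ 2 := by omega
    have hkZ : (k : ℤ) = (n : ℤ) - (p.1 : ℤ) ^ 2 - (p.2 : ℤ) ^ 2 := by
      have : (n : ℤ) = k + p.1 ^ 2 + p.2 ^ 2 := by exact_mod_cast hkn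
      linarith
    have hkR : (n : ℝ) = k + (p.1 : ℝ) ^ 2 + (p.2 : ℝ) ^ 2 := by exact_mod_cast hkn
    set w : ℂ := ((Real.exp (-(Real.pi * η * ((p.1 : ℝ) ^ 2 + (p.2 : ℝ) ^ 2))) : ℝ) : ℂ) with hw
    have hint : ∀ α : ℝ, (thetaSum η α ^ 2 - modelSum η Q α) *
        (w * circExp (α * ((p.1 : ℤ) ^ 2 + (p.2 : ℤ) ^ 2 : ℤ))) * circExp (α * (-(n : ℤ) : ℤ)) =
        w * (thetaSum η α ^ 2 * circExp (α * (-(k : ℤ) : ℤ)) -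
          modelSum η Q α * circExp (α * (-(k : ℤ) : ℤ))) := by
      intro α
      have e : circExp (α * (-(k : ℤ) : ℤ)) =
          circExp (α * ((p.1 : ℤ) ^ 2 + (p.2 : ℤ) ^ 2 : ℤ)) * circExp (α * (-(n : ℤ) : ℤ)) := by
        rw [← circExp_add, hkZ]
        congr 1
        push_cast
        ring
      rw [e]
      ring
    simp only [hint]
    rw [intervalIntegral.integral_const_mul, intervalIntegral.integral_sub,
      integral_thetaSum_sq_eq_zero hη (by rw [hkZ]; exact h p.1 hp.1 p.2 hp.2),
      integral_modelSum hη Q k, hw, hkR]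
    -- The Gaussian weights are multiplicative along n = k + a² + b², so every pair (a, b) carries
    -- the same weight exp(-πηn).
    · have : Real.exp (-(Real.pi * η * (k + (p.1 : ℝ) ^ 2 + (p.2 : ℝ) ^ 2))) =
          Real.exp (-(Real.pi * η * ((p.1 : ℝ) ^ 2 + (p.2 : ℝ) ^ 2))) *
            Real.exp (-(Real.pi * η * k)) := by
        rw [← Real.exp_add]
        congr 1
        ring
      rw [this]
      push_cast
      ring
    · exact ((hθ.pow 2).mul (he _)).intervalIntegrable _ _
    · exact (hm.mul (he _)).intervalIntegrable _ _
  · intro p _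
    refine Continuous.intervalIntegrable ?_ _ _
    exact (((hθ.pow 2).sub hm).mul (continuous_const.mul (he _))).mul (he _)

/-- A quadratic exponential sum at a fraction. -/
noncomputable def weylSum (M q u : ℕ) : ℂ := ∑ a ∈ Ioc 0 M, circExp (u / q * (a : ℝ) ^ 2)

/-- Complete periods give Gauss sums exactly; fewer than q terms are left over, and replacing ⌊M/q⌋
by M/q costs at most q more. -/
theorem norm_weylSum_sub_le (M : ℕ) {q : ℕ} (hq : 0 < q) (u : ℕ) :
    ‖weylSum M q u - M / q * quadGauss q u 0‖ ≤ 2 * q := by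
  have hqr : (0 : ℝ) < q := by exact_mod_cast hq
  set g : ℕ → ℂ := fun a => circExp (((u : ℤ) : ℝ) * (a : ℝ) ^ 2 / q) with hg
  have hper : ∀ y, g (y + q) = g y := fun y => circExp_sq_div_periodic hq u y
  set c := M / q with hc
  set r := M % q with hr
  have hM : M = c * q + r := by rw [mul_comm]; exact (Nat.div_add_mod M q).symm
  have hrq : r < q := Nat.mod_lt _ hq
  have h1 : weylSum M q u = ∑ a ∈ range M, g (a + 1) := by
    have h0 : ∀ m : ℕ, ∑ a ∈ Ioc 0 m, g a = ∑ a ∈ range m, g (a + 1) := by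
      intro m
      induction m with
      | zero => simp
      | succ m ih => rw [sum_Ioc_succ_top (Nat.zero_le m), sum_range_succ, ih]
    rw [← h0, weylSum]
    refine sum_congr rfl fun a _ => ?_
    simp only [hg]
    congr 1
    push_cast
    ring
  have h2 : ∑ a ∈ range M, g (a + 1) =
      c * quadGauss q u 0 + ∑ i ∈ range r, g (c * q + i + 1) := by
    rw [hM, sum_range_add, sum_range_mul_of_periodic (g := fun a => g (a + 1))
      (fun y => by rw [add_right_comm, hper]), sum_range_shift_of_periodic hper,
      quadGauss_zero_right]
  have h3 : ‖∑ i ∈ range r, g (c * q + i + 1)‖ ≤ q := by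
    refine (norm_sum_le _ _).trans ?_
    simp only [hg, norm_circExp, sum_const, card_range, nsmul_eq_mul, mul_one]
    exact_mod_cast hrq.le
  have h4 : ‖quadGauss q u 0‖ ≤ q := by
    rw [quadGauss_zero_right]
    refine (norm_sum_le _ _).trans ?_
    simp [norm_circExp]
  have h5 : weylSum M q u - M / q * quadGauss q u 0 =
      ∑ i ∈ range r, g (c * q + i + 1) - (r / q : ℝ) * quadGauss q u 0 := by
    rw [h1, h2]
    have : (M : ℂ) = c * q + r := by exact_mod_cast hM
    have hq0 : (q : ℂ) ≠ 0 := by exact_mod_cast hq.ne'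
    rw [this]
    push_cast
    field_simp
    ring
  have h6 : ‖((r / q : ℝ) : ℂ) * quadGauss q u 0‖ ≤ q := by
    rw [norm_mul, Complex.norm_real, Real.norm_of_nonneg (by positivity)]
    have : (r / q : ℝ) ≤ 1 := by
      rw [div_le_one hqr]
      exact_mod_cast hrq.le
    calc _ ≤ 1 * (q : ℝ) := by gcongr
      _ = q := one_mul _
  rw [h5]
  calc _ ≤ _ := norm_sub_le _ _
    _ ≤ _ := by linarith

/-- At a fixed fraction u/q the phase of n - a² - b² separates, and the sum over (a, b) is the
square of a Weyl sum. -/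
theorem sum_modelCoeff_eq (Q : ℕ) {M n : ℕ} (hn : 2 * M ^ 2 ≤ n) :
    ∑ p ∈ Ioc 0 M ×ˢ Ioc 0 M, modelCoeff Q (n - p.1 ^ 2 - p.2 ^ 2) =
      ∑ x ∈ (Ioc 0 Q).sigma fun q => {u ∈ range q | u.Coprime q},
        quadGauss x.1 x.2 0 ^ 2 / (x.1 : ℂ) ^ 2 * circExp (-((n * x.2 : ℕ) : ℝ) / x.1) *
          weylSum M x.1 x.2 ^ 2 := by
  simp only [modelCoeff]
  rw [sum_comm]
  refine sum_congr rfl fun x _ => ?_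
  rw [sq (weylSum M x.1 x.2), weylSum, sum_mul_sum, ← sum_product', mul_sum]
  refine sum_congr rfl fun p hp => ?_
  rw [mem_product, mem_Ioc, mem_Ioc] at hp
  have h3 : p.1 ^ 2 ≤ M ^ 2 := Nat.pow_le_pow_left hp.1.2 2
  have h4 : p.2 ^ 2 ≤ M ^ 2 := Nat.pow_le_pow_left hp.2.2 2
  have hk : ((n - p.1 ^ 2 - p.2 ^ 2 : ℕ) : ℝ) = n - (p.1 : ℝ) ^ 2 - (p.2 : ℝ) ^ 2 := by
    rw [Nat.cast_sub (by omega), Nat.cast_sub (by omega)]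
    push_cast
    ring
  rw [hk, mul_assoc, ← circExp_add, ← circExp_add]
  congr 2
  push_cast
  ring

/-- Since the fourth power of the Gauss sum is free of the numerator, the sum over numerators is a
Ramanujan sum. -/
theorem sum_gauss_pow_four_eq (Q n : ℕ) :
    ∑ x ∈ (Ioc 0 Q).sigma fun q => {u ∈ range q | u.Coprime q},
        quadGauss x.1 x.2 0 ^ 4 / (x.1 : ℂ) ^ 4 * circExp (-((n * x.2 : ℕ) : ℝ) / x.1) =
      truncSingularSeries n Q := by
  rw [sum_sigma, truncSingularSeries]
  push_cast
  refine sum_congr rfl fun q hq => ?_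
  have hq0 := (mem_Ioc.1 hq).1
  have hqc : (q : ℂ) ≠ 0 := by exact_mod_cast hq0.ne'
  have h := ramanujanSum_eq hq0 n
  have e : ∑ x ∈ q.divisorsAntidiagonal,
      (((if x.1 ∣ n then (x.1 : ℝ) * (ArithmeticFunction.moebius x.2 : ℝ) else 0 : ℝ)) : ℂ) =
      ramanujanSum q n := by
    rw [h]
    refine sum_congr rfl fun x _ => ?_
    split_ifs <;> push_cast <;> rfl
  rw [e, ramanujanSum, mul_sum]
  refine sum_congr rfl fun u hu => ?_
  rw [quadGauss_pow_four hq0 (Nat.isCoprime_iff_coprime.2 (mem_filter.1 hu).2)]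
  rw [Nat.cast_mul]
  congr 1
  field_simp

/-- Each of the at most Q² fractions contributes an error (2/q)·(2q)·(6M) = 24M, from the difference
of the squares of the Weyl sum and its main term. -/
theorem norm_sum_modelCoeff_sub_le {Q M n : ℕ} (hn : 2 * M ^ 2 ≤ n) (hQM : Q ≤ M) :
    ‖∑ p ∈ Ioc 0 M ×ˢ Ioc 0 M, modelCoeff Q (n - p.1 ^ 2 - p.2 ^ 2) -
      (M : ℂ) ^ 2 * truncSingularSeries n Q‖ ≤ 24 * M * (Q : ℝ) ^ 2 := by
  rw [sum_modelCoeff_eq Q hn, ← sum_gauss_pow_four_eq, mul_sum, ← sum_sub_distrib]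
  refine (norm_sum_le _ _).trans ?_
  have hterm : ∀ x ∈ (Ioc 0 Q).sigma fun q => {u ∈ range q | u.Coprime q},
      ‖quadGauss x.1 x.2 0 ^ 2 / (x.1 : ℂ) ^ 2 * circExp (-((n * x.2 : ℕ) : ℝ) / x.1) *
          weylSum M x.1 x.2 ^ 2 - (M : ℂ) ^ 2 * (quadGauss x.1 x.2 0 ^ 4 / (x.1 : ℂ) ^ 4 *
            circExp (-((n * x.2 : ℕ) : ℝ) / x.1))‖ ≤ 24 * M := by
    rintro ⟨q, u⟩ hx
    simp only [mem_sigma, mem_filter, mem_Ioc] at hx ⊢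
    obtain ⟨⟨hq0, hqQ⟩, -, hu⟩ := hx
    have hcop : IsCoprime (u : ℤ) (q : ℤ) := Nat.isCoprime_iff_coprime.2 hu
    have hqr : (1 : ℝ) ≤ q := by exact_mod_cast hq0
    have hqM : (q : ℝ) ≤ M := by exact_mod_cast hqQ.trans hQM
    have hqc : (q : ℂ) ≠ 0 := by exact_mod_cast hq0.ne'
    set G := weylSum M q u with hG
    set T : ℂ := M / q * quadGauss q u 0 with hT
    have h1 : ‖G - T‖ ≤ 2 * q := norm_weylSum_sub_le M hq0 u
    have h2 := norm_quadGauss_sq_div_le hq0 hcop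
    have h3 : ‖T‖ ≤ 2 * M := by
      have hS : ‖quadGauss q u 0‖ ≤ 2 * q := by
        have := norm_quadGauss_sq_le hq0 hcop 0
        refine abs_le_of_sq_le_sq' (by nlinarith) (by positivity) |>.2
      rw [hT, norm_mul, norm_div, Complex.norm_natCast, Complex.norm_natCast]
      calc _ ≤ (M / q : ℝ) * (2 * q) := by gcongr
        _ = _ := by field_simp
    have h4 : ‖G + T‖ ≤ 6 * M := by
      have : G + T = (G - T) + (T + T) := by ring
      rw [this]
      calc _ ≤ ‖G - T‖ + (‖T‖ + ‖T‖) := (norm_add_le _ _).trans (by gcongr; exact norm_add_le _ _)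
        _ ≤ _ := by linarith
    have e : quadGauss q u 0 ^ 2 / (q : ℂ) ^ 2 * circExp (-((n * u : ℕ) : ℝ) / q) * G ^ 2 -
        (M : ℂ) ^ 2 * (quadGauss q u 0 ^ 4 / (q : ℂ) ^ 4 * circExp (-((n * u : ℕ) : ℝ) / q)) =
        quadGauss q u 0 ^ 2 / (q : ℂ) ^ 2 * circExp (-((n * u : ℕ) : ℝ) / q) *
          ((G - T) * (G + T)) := by
      rw [hT]
      field_simp
      ring
    rw [e, norm_mul, norm_mul, norm_mul, norm_circExp, mul_one]
    calc _ ≤ (2 / q : ℝ) * (2 * q * (6 * M)) := by gcongr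
      _ = _ := by
        field_simp
        ring
  refine (sum_le_sum hterm).trans ?_
  rw [sum_const, nsmul_eq_mul]
  have : (#((Ioc 0 Q).sigma fun q => {u ∈ range q | u.Coprime q}) : ℝ) ≤ (Q : ℝ) ^ 2 := by
    exact_mod_cast card_reduced_fractions_le Q
  calc _ ≤ (Q : ℝ) ^ 2 * (24 * M) := by gcongr
    _ = _ := by ring

/-- As 384 = 16·24, the conditions 384 ≤ Q and Q³ ≤ M make the error 24MQ² at most M²/16, half of
the main term M²/8. -/
theorem le_norm_sum_modelCoeff {Q M n : ℕ} (hn : 2 * M ^ 2 ≤ n) (h8 : ¬ 8 ∣ n)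
    (hQ : 384 ≤ Q) (hQM : Q ^ 3 ≤ M) :
    (M : ℝ) ^ 2 / 16 ≤
      ‖∑ p ∈ Ioc 0 M ×ˢ Ioc 0 M, modelCoeff Q (n - p.1 ^ 2 - p.2 ^ 2)‖ := by
  have hQM' : Q ≤ M := (Nat.le_self_pow (by norm_num) Q).trans hQM
  have h1 := norm_sum_modelCoeff_sub_le hn hQM'
  have h2 := le_truncSingularSeries h8 (by omega : 1 ≤ Q)
  set A := ∑ p ∈ Ioc 0 M ×ˢ Ioc 0 M, modelCoeff Q (n - p.1 ^ 2 - p.2 ^ 2) with hA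
  have h3 : ‖(M : ℂ) ^ 2 * truncSingularSeries n Q‖ = (M : ℝ) ^ 2 * truncSingularSeries n Q := by
    rw [norm_mul, norm_pow, Complex.norm_natCast, Complex.norm_real,
      Real.norm_of_nonneg (by linarith)]
  have h4 : ‖(M : ℂ) ^ 2 * truncSingularSeries n Q‖ ≤ ‖A‖ +
      ‖A - (M : ℂ) ^ 2 * truncSingularSeries n Q‖ := by
    rw [norm_sub_rev]
    refine le_trans (le_of_eq ?_) (norm_add_le _ _)
    congr 1
    ring
  have h5 : 384 * (Q : ℝ) ^ 2 ≤ M := by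
    have : 384 * Q ^ 2 ≤ M := by
      calc 384 * Q ^ 2 ≤ Q * Q ^ 2 := by gcongr
        _ = Q ^ 3 := by ring
        _ ≤ M := hQM
    exact_mod_cast this
  have h6 : (M : ℝ) ^ 2 * (1 / 8) ≤ (M : ℝ) ^ 2 * truncSingularSeries n Q := by gcongr
  have h7 : (M : ℝ) * (384 * (Q : ℝ) ^ 2) ≤ M * M := by gcongr
  rw [h3] at h4
  linarith

end

/-! ### The bound for the exceptional set in terms of M and Q -/

section

open Finset MeasureTheory

/-- The exceptional integers are either sums of three squares, two of them small, or have no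
representation as a sum of four squares of integers, two of them small and positive. -/
theorem card_exceptionalSet_le {X Y : ℝ} {M : ℕ} (hM : (M : ℝ) ≤ Y) :
    ∃ S : Finset ℕ, E₀ X Y ≤ #S + M ^ 2 * (⌊√X⌋₊ + 1) ∧
      ∀ n ∈ S, X / 2 < n ∧ (n : ℝ) ≤ X ∧ ¬ 8 ∣ n ∧
      ∀ a ∈ Ioc 0 M, ∀ b ∈ Ioc 0 M, ∀ x y : ℤ,
        x ^ 2 + y ^ 2 ≠ (n : ℤ) - (a : ℤ) ^ 2 - (b : ℤ) ^ 2 := by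
  classical
  set F := (exceptionalSet_finite X Y).toFinset with hF
  -- The theta series runs over all integers, so representations with x = 0 or y = 0 must be set
  -- aside; these n are few.
  set T := ((Ioc 0 M ×ˢ Ioc 0 M) ×ˢ range (⌊√X⌋₊ + 1)).image
    fun p => p.1.1 ^ 2 + p.1.2 ^ 2 + p.2 ^ 2 with hT
  refine ⟨F \ T, ?_, ?_⟩
  · have h1 : E₀ X Y = #F := Set.ncard_eq_toFinset_card _ _
    have h2 : #F ≤ #(F \ T) + #T := by
      have := card_le_card_sdiff_add_card (s := F) (t := T)
      omega
    have h3 : #T ≤ M ^ 2 * (⌊√X⌋₊ + 1) := by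
      refine card_image_le.trans (le_of_eq ?_)
      simp [sq]
    omega
  · intro n hn
    rw [mem_sdiff, hF, Set.Finite.mem_toFinset] at hn
    obtain ⟨⟨hn1, hn2, hn8, hn3⟩, hnT⟩ := hn
    refine ⟨hn1, hn2, hn8, ?_⟩
    intro a ha b hb x y hxy
    have ha' := mem_Ioc.1 ha
    have hb' := mem_Ioc.1 hb
    have key : n = x.natAbs ^ 2 + y.natAbs ^ 2 + a ^ 2 + b ^ 2 := by
      zify
      rw [sq_abs, sq_abs]
      linarith
    have hroot : ∀ z : ℕ, z ^ 2 ≤ n → z ∈ range (⌊√X⌋₊ + 1) := by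
      intro z hz
      rw [mem_range, Nat.lt_succ_iff]
      refine Nat.le_floor (Real.le_sqrt_of_sq_le ?_)
      exact le_trans (by exact_mod_cast hz) hn2
    rcases Nat.eq_zero_or_pos x.natAbs with hx | hx
    · refine hnT (mem_image.2 ⟨((a, b), y.natAbs), ?_, ?_⟩)
      · have := hroot y.natAbs (by omega)
        exact mem_product.2 ⟨mem_product.2 ⟨ha, hb⟩, this⟩
      · rw [hx] at key
        simp only
        omega
    rcases Nat.eq_zero_or_pos y.natAbs with hy | hy
    · refine hnT (mem_image.2 ⟨((a, b), x.natAbs), ?_, ?_⟩)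
      · have := hroot x.natAbs (by omega)
        exact mem_product.2 ⟨mem_product.2 ⟨ha, hb⟩, this⟩
      · rw [hy] at key
        simp only
        omega
    · refine hn3 ⟨x.natAbs, y.natAbs, a, b, hx, hy, ha'.1, hb'.1, key, le_trans ?_ hM⟩
      exact_mod_cast max_le ha'.2 hb'.2

/-- Comparison of the number of unrepresented integers with the mean square of the error. -/
theorem card_mul_le_integral_norm_sq {X : ℝ} (hX : 0 < X) {Q M : ℕ} (hQ : 384 ≤ Q) (hQM : Q ^ 3 ≤ M)
    (hMX : 4 * (M : ℝ) ^ 2 ≤ X) {S : Finset ℕ} (hS : ∀ n ∈ S, X / 2 < n ∧ (n : ℝ) ≤ X ∧ ¬ 8 ∣ n ∧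
      ∀ a ∈ Ioc 0 M, ∀ b ∈ Ioc 0 M, ∀ x y : ℤ,
        x ^ 2 + y ^ 2 ≠ (n : ℤ) - (a : ℤ) ^ 2 - (b : ℤ) ^ 2) :
    #S * (Real.pi * Real.exp (-Real.pi) * ((M : ℝ) ^ 2 / 16)) ^ 2 ≤
      ∫ α in (0 : ℝ)..1,
        ‖(thetaSum X⁻¹ α ^ 2 - modelSum X⁻¹ Q α) * smallSum X⁻¹ M α ^ 2‖ ^ 2 := by
  have hη : 0 < X⁻¹ := inv_pos.2 hX
  have hcont : Continuous fun α => (thetaSum X⁻¹ α ^ 2 - modelSum X⁻¹ Q α) * smallSum X⁻¹ M α ^ 2 :=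
    (((continuous_thetaSum hη).pow 2).sub (continuous_modelSum hη Q)).mul
      ((continuous_smallSum X⁻¹ M).pow 2)
  refine le_trans ?_ (sum_norm_sq_integral_mul_circExp_le hcont (S.image fun n : ℕ => (n : ℤ)))
  rw [sum_image fun _ _ _ _ h => by exact_mod_cast h, ← nsmul_eq_mul]
  refine card_nsmul_le_sum _ _ _ fun n hn => ?_
  obtain ⟨h1, h2, h8, h⟩ := hS n hn
  have hn2 : 2 * M ^ 2 ≤ n := by
    have : 2 * (M : ℝ) ^ 2 ≤ n := by linarith
    exact_mod_cast this
  rw [integral_error_mul_circExp_eq hη Q hn2 h, norm_neg, norm_mul, norm_mul, Complex.norm_real,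
    Complex.norm_real, Real.norm_of_nonneg Real.pi_pos.le, Real.norm_of_nonneg (Real.exp_pos _).le]
  -- With η = 1/X and n ≤ X the Gaussian weight is at least exp(-π).
  have h3 : -Real.pi ≤ -(Real.pi * X⁻¹ * n) := by
    have : X⁻¹ * n ≤ 1 := by
      rw [inv_mul_le_iff₀ hX]
      linarith
    have := mul_le_mul_of_nonneg_left this Real.pi_pos.le
    linarith
  have h4 := le_norm_sum_modelCoeff hn2 h8 hQ hQM
  have h5 := Real.pi_pos
  gcongr

/-- The mean square of the error, with explicit choice of the parameters. -/
theorem integral_norm_sq_error_le_of_pow_le {X : ℝ} {Q M : ℕ} (hQ : 384 ≤ Q)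
    (hQM : Q ^ 3 ≤ M) (hM5 : (M : ℝ) ^ 6 ≤ X ^ (1 / 4 : ℝ)) (hX : 1 ≤ X) :
    ∫ α in (0 : ℝ)..1,
        ‖(thetaSum X⁻¹ α ^ 2 - modelSum X⁻¹ Q α) * smallSum X⁻¹ M α ^ 2‖ ^ 2 ≤
      24 * 11 ^ 4 * Real.pi * X * (17 * (M : ℝ) ^ 2 * (1 + Real.log (2 * M ^ 2 : ℕ)) ^ 2 *
        (1 + Real.log X) + 8 * (M : ℝ) ^ 4 * (1 + Real.log (2 * M ^ 2 : ℕ)) ^ 2 / Q +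
        4 * (M : ℝ) ^ 3 * (1 + Real.log (2 * M ^ 2 : ℕ))) +
      10 ^ 6 * Real.pi * X * (M : ℝ) ^ 2 := by
  have hX0 : 0 < X := by linarith
  set s := X ^ (1 / 4 : ℝ) with hs
  have hs0 : 0 < s := Real.rpow_pos_of_pos hX0 _
  have hs4 : s ^ 4 = X := by
    rw [hs, ← Real.rpow_natCast, ← Real.rpow_mul hX0.le]
    norm_num
  have hsqrt : √X = s ^ 2 := by
    rw [← hs4, show s ^ 4 = (s ^ 2) ^ 2 by ring, Real.sqrt_sq (by positivity)]
  have hQr : (384 : ℝ) ≤ Q := by exact_mod_cast hQ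
  have hQMr : (Q : ℝ) ^ 3 ≤ M := by exact_mod_cast hQM
  have hQ1 : (1 : ℝ) ≤ Q := by linarith
  have hMr : (1 : ℝ) ≤ M := (one_le_pow₀ hQ1).trans hQMr
  have hMpow : ∀ k : ℕ, k ≤ 6 → (M : ℝ) ^ k ≤ s := fun k hk =>
    (pow_le_pow_right₀ hMr hk).trans hM5
  have hMs : (M : ℝ) ≤ s := by simpa using hMpow 1 (by norm_num)
  have hs1 : 1 ≤ s := hMr.trans hMs
  have hQ25 : 5 * (Q : ℝ) ^ 2 ≤ s := by
    have : 5 * (Q : ℝ) ^ 2 ≤ (Q : ℝ) ^ 3 := by nlinarith [sq_nonneg (Q : ℝ)]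
    linarith
  set N := ⌊√X⌋₊ with hN
  have hN1 : (N : ℝ) ≤ s ^ 2 := by
    rw [← hsqrt]
    exact Nat.floor_le (Real.sqrt_nonneg _)
  have hN2 : s ^ 2 < N + 1 := by
    rw [← hsqrt]
    exact Nat.lt_floor_add_one _
  have hN0 : 0 < N := by
    refine Nat.floor_pos.2 ?_
    rw [hsqrt]
    exact one_le_pow₀ hs1
  have hη : X⁻¹ = (s ^ 4)⁻¹ := by rw [hs4]
  have hη4 : X⁻¹ ≤ 1 / 4 := by
    rw [hη, one_div]
    refine inv_anti₀ (by norm_num) ?_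
    have : (5 : ℝ) ≤ s := by nlinarith
    nlinarith [pow_le_pow_right₀ hs1 (show 1 ≤ 4 by norm_num)]
  -- With s = X^(1/4) the choices are η = s⁻⁴, τ = s⁻³ and N = ⌊s²⌋. Then Q²(η² + 4τ²) ≤ 5Q²s⁻⁶,
  -- which is Bη for B = 5Q²/s².
  have hmain := integral_norm_sq_error_le (inv_pos.2 hX0) hη4 (τ := (s ^ 3)⁻¹) (by positivity)
    (Q := Q) (N := N) hN0 (B := 5 * Q ^ 2 / s ^ 2)
    (by
      rw [← div_eq_mul_inv, div_le_one (by positivity)]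
      calc 4 * (Q : ℝ) ^ 2 ≤ s := by nlinarith
        _ ≤ s ^ 3 := le_self_pow₀ hs1 (by norm_num))
    (by
      rw [hη]
      have : (s ^ 4)⁻¹ ^ 2 ≤ (s ^ 6)⁻¹ := by
        rw [inv_pow, ← pow_mul]
        exact inv_anti₀ (by positivity) (pow_le_pow_right₀ hs1 (by norm_num))
      calc _ ≤ (Q : ℝ) ^ 2 * ((s ^ 6)⁻¹ + 4 * (s ^ 3)⁻¹ ^ 2) := by gcongr
        _ = _ := by
          field_simp
          ring)
    (by
      rw [div_le_one (by positivity)]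
      exact hQ25.trans (le_self_pow₀ hs1 (by norm_num)))
    (by
      rw [← div_eq_mul_inv, div_le_one hX0, ← hs4]
      calc (N : ℝ) ^ 2 ≤ (s ^ 2) ^ 2 := by gcongr
        _ = s ^ 4 := by ring)
    (by
      rw [← div_eq_mul_inv, one_le_div hX0, ← hs4]
      calc s ^ 4 = (s ^ 2) ^ 2 := by ring
        _ ≤ ((N : ℝ) + 1) ^ 2 := by gcongr) M
  refine hmain.trans ?_
  have hM0 : 0 < M := by exact_mod_cast (by linarith : (0 : ℝ) < M)
  have hcount := sum_quadCount_div_le (N := N) hM0 (by omega : 0 < Q)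
  have hlogN : Real.log N ≤ Real.log X := by
    refine Real.log_le_log (by exact_mod_cast hN0) (hN1.trans ?_)
    rw [← hs4]
    exact pow_le_pow_right₀ hs1 (by norm_num)
  have hl0 : 0 ≤ Real.log (2 * M ^ 2 : ℕ) := Real.log_natCast_nonneg _
  have hpi := Real.pi_pos
  refine add_le_add ?_ ?_
  · rw [div_inv_eq_mul]
    calc _ = 24 * 11 ^ 4 * Real.pi * X * ∑ q ∈ Ioc Q N, (quadCount M q : ℝ) / q := by ring
      _ ≤ 24 * 11 ^ 4 * Real.pi * X * (17 * (M : ℝ) ^ 2 * (1 + Real.log (2 * M ^ 2 : ℕ)) ^ 2 *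
        (1 + Real.log N) + 8 * (M : ℝ) ^ 4 * (1 + Real.log (2 * M ^ 2 : ℕ)) ^ 2 / Q +
        4 * (M : ℝ) ^ 3 * (1 + Real.log (2 * M ^ 2 : ℕ))) := by gcongr
      _ ≤ _ := by gcongr
  · have hQ4 : (1 : ℝ) ≤ (Q : ℝ) ^ 4 := one_le_pow₀ hQ1
    have hs2 : (1 : ℝ) ≤ s ^ 2 := one_le_pow₀ hs1
    -- 147 = 80 + 60 + 7, and 43218 below is 2·147².
    have hE : 16 * (5 * (Q : ℝ) ^ 2 / s ^ 2) / X⁻¹ + 60 + 7 * (Q : ℝ) ^ 4 ≤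
        147 * ((Q : ℝ) ^ 4 * s ^ 2) := by
      have e : 16 * (5 * (Q : ℝ) ^ 2 / s ^ 2) / X⁻¹ = 80 * ((Q : ℝ) ^ 2 * s ^ 2) := by
        rw [hη]
        field_simp
        ring
      rw [e]
      have a1 : (Q : ℝ) ^ 2 * s ^ 2 ≤ (Q : ℝ) ^ 4 * s ^ 2 := by
        gcongr
        norm_num
      have a2 : 1 * 1 ≤ (Q : ℝ) ^ 4 * s ^ 2 := by gcongr
      have a3 : (Q : ℝ) ^ 4 * 1 ≤ (Q : ℝ) ^ 4 * s ^ 2 := by gcongr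
      linarith
    have hE2 : (16 * (5 * (Q : ℝ) ^ 2 / s ^ 2) / X⁻¹ + 60 + 7 * (Q : ℝ) ^ 4) ^ 2 *
        (2 * (s ^ 3)⁻¹ ^ 2) ≤ 43218 * (Q : ℝ) ^ 8 := by
      have hE0 : 0 ≤ 16 * (5 * (Q : ℝ) ^ 2 / s ^ 2) / X⁻¹ + 60 + 7 * (Q : ℝ) ^ 4 := by positivity
      calc _ ≤ (147 * ((Q : ℝ) ^ 4 * s ^ 2)) ^ 2 * (2 * (s ^ 3)⁻¹ ^ 2) := by gcongr
        _ = 43218 * (Q : ℝ) ^ 8 * (s ^ 2)⁻¹ := by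
          field_simp
          norm_num
        _ ≤ 43218 * (Q : ℝ) ^ 8 * 1 := by
          gcongr
          exact inv_le_one_of_one_le₀ hs2
        _ = _ := mul_one _
    have hQ8 : (1 : ℝ) ≤ (Q : ℝ) ^ 8 := one_le_pow₀ hQ1
    have hQ38 : (Q : ℝ) ^ 3 ≤ (Q : ℝ) ^ 8 := pow_le_pow_right₀ hQ1 (by norm_num)
    have hQ10 : (Q : ℝ) ^ 10 ≤ (M : ℝ) ^ 4 := by
      calc (Q : ℝ) ^ 10 ≤ (Q : ℝ) ^ 12 := pow_le_pow_right₀ hQ1 (by norm_num)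
        _ = ((Q : ℝ) ^ 3) ^ 4 := by ring
        _ ≤ _ := by gcongr
    -- 200000 exceeds 43218 + 2·4·11⁴ + 98. Since τ is s⁻³ rather than η = s⁻⁴, a whole factor s is
    -- spared to absorb M⁶.
    calc _ ≤ (200000 * (Q : ℝ) ^ 8) * (3 * (Q : ℝ) ^ 2 * (M : ℝ) ^ 4 * (Real.pi / (s ^ 3)⁻¹)) := by
          gcongr
          linarith
      _ = 600000 * (Q : ℝ) ^ 10 * (M : ℝ) ^ 4 * Real.pi * s ^ 3 := by
          rw [div_inv_eq_mul]
          ring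
      _ ≤ 600000 * (M : ℝ) ^ 4 * (M : ℝ) ^ 4 * Real.pi * s ^ 3 := by gcongr
      _ = 600000 * Real.pi * (M : ℝ) ^ 2 * s ^ 3 * (M : ℝ) ^ 6 := by ring
      _ ≤ 600000 * Real.pi * (M : ℝ) ^ 2 * s ^ 3 * s := by gcongr
      _ = 600000 * Real.pi * (M : ℝ) ^ 2 * X := by rw [← hs4]; ring
      _ ≤ 10 ^ 6 * Real.pi * (M : ℝ) ^ 2 * X := by gcongr; norm_num
      _ = _ := by ring

/-- The number of exceptional integers is bounded in terms of the parameters. -/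
theorem exists_E₀_le : ∃ C : ℝ, 0 < C ∧ ∀ (X Y : ℝ) (Q M : ℕ), 384 ≤ Q → Q ^ 3 ≤ M →
    (M : ℝ) ^ 6 ≤ X ^ (1 / 4 : ℝ) → 1 ≤ X → (M : ℝ) ≤ Y →
    (E₀ X Y : ℝ) ≤ C * (X / (M : ℝ) ^ 2 * (1 + Real.log (2 * M ^ 2 : ℕ)) ^ 2 *
      (1 + Real.log X + (M : ℝ) ^ 2 / Q + M)) := by
  set κ : ℝ := (Real.pi * Real.exp (-Real.pi) / 16) ^ 2 with hκ
  have hpi := Real.pi_pos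
  have hκ0 : 0 < κ := by positivity
  refine ⟨10 ^ 8 * Real.pi / κ + 2, by positivity, ?_⟩
  intro X Y Q M hQ hQM hM6 hX hMY
  have hX0 : 0 < X := by linarith
  obtain ⟨S, hS1, hS⟩ := card_exceptionalSet_le (X := X) hMY
  set s := X ^ (1 / 4 : ℝ) with hs
  have hs0 : 0 < s := Real.rpow_pos_of_pos hX0 _
  have hs4 : s ^ 4 = X := by
    rw [hs, ← Real.rpow_natCast, ← Real.rpow_mul hX0.le]
    norm_num
  have hsqrt : √X = s ^ 2 := by
    rw [← hs4, show s ^ 4 = (s ^ 2) ^ 2 by ring, Real.sqrt_sq (by positivity)]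
  have hM2 : 2 ≤ M := by
    have : Q ≤ Q ^ 3 := Nat.le_self_pow (by norm_num) Q
    omega
  have hM2r : (2 : ℝ) ≤ M := by exact_mod_cast hM2
  have hM1r : (1 : ℝ) ≤ M := by linarith
  have hM0r : (0 : ℝ) < M := by linarith
  have hQ0 : (0 : ℝ) < Q := by exact_mod_cast (by omega : 0 < Q)
  have hs1 : 1 ≤ s := (one_le_pow₀ hM1r).trans hM6
  have hM4X : 4 * (M : ℝ) ^ 2 ≤ X := by
    calc 4 * (M : ℝ) ^ 2 = 2 ^ 2 * (M : ℝ) ^ 2 := by norm_num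
      _ ≤ (M : ℝ) ^ 2 * (M : ℝ) ^ 2 := by gcongr
      _ = (M : ℝ) ^ 4 := by ring
      _ ≤ (M : ℝ) ^ 6 := pow_le_pow_right₀ hM1r (by norm_num)
      _ ≤ s := hM6
      _ ≤ s ^ 4 := le_self_pow₀ hs1 (by norm_num)
      _ = X := hs4
  have h1 := card_mul_le_integral_norm_sq hX0 hQ hQM hM4X hS
  have h2 := h1.trans (integral_norm_sq_error_le_of_pow_le hQ hQM hM6 hX)
  set l := 1 + Real.log (2 * M ^ 2 : ℕ) with hl
  have hl1 : 1 ≤ l := by linarith [Real.log_natCast_nonneg (2 * M ^ 2)]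
  have hl2 : l ≤ l ^ 2 := le_self_pow₀ hl1 (by norm_num)
  have hlX : 0 ≤ Real.log X := Real.log_nonneg hX
  set A := 1 + Real.log X + (M : ℝ) ^ 2 / Q + M with hA
  have hMQ : 0 ≤ (M : ℝ) ^ 2 / Q := by positivity
  have hA1 : 1 ≤ A := by linarith
  set U := X / (M : ℝ) ^ 2 * l ^ 2 * A with hU
  have hU0 : 0 ≤ U := by positivity
  have hcard : (#S : ℝ) ≤ 10 ^ 8 * Real.pi / κ * U := by
    rw [div_mul_eq_mul_div, le_div_iff₀ hκ0]
    have h3 : (#S : ℝ) * κ * (M : ℝ) ^ 4 ≤ 10 ^ 8 * Real.pi * U * (M : ℝ) ^ 4 := by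
      have e1 : 10 ^ 8 * Real.pi * U * (M : ℝ) ^ 4 =
          10 ^ 8 * Real.pi * X * (M : ℝ) ^ 2 * (l ^ 2 * A) := by
        rw [hU]
        field_simp
      have e2 : (#S : ℝ) * κ * (M : ℝ) ^ 4 =
          #S * (Real.pi * Real.exp (-Real.pi) * ((M : ℝ) ^ 2 / 16)) ^ 2 := by
        rw [hκ]
        ring
      rw [e1, e2]
      refine h2.trans ?_
      have e3 : 17 * (M : ℝ) ^ 2 * l ^ 2 * (1 + Real.log X) + 8 * (M : ℝ) ^ 4 * l ^ 2 / Q +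
          4 * (M : ℝ) ^ 3 * l ≤ 17 * (M : ℝ) ^ 2 * (l ^ 2 * A) := by
        have f1 : 8 * (M : ℝ) ^ 4 * l ^ 2 / Q = 8 * ((M : ℝ) ^ 2 * l ^ 2 * ((M : ℝ) ^ 2 / Q)) := by
          ring
        have f2 : 0 ≤ (M : ℝ) ^ 2 * l ^ 2 * ((M : ℝ) ^ 2 / Q) := by positivity
        have f3 : (M : ℝ) ^ 3 * l ≤ (M : ℝ) ^ 3 * l ^ 2 := by gcongr
        have f4 : 0 ≤ (M : ℝ) ^ 3 * l ^ 2 := by positivity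
        have f5 : 17 * (M : ℝ) ^ 2 * (l ^ 2 * A) = 17 * (M : ℝ) ^ 2 * l ^ 2 * (1 + Real.log X) +
            17 * ((M : ℝ) ^ 2 * l ^ 2 * ((M : ℝ) ^ 2 / Q)) + 17 * ((M : ℝ) ^ 3 * l ^ 2) := by
          rw [hA]
          ring
        rw [f1, f5]
        linarith
      have e4 : 1 * 1 ≤ l ^ 2 * A := by
        gcongr
        exact one_le_pow₀ hl1
      calc _ ≤ 24 * 11 ^ 4 * Real.pi * X * (17 * (M : ℝ) ^ 2 * (l ^ 2 * A)) +
            10 ^ 6 * Real.pi * X * (M : ℝ) ^ 2 * (1 * 1) := by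
            rw [one_mul, mul_one]
            gcongr
        _ ≤ 24 * 11 ^ 4 * Real.pi * X * (17 * (M : ℝ) ^ 2 * (l ^ 2 * A)) +
            10 ^ 6 * Real.pi * X * (M : ℝ) ^ 2 * (l ^ 2 * A) := by gcongr
        _ = (24 * 11 ^ 4 * 17 + 10 ^ 6) * (Real.pi * X * (M : ℝ) ^ 2 * (l ^ 2 * A)) := by ring
        _ ≤ 10 ^ 8 * (Real.pi * X * (M : ℝ) ^ 2 * (l ^ 2 * A)) := by
            gcongr
            norm_num
        _ = _ := by ring
    exact le_of_mul_le_mul_right h3 (by positivity)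
  have hT : (M : ℝ) ^ 2 * ((⌊√X⌋₊ : ℝ) + 1) ≤ 2 * U := by
    have f1 : (⌊√X⌋₊ : ℝ) ≤ s ^ 2 := by
      rw [← hsqrt]
      exact Nat.floor_le (Real.sqrt_nonneg _)
    have f2 : (1 : ℝ) ≤ s ^ 2 := one_le_pow₀ hs1
    have f3 : (M : ℝ) ^ 2 * s ^ 2 ≤ X / (M : ℝ) ^ 2 := by
      rw [le_div_iff₀ (by positivity)]
      calc (M : ℝ) ^ 2 * s ^ 2 * (M : ℝ) ^ 2 = (M : ℝ) ^ 4 * s ^ 2 := by ring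
        _ ≤ s * s ^ 2 := by
          gcongr
          exact (pow_le_pow_right₀ hM1r (by norm_num)).trans hM6
        _ = s ^ 3 := by ring
        _ ≤ s ^ 4 := pow_le_pow_right₀ hs1 (by norm_num)
        _ = X := hs4
    have f4 : X / (M : ℝ) ^ 2 * 1 * 1 ≤ U := by
      rw [hU]
      gcongr
      exact one_le_pow₀ hl1
    calc _ ≤ (M : ℝ) ^ 2 * (s ^ 2 + s ^ 2) := by gcongr
      _ = 2 * ((M : ℝ) ^ 2 * s ^ 2) := by ring
      _ ≤ _ := by linarith
  have hE : (E₀ X Y : ℝ) ≤ #S + (M : ℝ) ^ 2 * ((⌊√X⌋₊ : ℝ) + 1) := by exact_mod_cast hS1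
  calc (E₀ X Y : ℝ) ≤ 10 ^ 8 * Real.pi / κ * U + 2 * U := by linarith
    _ = _ := by ring

end

/-! ### Choice of parameters and conclusion -/

/-- Supplies the largest Q allowed by Q³ ≤ M, since M²/Q should be as small as possible. -/
theorem exists_cube_root (M : ℕ) : ∃ Q : ℕ, Q ^ 3 ≤ M ∧ M < (Q + 1) ^ 3 := by
  induction M with
  | zero => exact ⟨0, by norm_num⟩
  | succ M ih =>
    obtain ⟨Q, h1, h2⟩ := ih
    rcases Nat.lt_or_ge (M + 1) ((Q + 1) ^ 3) with h | h
    · exact ⟨Q, by omega, h⟩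
    · refine ⟨Q + 1, h, lt_of_le_of_lt (Nat.succ_le_of_lt h2) ?_⟩
      exact Nat.pow_lt_pow_left (by omega) (by norm_num)

theorem theorem6p1 (δ : ℝ) (hδ : 0 < δ) (hδ' : δ < 1 / 11) :
    ∃ C X₀ : ℝ, 0 < C ∧ ∀ X Y : ℝ, X₀ ≤ X →
      (Real.log X) ^ (1 / 2 : ℝ) * (Real.log (Real.log X)) ^ (3 / 2 : ℝ) ≤ Y →
      Y ≤ (Real.log X) ^ (1 / 2 + δ) →
      (E₀ X Y : ℝ) ≤ C * (X * (Y ^ 2)⁻¹ * Real.log X * (Real.log (Real.log X)) ^ 3) := by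
  obtain ⟨C, hC, hE⟩ := exists_E₀_le
  have hlog := Real.tendsto_log_atTop
  have hev : ∀ᶠ X : ℝ in Filter.atTop, 1 ≤ X ∧ (10 ^ 8 : ℝ) ^ 2 ≤ Real.log X ∧
      1 ≤ Real.log (Real.log X) ∧ Real.log X ^ 6 ≤ X ^ (1 / 4 : ℝ) := by
    have h1 : (fun x : ℝ => Real.log x ^ (6 : ℝ)) =o[Filter.atTop] fun x => x ^ (1 / 4 : ℝ) :=
      isLittleO_log_rpow_rpow_atTop 6 (by norm_num)
    filter_upwards [Filter.eventually_ge_atTop 1, hlog.eventually_ge_atTop ((10 ^ 8 : ℝ) ^ 2),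
      (hlog.comp hlog).eventually_ge_atTop 1, h1.bound (c := 1) one_pos] with X a b c d
    refine ⟨a, b, c, ?_⟩
    rw [one_mul, Real.norm_of_nonneg (Real.rpow_nonneg (by linarith : (0 : ℝ) ≤ X) _)] at d
    refine le_trans (le_of_eq ?_) ((le_abs_self _).trans d)
    rw [← Real.rpow_natCast]
    norm_num
  obtain ⟨X₀, hX₀⟩ := Filter.eventually_atTop.1 hev
  -- 320 = 4·4²·5: passing from M to Y, the square of 1 + log(2M²) ≤ 4 log log X, and the bracket
  -- bounded by 5 log X.
  refine ⟨C * 320, X₀, by positivity, ?_⟩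
  intro X Y hX hY1 hY2
  obtain ⟨hX1, hL, hLL, hL6⟩ := hX₀ X hX
  set L := Real.log X with hLdef
  set LL := Real.log L with hLLdef
  have hL1 : 1 ≤ L := le_trans (by norm_num) hL
  have hL0 : 0 < L := by linarith
  have hYbig : (10 ^ 8 : ℝ) ≤ Y := by
    refine le_trans ?_ hY1
    have a1 : (10 ^ 8 : ℝ) ≤ L ^ (1 / 2 : ℝ) := by
      rw [← Real.sqrt_eq_rpow]
      exact Real.le_sqrt_of_sq_le hL
    have a2 : 1 ≤ LL ^ (3 / 2 : ℝ) := Real.one_le_rpow hLL (by norm_num)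
    calc (10 ^ 8 : ℝ) = 10 ^ 8 * 1 := (mul_one _).symm
      _ ≤ _ := by gcongr
  have hY0 : 0 < Y := by linarith
  -- Here 1/2 + 1/11 < 3/5. The exponent 3/5 is the natural limit: with Q about M^(1/3), the term
  -- M²/Q = M^(5/3) is ≪ L exactly when M ≪ L^(3/5).
  have hY5 : Y ^ 5 ≤ L ^ 3 := by
    have a1 : Y ≤ L ^ (3 / 5 : ℝ) :=
      hY2.trans (Real.rpow_le_rpow_of_exponent_le hL1 (by linarith))
    calc Y ^ 5 ≤ (L ^ (3 / 5 : ℝ)) ^ 5 := by gcongr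
      _ = L ^ 3 := by
        rw [← Real.rpow_natCast, ← Real.rpow_mul hL0.le, ← Real.rpow_natCast]
        norm_num
  set M := ⌊Y⌋₊ with hM
  have hMY : (M : ℝ) ≤ Y := Nat.floor_le hY0.le
  have hYM : Y < M + 1 := Nat.lt_floor_add_one _
  have hM1 : (1 : ℝ) ≤ M := by linarith
  have hM0 : (0 : ℝ) < M := by linarith
  have hY2M : Y ≤ 2 * M := by linarith
  have hM5 : (M : ℝ) ^ 5 ≤ L ^ 3 := le_trans (by gcongr) hY5
  have hML : (M : ℝ) ≤ L := by
    refine le_of_pow_le_pow_left₀ (by norm_num : 5 ≠ 0) hL0.le (hM5.trans ?_)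
    exact pow_le_pow_right₀ hL1 (by norm_num)
  have hM6 : (M : ℝ) ^ 6 ≤ X ^ (1 / 4 : ℝ) := le_trans (by gcongr) hL6
  obtain ⟨Q, hQ1, hQ2⟩ := exists_cube_root M
  -- 384³ < 10⁸, and M + 1 > Y ≥ 10⁸.
  have hQ : 384 ≤ Q := by
    by_contra hcon
    have a1 : (Q + 1) ^ 3 ≤ 384 ^ 3 := Nat.pow_le_pow_left (by omega) 3
    have a2 : (10 ^ 8 : ℝ) < M + 1 := by linarith
    have a3 : 10 ^ 8 < M + 1 := by exact_mod_cast a2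
    omega
  have hQr : (384 : ℝ) ≤ Q := by exact_mod_cast hQ
  have hQ0 : (0 : ℝ) < Q := by linarith
  -- After cubing, M⁶ = M⁵·M with M⁵ ≤ L³ and M ≤ (Q + 1)³ ≤ (2Q)³.
  have hMQ : (M : ℝ) ^ 2 / Q ≤ 2 * L := by
    refine le_of_pow_le_pow_left₀ (by norm_num : 3 ≠ 0) (by positivity) ?_
    have a1 : (M : ℝ) ≤ (2 * Q) ^ 3 := by
      have : (M : ℝ) ≤ ((Q : ℝ) + 1) ^ 3 := by exact_mod_cast hQ2.le
      refine this.trans ?_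
      gcongr
      linarith
    rw [div_pow, div_le_iff₀ (by positivity)]
    calc ((M : ℝ) ^ 2) ^ 3 = (M : ℝ) ^ 5 * M := by ring
      _ ≤ L ^ 3 * (2 * Q) ^ 3 := by gcongr
      _ = _ := by ring
  have hl : 1 + Real.log (2 * M ^ 2 : ℕ) ≤ 4 * LL := by
    have a1 : Real.log (2 * M ^ 2 : ℕ) = Real.log 2 + 2 * Real.log M := by
      push_cast
      rw [Real.log_mul (by norm_num) (by positivity), Real.log_pow]
      norm_num
    have a2 : Real.log M ≤ LL := Real.log_le_log hM0 hML
    have a3 := Real.log_two_lt_d9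
    linarith
  have hl0 : 0 ≤ 1 + Real.log (2 * M ^ 2 : ℕ) := by
    linarith [Real.log_natCast_nonneg (2 * M ^ 2)]
  have hmain := hE X Y Q M hQ hQ1 hM6 hX1 hMY
  refine hmain.trans ?_
  rw [mul_assoc C]
  refine mul_le_mul_of_nonneg_left ?_ hC.le
  have hinv : ((M : ℝ) ^ 2)⁻¹ ≤ 4 * (Y ^ 2)⁻¹ := by
    have : Y ^ 2 ≤ (2 * M) ^ 2 := by gcongr
    rw [← div_eq_mul_inv, inv_eq_one_div, div_le_div_iff₀ (by positivity) (by positivity)]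
    linarith
  -- The argument yields the square of log log X; the third power follows as log log X ≥ 1.
  have hLL3 : LL ^ 2 ≤ LL ^ 3 := pow_le_pow_right₀ hLL (by norm_num)
  calc X / (M : ℝ) ^ 2 * (1 + Real.log (2 * M ^ 2 : ℕ)) ^ 2 * (1 + L + (M : ℝ) ^ 2 / Q + M)
      = X * ((M : ℝ) ^ 2)⁻¹ * (1 + Real.log (2 * M ^ 2 : ℕ)) ^ 2 *
        (1 + L + (M : ℝ) ^ 2 / Q + M) := by rw [div_eq_mul_inv]
    _ ≤ X * (4 * (Y ^ 2)⁻¹) * (4 * LL) ^ 2 * (L + L + 2 * L + L) := by gcongr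
    _ = 320 * (X * (Y ^ 2)⁻¹ * L * LL ^ 2) := by ring
    _ ≤ 320 * (X * (Y ^ 2)⁻¹ * L * LL ^ 3) := by gcongr
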